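/- Let $0<\alpha<1$ and $-1<\mu<0$. There is a constant $c>0$, depending only on $\alpha$ and $\mu$, for which the following holds. Setting. Let $\Omega\subset\mathbb R^d$, $d\in\{1,2\}$, be a bounded domain, $\|\cdot\|$ and $(\cdot,\cdot)$ the norm and inner product of $L^2(\Omega)$, and let $Av=-\nabla\cdot(a\nabla v)+bv$ (homogeneous Dirichlet condition) be a self-adjoint positive definite second-order elliptic operator: $a,b$ are bounded and measurable, $a$ is symmetric and uniformly elliptic, and the bilinear form $A(v,w)=\int_\Omega (a\nabla v\cdot\nabla w+bvw)\,dx$ satisfies $A(v,v)>0$ for $0\ne v\in H^1_0(\Omega)$. Let $X_h\subset H_0^1(\Omega)$ be the space of continuous piecewise linear functions on a triangulation of $\Omega$, $P_h$ the $L^2$-projection onto $X_h$, and $A_h:X_h\to X_h$ be given by $(A_h\varphi,\psi)=A(\varphi,\psi)$. Let $T>0$. Source. Let $u^0=0$ and $f(t)=t^\mu g(t)$ with $g\in W^{1,\infty}(0,T;L^2(\Omega))$ having a second weak derivative $g''\in L^1_{\rm loc}(0,T;L^2(\Omega))$ such that $$\int_0^t(t-\zeta)^{\alpha-1}\zeta^\mu\|g''(\zeta)\|\,d\zeta<\infty\quad\text{for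 all } t\in(0,T],\qquad \int_0^T\zeta^{\frac{\mu-1}{2}}\|g''(\zeta)\|\,d\zeta<\infty .$$ Here $g$ and $g'$ denote the continuous representatives on $[0,T]$. Set $f=0$ for $t\le 0$. Semidiscrete solution. Let $u_h\in C((0,T];X_h)\cap L^1(0,T;X_h)$ solve ${}^{C}D_t^\alpha u_h+A_hu_h=P_hf$, $u_h(0)=0$, understood in the time-integrated form $${}^{C}D_t^\alpha U_h(t)+A_hU_h(t)=F_h(t),\quad t\in(0,T],\qquad U_h(t)=\int_0^tu_h(\xi)\,d\xi,\quad F_h(t)=\int_0^tP_hf(\xi)\,d\xi,$$ where ${}^{C}D_t^\alpha v(t)=\frac1{\Gamma(1-\alpha)}\int_0^t(t-\zeta)^{-\alpha}v'(\zeta)\,d\zeta$ is the Caputo derivative. Scheme CN-II. Let $N\ge1$, $\tau=T/N$, $t_n=n\tau$, $\tilde F_h(t)=\int_0^tF_h(\xi)\,d\xi$ (zero for $t\le0$), $D_\tau v(t)=\tau^{-1}\big(\tfrac32v(t)-2v(t-\tau)+\tfrac12v(t-2\tau)\big)$, and $\sigma_0=1$, $\sigma_j=(1-\frac{\alpha+1}{j})\sigma_{j-1}$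 for $j\ge 1$. Let $\tilde U_h^n\in X_h$, with $\tilde U_h^n=0$ for $n\le0$, satisfy for $1\le n\le N$ $$\tau^{-\alpha}\sum_{j=0}^n\sigma_j\tilde U_h^{n-j}+\Big(1-\frac\alpha2\Big)A_h\tilde U_h^n+\frac\alpha2A_h\tilde U_h^{n-1}=\Big(1-\frac\alpha2\Big)D_\tau\tilde F_h(t_n)+\frac\alpha2D_\tau\tilde F_h(t_{n-1}),$$ $$\tilde u_h^n=\tau^{-1}\Big(\frac32\tilde U_h^n-2\tilde U_h^{n-1}+\frac12\tilde U_h^{n-2}\Big).$$ Conclusion. For all $1\le n\le N$, $$\|u_h(t_n)-\tilde u_h^n\|\le c\,\tau^2\Big(t_n^{\alpha+\mu-2}\|g(0)\|+t_n^{\alpha+\mu-1}\|g'(0)\|+\int_0^{t_n}(t_n-\zeta)^{\alpha-1}\zeta^\mu\|g''(\zeta)\|\,d\zeta+t_n^{\alpha+\frac{\mu-1}2}\int_0^{t_n}\zeta^{\frac{\mu-1}2}\|g''(\zeta)\|\,d\zeta\Big).$$ -/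

import Mathlib

open MeasureTheory Set Filter Topology
open scoped ContDiff

noncomputable section

namespace SubDiffusion

/-- Euclidean space `ℝᵈ`. -/
abbrev E (d : ℕ) : Type := EuclideanSpace ℝ (Fin d)

/-- The real Hilbert space `L²(Ω)`. -/
abbrev L2 {d : ℕ} (Ω : Set (E d)) : Type := Lp ℝ 2 ((volume : Measure (E d)).restrict Ω)

/-- The space `L²(Ω; ℝᵈ)` of square integrable vector fields. -/
abbrev L2Vec {d : ℕ} (Ω : Set (E d)) : Type :=
  Lp (E d) 2 ((volume : Measure (E d)).restrict Ω)

/-! ### The domain, the space `H¹₀(Ω)` and the elliptic operator -/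

/-- A bounded domain: a bounded, open, connected (in particular nonempty) set. -/
structure IsBoundedDomain {d : ℕ} (Ω : Set (E d)) : Prop where
  isOpen : IsOpen Ω
  isConnected : IsConnected Ω
  isBounded : Bornology.IsBounded Ω

/-- The pairs `(φ, ∇φ)` with `φ ∈ C_c^∞(Ω)`, as a subspace of `L²(Ω) × L²(Ω; ℝᵈ)`. -/
def testGraph {d : ℕ} (Ω : Set (E d)) : Submodule ℝ (L2 Ω × L2Vec Ω) where
  carrier := {p | ∃ φ : E d → ℝ, ContDiff ℝ ∞ φ ∧ HasCompactSupport φ ∧ tsupport φ ⊆ Ω ∧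
    p.1 =ᵐ[(volume : Measure (E d)).restrict Ω] φ ∧
    p.2 =ᵐ[(volume : Measure (E d)).restrict Ω] gradient φ}
  zero_mem' := by
    refine ⟨fun _ => 0, contDiff_const, HasCompactSupport.zero, ?_, ?_, ?_⟩
    · simp [tsupport]
    · exact Lp.coeFn_zero _ _ _
    · rw [gradient_fun_const']
      exact Lp.coeFn_zero _ _ _
  add_mem' := by
    rintro p q ⟨φ, hφ, hφc, hφs, hp1, hp2⟩ ⟨ψ, hψ, hψc, hψs, hq1, hq2⟩
    refine ⟨φ + ψ, hφ.add hψ, hφc.add hψc,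
      (tsupport_add φ ψ).trans (union_subset hφs hψs), ?_, ?_⟩
    · exact (Lp.coeFn_add _ _).trans (hp1.add hq1)
    · refine (Lp.coeFn_add _ _).trans ((hp2.add hq2).trans (Eventually.of_forall fun x => ?_))
      have h1 : DifferentiableAt ℝ φ x := (hφ.differentiable (by simp)) x
      have h2 : DifferentiableAt ℝ ψ x := (hψ.differentiable (by simp)) x
      simp [gradient, fderiv_add h1 h2]
  smul_mem' := by
    rintro r p ⟨φ, hφ, hφc, hφs, hp1, hp2⟩
    refine ⟨r • φ, hφ.const_smul r, hφc.smul_left (f := fun _ => r),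
      (tsupport_smul_subset_right (fun _ => r) φ).trans hφs, ?_, ?_⟩
    · exact (Lp.coeFn_smul _ _).trans (hp1.const_smul r)
    · refine (Lp.coeFn_smul _ _).trans ((hp2.const_smul r).trans
        (Eventually.of_forall fun x => ?_))
      have h1 : DifferentiableAt ℝ φ x := (hφ.differentiable (by simp)) x
      simp [gradient, fderiv_const_smul h1]

/-- The pairs `(v, ∇v)` with `v ∈ H¹₀(Ω)`: the `H¹`-closure of the test functions. -/
def sobolevGraph {d : ℕ} (Ω : Set (E d)) : Submodule ℝ (L2 Ω × L2Vec Ω) :=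
  (testGraph Ω).topologicalClosure

/-- The Sobolev space `H¹₀(Ω)`, as a subspace of `L²(Ω)`. -/
def H10 {d : ℕ} (Ω : Set (E d)) : Submodule ℝ (L2 Ω) :=
  (sobolevGraph Ω).map (LinearMap.fst ℝ (L2 Ω) (L2Vec Ω))

open Classical in
/-- The weak gradient of `v ∈ H¹₀(Ω)` (and `0` for `v ∉ H¹₀(Ω)`). -/
def weakGrad {d : ℕ} (Ω : Set (E d)) (v : L2 Ω) : L2Vec Ω :=
  if h : ∃ G : L2Vec Ω, (v, G) ∈ sobolevGraph Ω then h.choose else 0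

/-- The bilinear form `A(v, w) = ∫_Ω (a ∇v · ∇w + b v w) dx` of the operator
`A v = -∇ · (a ∇v) + b v`. -/
def ellipticForm {d : ℕ} (Ω : Set (E d)) (a : E d → (E d →L[ℝ] E d)) (b : E d → ℝ)
    (v w : L2 Ω) : ℝ :=
  ∫ x in Ω, (inner ℝ (a x (weakGrad Ω v x)) (weakGrad Ω w x) + b x * v x * w x)

/-- The operator `A v = -∇ · (a ∇v) + b v` on `Ω` with homogeneous Dirichlet condition is a
self-adjoint, positive definite, second-order elliptic operator: the coefficients are bounded and
measurable, `a` is symmetric and uniformly elliptic, and `A(v, v) > 0` for `0 ≠ v ∈ H¹₀(Ω)`. -/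
structure IsPosDefElliptic {d : ℕ} (Ω : Set (E d)) (a : E d → (E d →L[ℝ] E d))
    (b : E d → ℝ) : Prop where
  a_meas : AEStronglyMeasurable a ((volume : Measure (E d)).restrict Ω)
  b_meas : AEStronglyMeasurable b ((volume : Measure (E d)).restrict Ω)
  a_bdd : ∃ M : ℝ, ∀ x ∈ Ω, ‖a x‖ ≤ M
  b_bdd : ∃ M : ℝ, ∀ x ∈ Ω, |b x| ≤ M
  a_symm : ∀ x ∈ Ω, ∀ ξ η : E d, inner ℝ (a x ξ) η = inner ℝ ξ (a x η)
  a_elliptic : ∃ m : ℝ, 0 < m ∧ ∀ x ∈ Ω, ∀ ξ : E d, m * ‖ξ‖ ^ 2 ≤ inner ℝ (a x ξ) ξ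
  pos_def : ∀ v ∈ H10 Ω, v ≠ 0 → 0 < ellipticForm Ω a b v v

/-! ### The finite element space -/

/-- `K` is a (conforming) triangulation of `Ω`: finitely many nondegenerate `d`-simplices
(with their faces), meeting along common faces, whose union is the closure of `Ω`. -/
structure IsTriangulation {d : ℕ} (Ω : Set (E d)) (K : Geometry.SimplicialComplex ℝ (E d)) :
    Prop where
  finite : K.faces.Finite
  pure : ∀ s ∈ K.faces, ∃ t ∈ K.faces, s ⊆ t ∧ t.card = d + 1
  space_eq : K.space = closure Ω

/-- `w` is continuous on `closure Ω` and affine on each simplex of `K`. -/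
def IsPiecewiseLinear {d : ℕ} (Ω : Set (E d)) (K : Geometry.SimplicialComplex ℝ (E d))
    (w : E d → ℝ) : Prop :=
  ContinuousOn w (closure Ω) ∧
    ∀ s ∈ K.faces, ∃ l : E d →ᵃ[ℝ] ℝ, EqOn w l (convexHull ℝ (s : Set (E d)))

/-- The linear finite element space `X_h ⊂ H¹₀(Ω)`: the elements of `H¹₀(Ω)` that are continuous
and piecewise linear with respect to the triangulation `K`. -/
def feSpace {d : ℕ} (Ω : Set (E d)) (K : Geometry.SimplicialComplex ℝ (E d)) :
    Submodule ℝ (L2 Ω) where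
  carrier := {v | v ∈ H10 Ω ∧ ∃ w : E d → ℝ, IsPiecewiseLinear Ω K w ∧
    v =ᵐ[(volume : Measure (E d)).restrict Ω] w}
  zero_mem' := ⟨zero_mem _, 0, ⟨continuousOn_const, fun _ _ => ⟨0, fun _ _ => rfl⟩⟩,
    Lp.coeFn_zero _ _ _⟩
  add_mem' := by
    rintro v v' ⟨hv, w, ⟨hwc, hwl⟩, hvw⟩ ⟨hv', w', ⟨hwc', hwl'⟩, hvw'⟩
    refine ⟨add_mem hv hv', w + w', ⟨hwc.add hwc', fun s hs => ?_⟩,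
      (Lp.coeFn_add _ _).trans (hvw.add hvw')⟩
    obtain ⟨l, hl⟩ := hwl s hs
    obtain ⟨l', hl'⟩ := hwl' s hs
    exact ⟨l + l', fun x hx => by simp [hl hx, hl' hx]⟩
  smul_mem' := by
    rintro r v ⟨hv, w, ⟨hwc, hwl⟩, hvw⟩
    refine ⟨Submodule.smul_mem _ r hv, r • w, ⟨hwc.const_smul r, fun s hs => ?_⟩,
      (Lp.coeFn_smul _ _).trans (hvw.const_smul r)⟩
    obtain ⟨l, hl⟩ := hwl s hs
    exact ⟨r • l, fun x hx => by simp [hl hx]⟩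

/-! ### The semidiscrete problem -/

/-- The left Caputo derivative `(1 / Γ(1-α)) ∫_0^t (t-ζ)^{-α} v'(ζ) dζ`. -/
def caputoDeriv {X : Type*} [NormedAddCommGroup X] [NormedSpace ℝ X] (α : ℝ) (v : ℝ → X)
    (t : ℝ) : X :=
  (Real.Gamma (1 - α))⁻¹ • ∫ ζ in (0 : ℝ)..t, (t - ζ) ^ (-α) • deriv v ζ

/-- The primitive `∫_0^t v(ξ) dξ`. -/
def primitive {X : Type*} [NormedAddCommGroup X] [NormedSpace ℝ X] (v : ℝ → X) (t : ℝ) : X :=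
  ∫ ξ in (0 : ℝ)..t, v ξ

/-- `u = u_h ∈ C((0,T]; X_h) ∩ L¹(0,T; X_h)` solves the semidiscrete problem
`ᶜD^α u_h + A_h u_h = P_h f`, `u_h(0) = P_h u⁰`, in its time-integrated form: with
`U_h = ∫_0^t u_h` and `F_h = ∫_0^t P_h f`,
`ᶜD^α U_h + A_h U_h = F_h + D_t (t^{2-α} / Γ(3-α)) P_h u⁰` on `(0, T]`.
Here `P_h` is the `L²`-projection onto `X_h` and `(A_h φ, ψ) = A(φ, ψ)` on `X_h`, so that the
equation in `X_h` is expressed by testing with all `φ ∈ X_h`. -/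
structure IsSemidiscreteSolution {d : ℕ} {Ω : Set (E d)} (X : Submodule ℝ (L2 Ω))
    (A : L2 Ω → L2 Ω → ℝ) (α T : ℝ) (u0 : L2 Ω) (f u : ℝ → L2 Ω) : Prop where
  mem : ∀ t ∈ Ioc 0 T, u t ∈ X
  continuousOn : ContinuousOn u (Ioc 0 T)
  integrableOn : IntegrableOn u (Ioc 0 T)
  equation : ∀ t ∈ Ioc 0 T, ∀ φ ∈ X,
    inner ℝ (caputoDeriv α (primitive u) t) φ + A (primitive u t) φ =
      inner ℝ (primitive f t) φ
        + deriv (fun s : ℝ => s ^ (2 - α) / Real.Gamma (3 - α)) t * inner ℝ u0 φ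

/-! ### The Crank-Nicolson scheme -/

/-- The Grünwald-Letnikov coefficients: `σ_0 = 1`, `σ_j = (1 - (α + 1) / j) σ_{j-1}`. -/
def glCoeff (α : ℝ) : ℕ → ℝ
  | 0 => 1
  | j + 1 => (1 - (α + 1) / ((j : ℝ) + 1)) * glCoeff α j

/-- The second-order BDF operator `D_τ v(t) = (3/2 v(t) - 2 v(t-τ) + 1/2 v(t-2τ)) / τ`. -/
def bdf2 {X : Type*} [NormedAddCommGroup X] [NormedSpace ℝ X] (τ : ℝ) (v : ℝ → X) (t : ℝ) : X :=
  τ⁻¹ • ((3 / 2 : ℝ) • v t - (2 : ℝ) • v (t - τ) + (1 / 2 : ℝ) • v (t - 2 * τ))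

/-- The function `t ↦ t^{2-α} / Γ(3-α)`, extended by zero to `t ≤ 0`. -/
def initialWeight (α t : ℝ) : ℝ :=
  if 0 < t then t ^ (2 - α) / Real.Gamma (3 - α) else 0

/-- The family `U k = Ũ_h^k ∈ X_h` (equal to zero for `k ≤ 0`) solves the first line of the scheme
CN-II with `N` steps of size `τ` and `t_n = n τ`:
`τ^{-α} ∑_{j=0}^n σ_j Ũ_h^{n-j} + (1 - α/2) A_h Ũ_h^n + (α/2) A_h Ũ_h^{n-1}`
`= (1 - α/2) D_τ F̃_h^n + (α/2) D_τ F̃_h^{n-1} + (1 - α/2) D_τ (t_n^{2-α} / Γ(3-α)) P_h u⁰`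
`+ (α/2) D_τ (t_{n-1}^{2-α} / Γ(3-α)) P_h u⁰` for `1 ≤ n ≤ N`,
tested with all `φ ∈ X_h`. Here `F̃ = ∫_0^t ∫_0^ξ f` and `F̃_h = P_h F̃`; the source `f` has to be
extended by zero to `t ≤ 0`. -/
structure IsCNSolution {d : ℕ} {Ω : Set (E d)} (X : Submodule ℝ (L2 Ω))
    (A : L2 Ω → L2 Ω → ℝ) (α τ : ℝ) (N : ℕ) (u0 : L2 Ω) (f : ℝ → L2 Ω) (U : ℤ → L2 Ω) :
    Prop where
  mem : ∀ k, U k ∈ X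
  zero : ∀ k ≤ 0, U k = 0
  equation : ∀ n : ℕ, 1 ≤ n → n ≤ N → ∀ φ ∈ X,
    inner ℝ (τ ^ (-α) • ∑ j ∈ Finset.range (n + 1), glCoeff α j • U ((n : ℤ) - (j : ℤ))) φ
        + (1 - α / 2) * A (U (n : ℤ)) φ + α / 2 * A (U ((n : ℤ) - 1)) φ =
      (1 - α / 2) * inner ℝ (bdf2 τ (primitive (primitive f)) ((n : ℝ) * τ)) φ
        + α / 2 * inner ℝ (bdf2 τ (primitive (primitive f)) (((n : ℝ) - 1) * τ)) φ
        + (1 - α / 2) * bdf2 τ (initialWeight α) ((n : ℝ) * τ) * inner ℝ u0 φ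
        + α / 2 * bdf2 τ (initialWeight α) (((n : ℝ) - 1) * τ) * inner ℝ u0 φ

/-- The second line of the scheme:
`ũ_h^n = (3/2 Ũ_h^n - 2 Ũ_h^{n-1} + 1/2 Ũ_h^{n-2}) / τ`. -/
def cnApprox {X : Type*} [NormedAddCommGroup X] [NormedSpace ℝ X] (τ : ℝ) (U : ℤ → X)
    (n : ℤ) : X :=
  τ⁻¹ • ((3 / 2 : ℝ) • U n - (2 : ℝ) • U (n - 1) + (1 / 2 : ℝ) • U (n - 2))

/-! ### The source term -/

/-- `g'` is the weak derivative of `g` on `(0, T)` (functions with values in a Banach space). -/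
def HasWeakDeriv {X : Type*} [NormedAddCommGroup X] [NormedSpace ℝ X] (T : ℝ)
    (g g' : ℝ → X) : Prop :=
  LocallyIntegrableOn g (Ioo 0 T) ∧ LocallyIntegrableOn g' (Ioo 0 T) ∧
    ∀ φ : ℝ → ℝ, ContDiff ℝ ∞ φ → HasCompactSupport φ → tsupport φ ⊆ Ioo 0 T →
      ∫ t in Ioo 0 T, deriv φ t • g t = -∫ t in Ioo 0 T, φ t • g' t

/-- `g ∈ W^{1,∞}(0, T; X)` with weak derivative `g'`. -/
def MemW1Infty {X : Type*} [NormedAddCommGroup X] [NormedSpace ℝ X] (T : ℝ)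
    (g g' : ℝ → X) : Prop :=
  MemLp g ⊤ (volume.restrict (Ioo 0 T)) ∧ MemLp g' ⊤ (volume.restrict (Ioo 0 T)) ∧
    HasWeakDeriv T g g'

/-- The source `f(t) = t^μ g(t)` for `t > 0`, extended by zero to `t ≤ 0`. -/
def singularSource {X : Type*} [NormedAddCommGroup X] [NormedSpace ℝ X] (μ : ℝ) (g : ℝ → X)
    (t : ℝ) : X :=
  if 0 < t then t ^ μ • g t else 0

end SubDiffusion

end

/-!
The symmetric positive definite operator `A_h` is diagonalised on the finite dimensional space `X_h`
(`finiteDimensional_feSpace`, `exists_orthonormalBasis_of_symmetric`), so that both the semidiscrete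
and the fully discrete problem split into scalar problems, one for each eigenvalue `λ > 0`. All
bounds for the scalar problem are uniform in `λ ≥ 0`, and Bessel's inequality in the form
`norm_le_of_inner_eq` puts the components back together.

**Both solutions are convolutions with the source.** For the scalar problem the exact solution is the
convolution of `f` with the Mittag-Leffler kernel `exactKernel` (`eq_integral_exactKernel_mul`).
Solving the recursion of the scheme by generating functions (`cnApprox_eq_sum`), and writing a
twofold primitive as a convolution with a ramp (`sum_coeff_mul_primitive`), the discrete solution at
`t_n` is the convolution of `f` with the rescaled `discreteKernel`. Hence the error at `t_n` is
`∫ k_τ (t_n - s) f(s) ds`, where `k_τ(r) = τ^(α-1) k(r/τ)` and `k` is the `errorKernel` for step `1`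
and the parameter `λ τ^α` (`error_eq_integral_errorKernel`).

**The error kernel.** Its Laplace transform is
`errorSymbol = 1 / (z^α + λ) - (y + y²/2)² q / (z² (y^α + λ q))` with `y = 1 - e^{-z}` and
`q = 1 - α y / 2`. The two summands of each denominator stay in a sector of opening less than `π`,
so no cancellation occurs (`sector_lower_bound`): this is where the uniformity in `λ` comes from. The
scheme is consistent of second order, so the symbol is `O(z^(2-α))` at the origin
(`norm_errorSymbol_le`). By Cauchy's estimate its third derivative is `O(|z|^(-1-α))` there, its
integral along the line `Re z = 1/r` is `O(r^α)` (`integral_norm_iteratedDeriv_errorSymbol_le`), and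
Laplace inversion (`pow_three_mul_abs_le_of_laplace_eq`) gives `|k(r)| ≤ C r^(α-3)`
(`abs_errorKernel_le`). As `2 - α > 1`, the symbol vanishes at the origin together with its
derivative, that is `∫ k = ∫ s k = 0` (`isCancellingKernel_errorKernel`). The bound scales to
`|k_τ(r)| ≤ C τ² r^(α-3)` (`IsCancellingKernel.scale`), which produces the factor `τ²`.

**Convolution with a singular source.** The function `r^(α-3)` is not integrable at the origin, but
since the first two moments of `k_τ` vanish, its first and second primitive are bounded by
`C τ² r^(α-2)` and `C τ² r^(α-1)`. Integrating by parts twice away from the singularity of the source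
bounds the convolution with `s^μ` and `s^(μ+1)` (`abs_integral_mul_rpow_le`) and with `s^μ (s - ζ)₊`
(`abs_integral_mul_rpow_mul_sub_le`). Taylor's formula
`g(s) = g(0) + s g'(0) + ∫₀ˢ (s - ζ) g''(ζ) dζ` for weak derivatives (`eq_taylor_of_hasWeakDeriv`)
writes `f = s^μ g` as a superposition of these functions, and the four terms of the bound result.
-/

namespace SubDiffusion

/-! ### Symbols of the exact and of the discrete solution operator -/

theorem mul_mem_slitPlane_of_re_pos {a b : ℂ} (ha : 0 < a.re) (hb : 0 < b.re) :
    a * b ∈ Complex.slitPlane := by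
  rw [Complex.mem_slitPlane_iff, Complex.mul_re, Complex.mul_im]
  by_contra! h
  obtain ⟨h1, h2⟩ := h
  have h3 : b.im = -(a.im * b.re) / a.re := by field_simp; linarith
  rw [h3] at h1
  have h4 : a.re * b.re - a.im * (-(a.im * b.re) / a.re) =
      a.re * b.re + a.im ^ 2 * b.re / a.re := by field_simp; ring
  rw [h4] at h1
  have h5 : 0 < a.re * b.re + a.im ^ 2 * b.re / a.re := by positivity
  linarith

theorem mul_cpow_of_re_pos {a b : ℂ} (ha : 0 < a.re) (hb : 0 < b.re) (s : ℂ) :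
    (a * b) ^ s = a ^ s * b ^ s := by
  have ha0 : a ≠ 0 := fun h => by simp [h] at ha
  have hb0 : b ≠ 0 := fun h => by simp [h] at hb
  have h1 := abs_lt.1 (Complex.abs_arg_lt_pi_div_two_iff.2 (Or.inl ha))
  have h2 := abs_lt.1 (Complex.abs_arg_lt_pi_div_two_iff.2 (Or.inl hb))
  have h3 : Complex.log (a * b) = Complex.log a + Complex.log b :=
    (Complex.log_mul_eq_add_log_iff ha0 hb0).2 ⟨by linarith, by linarith⟩
  rw [Complex.cpow_def_of_ne_zero (mul_ne_zero ha0 hb0), Complex.cpow_def_of_ne_zero ha0,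
    Complex.cpow_def_of_ne_zero hb0, h3, ← Complex.exp_add]
  ring_nf

theorem norm_cpow_ofReal {z : ℂ} (hz : z ≠ 0) (a : ℝ) : ‖z ^ (a : ℂ)‖ = ‖z‖ ^ a := by
  rw [Complex.norm_cpow_of_ne_zero hz]
  simp

theorem re_pos_of_norm_sub_one_le {x : ℂ} (hx : ‖x - 1‖ ≤ 1 / 2) : 0 < x.re := by
  have h := (Complex.abs_re_le_norm (x - 1)).trans hx
  have h2 := (abs_le.1 h).1
  simp at h2
  linarith

theorem norm_cpow_sub_one_le {a : ℝ} (ha0 : 0 < a) (ha1 : a < 1) {x : ℂ}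
    (hx : ‖x - 1‖ ≤ 1 / 2) : ‖x ^ (a : ℂ) - 1‖ ≤ 3 * ‖x - 1‖ := by
  have hre := re_pos_of_norm_sub_one_le hx
  have hx0 : x ≠ 0 := fun h => by simp [h] at hre
  have hl : ‖Complex.log x‖ ≤ 3 / 2 * ‖x - 1‖ := by
    have := Complex.norm_log_one_add_half_le_self hx
    simpa using this
  have hla : ‖Complex.log x * a‖ ≤ 3 / 2 * ‖x - 1‖ := by
    rw [norm_mul, Complex.norm_real, Real.norm_of_nonneg ha0.le]
    calc ‖Complex.log x‖ * a ≤ ‖Complex.log x‖ * 1 := by gcongr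
      _ ≤ _ := by linarith
  rw [Complex.cpow_def_of_ne_zero hx0]
  have := Complex.norm_exp_sub_one_le (x := Complex.log x * a) (by linarith)
  linarith

theorem norm_cpow_sub_taylor_le {a : ℝ} (ha0 : 0 < a) (ha1 : a < 1) {x : ℂ}
    (hx : ‖x - 1‖ ≤ 1 / 2) : ‖x ^ (a : ℂ) - 1 - a * (x - 1)‖ ≤ 4 * ‖x - 1‖ ^ 2 := by
  have hre := re_pos_of_norm_sub_one_le hx
  have hx0 : x ≠ 0 := fun h => by simp [h] at hre
  have hl : ‖Complex.log x‖ ≤ 3 / 2 * ‖x - 1‖ := by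
    have := Complex.norm_log_one_add_half_le_self hx
    simpa using this
  have hl2 : ‖Complex.log x - (x - 1)‖ ≤ ‖x - 1‖ ^ 2 := by
    have h := Complex.norm_log_one_add_sub_self_le (z := x - 1) (by linarith)
    rw [add_sub_cancel] at h
    refine h.trans ?_
    have h1 : (1 - ‖x - 1‖)⁻¹ ≤ 2 := by
      rw [inv_le_comm₀ (by linarith) (by norm_num)]; linarith
    have h2 : 0 ≤ ‖x - 1‖ ^ 2 := by positivity
    nlinarith
  have hla : ‖Complex.log x * a‖ ≤ 3 / 2 * ‖x - 1‖ := by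
    rw [norm_mul, Complex.norm_real, Real.norm_of_nonneg ha0.le]
    calc ‖Complex.log x‖ * a ≤ ‖Complex.log x‖ * 1 := by gcongr
      _ ≤ _ := by linarith
  rw [Complex.cpow_def_of_ne_zero hx0]
  have h1 := Complex.norm_exp_sub_one_sub_id_le (x := Complex.log x * a) (by linarith)
  have h2 : ‖(a : ℂ) * (Complex.log x - (x - 1))‖ ≤ ‖x - 1‖ ^ 2 := by
    rw [norm_mul, Complex.norm_real, Real.norm_of_nonneg ha0.le]
    calc a * ‖Complex.log x - (x - 1)‖ ≤ 1 * ‖Complex.log x - (x - 1)‖ := by gcongr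
      _ ≤ _ := by linarith
  have h3 : Complex.exp (Complex.log x * a) - 1 - a * (x - 1) =
      (Complex.exp (Complex.log x * a) - 1 - Complex.log x * a) +
        (a : ℂ) * (Complex.log x - (x - 1)) := by ring
  rw [h3]
  refine (norm_add_le _ _).trans ?_
  have h4 : ‖Complex.log x * a‖ ^ 2 ≤ (3 / 2 * ‖x - 1‖) ^ 2 := by gcongr
  nlinarith [sq_nonneg ‖x - 1‖]

/-- The constant in the sectorial lower bound `sector_lower_bound`. -/
noncomputable def sectorConst (α : ℝ) : ℝ := Real.sin ((1 - α) * (Real.pi / 4))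

theorem sectorConst_pos {α : ℝ} (h0 : 0 < α) (h1 : α < 1) : 0 < sectorConst α := by
  have := Real.pi_pos
  refine Real.sin_pos_of_pos_of_lt_pi (by nlinarith) (by nlinarith)

theorem sectorConst_le_one (α : ℝ) : sectorConst α ≤ 1 := Real.sin_le_one _

/-- The case `0 ≤ Im y`, `Im q ≤ 0` of `sector_lower_bound`; the other one follows by complex
conjugation. -/
theorem sector_lower_bound_aux {α : ℝ} (h0 : 0 < α) (h1 : α < 1) {y q : ℂ} (hy : 0 < y.re)
    (hyi : 0 ≤ y.im) (hq : 0 ≤ q.re) (hqi : q.im ≤ 0) {lam : ℝ} (hl : 0 ≤ lam) :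
    sectorConst α * (‖y‖ ^ α + lam * ‖q‖) ≤ ‖y ^ (α : ℂ) + lam * q‖ := by
  have hpi := Real.pi_pos
  have hy0 : y ≠ 0 := fun h => by simp [h] at hy
  set β := (1 - α) * (Real.pi / 4) with hβ
  have hβ0 : 0 < β := by rw [hβ]; nlinarith
  have hβ1 : β < Real.pi / 4 := by rw [hβ]; nlinarith
  -- rotating by the angle `β` moves both `y ^ α` and `q` into a proper sector of `Re > 0`
  have hw : ‖Complex.exp (β * Complex.I)‖ = 1 := Complex.norm_exp_ofReal_mul_I β
  have hre : (Complex.exp (β * Complex.I) * (y ^ (α : ℂ) + lam * q)).re ≤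
      ‖y ^ (α : ℂ) + lam * q‖ := by
    refine (Complex.re_le_norm _).trans ?_
    rw [norm_mul, hw, one_mul]
  refine le_trans ?_ hre
  have harg0 : 0 ≤ y.arg := Complex.arg_nonneg_iff.2 hyi
  have harg1 : y.arg < Real.pi / 2 :=
    (abs_lt.1 (Complex.abs_arg_lt_pi_div_two_iff.2 (Or.inl hy))).2
  have hcpow : Complex.exp (β * Complex.I) * y ^ (α : ℂ) =
      (‖y‖ ^ α : ℝ) * Complex.exp ((β + α * y.arg : ℝ) * Complex.I) := by
    rw [Complex.cpow_def_of_ne_zero hy0, ← Complex.exp_add, Complex.log,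
      Real.rpow_def_of_pos (norm_pos_iff.2 hy0), Complex.ofReal_exp, ← Complex.exp_add]
    congr 1
    push_cast
    ring
  rw [mul_add (Complex.exp _), Complex.add_re, hcpow, Complex.re_ofReal_mul,
    Complex.exp_ofReal_mul_I_re]
  have hcos : sectorConst α ≤ Real.cos (β + α * y.arg) := by
    have hs : sectorConst α = Real.cos (Real.pi / 2 - β) := by
      rw [Real.cos_pi_div_two_sub]; rfl
    rw [hs]
    refine Real.cos_le_cos_of_nonneg_of_le_pi (by positivity) (by linarith) ?_
    have : α * y.arg ≤ α * (Real.pi / 2) := by gcongr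
    rw [hβ]; nlinarith
  have hqre : sectorConst α * ‖q‖ ≤ (Complex.exp (β * Complex.I) * q).re := by
    rw [Complex.mul_re, Complex.exp_ofReal_mul_I_re, Complex.exp_ofReal_mul_I_im]
    have hcs : Real.sin β ≤ Real.cos β := by
      rw [← Real.cos_pi_div_two_sub]
      exact Real.cos_le_cos_of_nonneg_of_le_pi hβ0.le (by linarith) (by linarith)
    have hs0 : 0 < Real.sin β := sectorConst_pos h0 h1
    have hn : ‖q‖ ≤ q.re - q.im := by
      have := Complex.norm_le_abs_re_add_abs_im q
      rwa [abs_of_nonneg hq, abs_of_nonpos hqi, ← sub_eq_add_neg] at this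
    change Real.sin β * ‖q‖ ≤ _
    nlinarith
  have h5 : (Complex.exp (β * Complex.I) * (lam * q)).re =
      lam * (Complex.exp (β * Complex.I) * q).re := by
    rw [mul_left_comm, Complex.re_ofReal_mul]
  rw [h5]
  have h6 : 0 ≤ ‖y‖ ^ α := by positivity
  nlinarith [mul_le_mul_of_nonneg_left hqre hl, mul_le_mul_of_nonneg_left hcos h6]

/-- If `y` and `q` lie in the right half-plane on opposite sides of the real axis, then `y ^ α` and
`λ q` enclose an angle of at most `(1 + α) π / 2 < π`, so that they cannot cancel. -/
theorem sector_lower_bound {α : ℝ} (h0 : 0 < α) (h1 : α < 1) {y q : ℂ} (hy : 0 < y.re)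
    (hq : 0 ≤ q.re) (hyq : (0 ≤ y.im ∧ q.im ≤ 0) ∨ (y.im ≤ 0 ∧ 0 ≤ q.im)) {lam : ℝ}
    (hl : 0 ≤ lam) :
    sectorConst α * (‖y‖ ^ α + lam * ‖q‖) ≤ ‖y ^ (α : ℂ) + lam * q‖ := by
  rcases hyq with ⟨h, h'⟩ | ⟨h, h'⟩
  · exact sector_lower_bound_aux h0 h1 hy h hq h' hl
  · have hpi : y.arg ≠ Real.pi := by
      have := (abs_lt.1 (Complex.abs_arg_lt_pi_div_two_iff.2 (Or.inl hy))).2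
      have := Real.pi_pos
      linarith
    have key := sector_lower_bound_aux h0 h1 (y := (starRingEnd ℂ) y) (q := (starRingEnd ℂ) q)
      (by simpa using hy) (by simpa using h) (by simpa using hq) (by simpa using h') hl
    have h3 : (starRingEnd ℂ) y ^ (α : ℂ) + lam * (starRingEnd ℂ) q =
        (starRingEnd ℂ) (y ^ (α : ℂ) + lam * q) := by
      have := Complex.cpow_conj y α hpi
      rw [Complex.conj_ofReal] at this
      rw [map_add, map_mul, Complex.conj_ofReal, this, Complex.conj_conj]
    rw [h3] at key
    simpa only [Complex.norm_conj] using key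

/-- `sector_lower_bound` is stable under small relative perturbations, which may leave the right
half-plane. -/
theorem sector_lower_bound_perturb {α : ℝ} (h0 : 0 < α) (h1 : α < 1) {y y0 q q0 : ℂ}
    (hy : 0 < y0.re) (hq : 0 ≤ q0.re)
    (hyq : (0 ≤ y0.im ∧ q0.im ≤ 0) ∨ (y0.im ≤ 0 ∧ 0 ≤ q0.im)) {lam : ℝ} (hl : 0 ≤ lam)
    (hyy : ‖y - y0‖ ≤ sectorConst α / 6 * ‖y0‖) (hqq : ‖q - q0‖ ≤ sectorConst α / 2 * ‖q0‖) :
    y ∈ Complex.slitPlane ∧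
      sectorConst α / 2 * (‖y0‖ ^ α + lam * ‖q0‖) ≤ ‖y ^ (α : ℂ) + lam * q‖ := by
  have hc0 := sectorConst_pos h0 h1
  have hc1 := sectorConst_le_one α
  have hy0 : y0 ≠ 0 := fun h => by simp [h] at hy
  have hn0 : 0 < ‖y0‖ := norm_pos_iff.2 hy0
  set x := y / y0 with hx
  have hyx : y = y0 * x := by rw [hx]; field_simp
  have hx1 : ‖x - 1‖ ≤ sectorConst α / 6 := by
    have : x - 1 = (y - y0) / y0 := by rw [hx]; field_simp
    rw [this, norm_div, div_le_iff₀ hn0]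
    exact hyy
  have hxre : 0 < x.re := re_pos_of_norm_sub_one_le (by linarith)
  refine ⟨hyx ▸ mul_mem_slitPlane_of_re_pos hy hxre, ?_⟩
  have hb := sector_lower_bound h0 h1 hy hq hyq hl
  have h2 : y ^ (α : ℂ) + lam * q = (y0 ^ (α : ℂ) + lam * q0) +
      (y0 ^ (α : ℂ) * (x ^ (α : ℂ) - 1) + lam * (q - q0)) := by
    rw [hyx, mul_cpow_of_re_pos hy hxre]; ring
  have h3 : ‖y0 ^ (α : ℂ) * (x ^ (α : ℂ) - 1) + lam * (q - q0)‖ ≤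
      sectorConst α / 2 * (‖y0‖ ^ α + lam * ‖q0‖) := by
    refine (norm_add_le _ _).trans ?_
    rw [norm_mul, norm_mul, norm_cpow_ofReal hy0, Complex.norm_real, Real.norm_of_nonneg hl]
    have h4 := norm_cpow_sub_one_le h0 h1 (x := x) (by linarith)
    have h5 : ‖x ^ (α : ℂ) - 1‖ ≤ sectorConst α / 2 := by linarith
    have h6 : 0 ≤ ‖y0‖ ^ α := by positivity
    nlinarith [mul_le_mul_of_nonneg_left h5 h6, mul_le_mul_of_nonneg_left hqq hl]
  have h4 := norm_sub_le_norm_add (y0 ^ (α : ℂ) + lam * q0)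
    (y0 ^ (α : ℂ) * (x ^ (α : ℂ) - 1) + lam * (q - q0))
  rw [← h2] at h4
  linarith

/-- The backward difference `1 - e^{-z}`. -/
noncomputable def backDiff (z : ℂ) : ℂ := 1 - Complex.exp (-z)

/-- The weight `1 - α y / 2` of the two time levels in the Crank-Nicolson scheme, where
`y = 1 - ξ`. -/
noncomputable def cnWeight (α : ℝ) (y : ℂ) : ℂ := 1 - α / 2 * y

/-- The symbol `y + y² / 2` of the BDF2 difference, where `y = 1 - ξ`. -/
noncomputable def bdfSymbol (y : ℂ) : ℂ := y + y ^ 2 / 2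

/-- The Laplace transform `(z^α + λ)⁻¹` of the kernel of the exact solution operator. -/
noncomputable def exactSymbol (α lam : ℝ) (z : ℂ) : ℂ := (z ^ (α : ℂ) + lam)⁻¹

/-- The Laplace transform of the kernel of the discrete solution operator with step `1`. -/
noncomputable def discreteSymbol (α lam : ℝ) (z : ℂ) : ℂ :=
  bdfSymbol (backDiff z) ^ 2 * cnWeight α (backDiff z) /
    (z ^ 2 * (backDiff z ^ (α : ℂ) + lam * cnWeight α (backDiff z)))

/-- The Laplace transform of the error kernel. -/
noncomputable def errorSymbol (α lam : ℝ) (z : ℂ) : ℂ := exactSymbol α lam z - discreteSymbol α lam z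

theorem norm_one_sub_backDiff_lt {z : ℂ} (hz : 0 < z.re) : ‖1 - backDiff z‖ < 1 := by
  rw [backDiff, sub_sub_cancel, Complex.norm_exp]
  simpa using hz

theorem backDiff_re_pos {z : ℂ} (hz : 0 < z.re) : 0 < (backDiff z).re := by
  have h := (Complex.re_le_norm (1 - backDiff z)).trans_lt (norm_one_sub_backDiff_lt hz)
  simp at h
  linarith

theorem norm_backDiff_lt_two {z : ℂ} (hz : 0 < z.re) : ‖backDiff z‖ < 2 := by
  have h := norm_one_sub_backDiff_lt hz
  have h2 : backDiff z = 1 - (1 - backDiff z) := by ring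
  rw [h2]
  refine (norm_sub_le _ _).trans_lt ?_
  simp only [norm_one]
  linarith

theorem norm_backDiff_le {z : ℂ} (hz : 0 < z.re) : ‖backDiff z‖ ≤ 2 * ‖z‖ := by
  rcases le_or_gt ‖z‖ 1 with h | h
  · have := Complex.norm_exp_sub_one_le (x := -z) (by simpa using h)
    rw [backDiff, norm_sub_rev]
    simpa using this
  · have := norm_backDiff_lt_two hz
    linarith

theorem cnWeight_re {α : ℝ} (h0 : 0 < α) {z : ℂ} (hz : 0 < z.re) :
    1 - α ≤ (cnWeight α (backDiff z)).re := by
  have h := (Complex.re_le_norm _).trans (norm_backDiff_lt_two hz).le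
  have h2 : (cnWeight α (backDiff z)).re = 1 - α / 2 * (backDiff z).re := by
    simp [cnWeight]
  rw [h2]
  nlinarith

theorem cnWeight_im {α : ℝ} (y : ℂ) : (cnWeight α y).im = -(α / 2 * y.im) := by
  simp [cnWeight]

theorem opposite_im_cnWeight {α : ℝ} (h0 : 0 < α) (y : ℂ) :
    (0 ≤ y.im ∧ (cnWeight α y).im ≤ 0) ∨ (y.im ≤ 0 ∧ 0 ≤ (cnWeight α y).im) := by
  rw [cnWeight_im]
  rcases le_total 0 y.im with h | h
  · exact Or.inl ⟨h, by nlinarith⟩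
  · exact Or.inr ⟨h, by nlinarith⟩

theorem differentiable_backDiff : Differentiable ℂ backDiff := by
  unfold backDiff; fun_prop

theorem differentiableAt_exactSymbol {α lam : ℝ} {z : ℂ} (hz : z ∈ Complex.slitPlane)
    (h : z ^ (α : ℂ) + lam ≠ 0) : DifferentiableAt ℂ (exactSymbol α lam) z := by
  unfold exactSymbol
  exact ((differentiableAt_id.cpow_const hz).add_const _).inv h

theorem differentiableAt_discreteSymbol {α lam : ℝ} {z : ℂ} (hz0 : z ≠ 0)
    (hz : backDiff z ∈ Complex.slitPlane)
    (h : backDiff z ^ (α : ℂ) + lam * cnWeight α (backDiff z) ≠ 0) :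
    DifferentiableAt ℂ (discreteSymbol α lam) z := by
  have hb : DifferentiableAt ℂ backDiff z := differentiable_backDiff z
  have hq : DifferentiableAt ℂ (fun w => cnWeight α (backDiff w)) z := by
    unfold cnWeight; fun_prop
  have hd : DifferentiableAt ℂ (fun w => bdfSymbol (backDiff w)) z := by
    unfold bdfSymbol; fun_prop
  unfold discreteSymbol
  refine ((hd.pow 2).mul hq).div ((differentiableAt_id.pow 2).mul
    ((hb.cpow_const hz).add ((differentiableAt_const _).mul hq))) ?_
  exact mul_ne_zero (pow_ne_zero _ hz0) h

/-- Bounds on a disc around `z₀` of radius comparable to `‖z₀‖`. -/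
theorem norm_exactSymbol_le {α : ℝ} (h0 : 0 < α) (h1 : α < 1) {lam : ℝ} (hl : 0 ≤ lam)
    {z z0 : ℂ} (hz0 : 0 < z0.re) (hz : ‖z - z0‖ ≤ sectorConst α / 6 * ‖z0‖) :
    DifferentiableAt ℂ (exactSymbol α lam) z ∧
      ‖exactSymbol α lam z‖ ≤ 2 / sectorConst α * ‖z0‖ ^ (-α) := by
  have hc0 := sectorConst_pos h0 h1
  have hn0 : 0 < ‖z0‖ := norm_pos_iff.2 (fun h => by simp [h] at hz0)
  obtain ⟨hs, hb⟩ := sector_lower_bound_perturb h0 h1 (q := 1) (q0 := 1) hz0 (by simp)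
    (by simp [le_total]) hl hz (by simp; positivity)
  simp only [mul_one, norm_one] at hb
  have hp : 0 < ‖z0‖ ^ α := by positivity
  have hpos : 0 < sectorConst α / 2 * ‖z0‖ ^ α := by positivity
  have hb' : sectorConst α / 2 * ‖z0‖ ^ α ≤ ‖z ^ (α : ℂ) + lam‖ := by nlinarith
  refine ⟨differentiableAt_exactSymbol hs (norm_pos_iff.1 (hpos.trans_le hb')), ?_⟩
  rw [exactSymbol, norm_inv, Real.rpow_neg hn0.le]
  refine (inv_anti₀ hpos hb').trans (le_of_eq ?_)
  field_simp

theorem norm_bdfSymbol_le (y : ℂ) : ‖bdfSymbol y‖ ≤ ‖y‖ + ‖y‖ ^ 2 / 2 := by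
  refine (norm_add_le _ _).trans (le_of_eq ?_)
  simp

theorem norm_cnWeight_le {α : ℝ} (h0 : 0 < α) (h1 : α < 1) (y : ℂ) :
    ‖cnWeight α y‖ ≤ 1 + ‖y‖ / 2 := by
  refine (norm_sub_le _ _).trans ?_
  rw [norm_one, norm_mul, norm_div, Complex.norm_real, Real.norm_of_nonneg h0.le]
  simp only [Complex.norm_ofNat]
  nlinarith [norm_nonneg y]

theorem norm_backDiff_sub_le {z z0 : ℂ} (hz0 : 0 < z0.re) (h : ‖z - z0‖ ≤ 1) :
    ‖backDiff z - backDiff z0‖ ≤ 2 * ‖z - z0‖ := by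
  have h1 : backDiff z - backDiff z0 = -(Complex.exp (-z0) * (Complex.exp (-(z - z0)) - 1)) := by
    rw [mul_sub, ← Complex.exp_add]
    simp only [backDiff]
    ring_nf
  rw [h1, norm_neg, norm_mul]
  have h2 : ‖Complex.exp (-z0)‖ ≤ 1 := by
    rw [Complex.norm_exp]; simpa using hz0.le
  have h3 := Complex.norm_exp_sub_one_le (x := -(z - z0)) (by rwa [norm_neg])
  rw [norm_neg] at h3
  calc _ ≤ 1 * (2 * ‖z - z0‖) := by gcongr
    _ = _ := one_mul _

/-- Bounds on a disc around `z₀` of radius comparable to `‖1 - e^{-z₀}‖`. -/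
theorem norm_discreteSymbol_le {α : ℝ} (h0 : 0 < α) (h1 : α < 1) {lam : ℝ} (hl : 0 ≤ lam)
    {z z0 : ℂ} (hz0 : 0 < z0.re)
    (hz : ‖z - z0‖ ≤ sectorConst α * (1 - α) / 12 * ‖backDiff z0‖) :
    DifferentiableAt ℂ (discreteSymbol α lam) z ∧
      ‖discreteSymbol α lam z‖ ≤
        1000 / sectorConst α * (‖backDiff z0‖ ^ (2 - α) * (‖z0‖ ^ 2)⁻¹) := by
  have hc0 := sectorConst_pos h0 h1
  have hc1 := sectorConst_le_one α
  set y0 := backDiff z0 with hy0d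
  set y := backDiff z with hyd
  set c := sectorConst α with hc
  have hy0re : 0 < y0.re := backDiff_re_pos hz0
  have hy0 : 0 < ‖y0‖ := norm_pos_iff.2 (fun h => by simp [h] at hy0re)
  have hzn : 0 < ‖z0‖ := norm_pos_iff.2 (fun h => by simp [h] at hz0)
  have hy2 : ‖y0‖ < 2 := norm_backDiff_lt_two hz0
  have hyz : ‖y0‖ ≤ 2 * ‖z0‖ := norm_backDiff_le hz0
  have hε : 0 < c * (1 - α) := mul_pos hc0 (by linarith)
  have hε1 : c * (1 - α) ≤ 1 := by nlinarith
  have hεc : c * (1 - α) ≤ c := by nlinarith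
  have hR : ‖z - z0‖ ≤ 1 := by nlinarith
  have hyy : ‖y - y0‖ ≤ c * (1 - α) / 6 * ‖y0‖ := by
    refine (norm_backDiff_sub_le hz0 hR).trans ?_
    linarith
  have hyy' : ‖y - y0‖ ≤ c / 6 * ‖y0‖ := hyy.trans (by gcongr)
  have hq0 : 1 - α ≤ ‖cnWeight α y0‖ := (cnWeight_re h0 hz0).trans (Complex.re_le_norm _)
  have hqq : ‖cnWeight α y - cnWeight α y0‖ ≤ c / 2 * ‖cnWeight α y0‖ := by
    have e : cnWeight α y - cnWeight α y0 = -((α / 2 : ℝ) * (y - y0)) := by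
      simp only [cnWeight]; push_cast; ring
    rw [e, norm_neg, norm_mul, Complex.norm_real, Real.norm_of_nonneg (by linarith)]
    have s1 : α / 2 * ‖y - y0‖ ≤ 1 / 2 * (c * (1 - α) / 6 * 2) := by
      gcongr
      refine hyy.trans ?_
      gcongr
    have s2 : c / 2 * (1 - α) ≤ c / 2 * ‖cnWeight α y0‖ := by gcongr
    nlinarith
  obtain ⟨hs, hb⟩ := sector_lower_bound_perturb h0 h1 hy0re
    ((by linarith : (0 : ℝ) ≤ 1 - α).trans (cnWeight_re h0 hz0)) (opposite_im_cnWeight h0 y0) hl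
    hyy' hqq
  have hp : 0 < ‖y0‖ ^ α := by positivity
  have hpos : 0 < c / 2 * ‖y0‖ ^ α := by positivity
  have hb' : c / 2 * ‖y0‖ ^ α ≤ ‖y ^ (α : ℂ) + lam * cnWeight α y‖ := by
    refine le_trans ?_ hb
    have : 0 ≤ lam * ‖cnWeight α y0‖ := by positivity
    gcongr; linarith
  have hzlow : ‖z0‖ / 2 ≤ ‖z‖ := by
    have a1 : ‖z0‖ - ‖z - z0‖ ≤ ‖z‖ := by
      have := norm_sub_le z (z - z0)
      rw [sub_sub_cancel] at this; linarith
    have : c * (1 - α) / 12 * ‖y0‖ ≤ 1 / 12 * (2 * ‖z0‖) := by gcongr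
    linarith
  have hz00 : z ≠ 0 := norm_pos_iff.1 (by linarith)
  refine ⟨differentiableAt_discreteSymbol hz00 hs (norm_pos_iff.1 (hpos.trans_le hb')), ?_⟩
  have hyu : ‖y‖ ≤ 2 * ‖y0‖ := by
    have a1 := norm_add_le (y - y0) y0
    rw [sub_add_cancel] at a1
    nlinarith
  have hD : ‖bdfSymbol y‖ ≤ 6 * ‖y0‖ := by
    have := norm_bdfSymbol_le y
    have a2 : ‖y‖ ^ 2 ≤ (2 * ‖y0‖) ^ 2 := by gcongr
    nlinarith
  have hQ : ‖cnWeight α y‖ ≤ 3 := by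
    have := norm_cnWeight_le h0 h1 y
    linarith
  rw [discreteSymbol, norm_div, norm_mul, norm_mul, norm_pow, norm_pow]
  have hfin : ‖bdfSymbol y‖ ^ 2 * ‖cnWeight α y‖ / (‖z‖ ^ 2 *
      ‖y ^ (α : ℂ) + lam * cnWeight α y‖) ≤
      (6 * ‖y0‖) ^ 2 * 3 / ((‖z0‖ / 2) ^ 2 * (c / 2 * ‖y0‖ ^ α)) := by
    gcongr
  refine hfin.trans ?_
  rw [Real.rpow_sub hy0, Real.rpow_two]
  have : (6 * ‖y0‖) ^ 2 * 3 / ((‖z0‖ / 2) ^ 2 * (c / 2 * ‖y0‖ ^ α)) =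
      864 / c * (‖y0‖ ^ 2 / ‖y0‖ ^ α * (‖z0‖ ^ 2)⁻¹) := by
    field_simp; norm_num
  rw [this]
  gcongr
  norm_num

/-! ### Consistency and derivatives of the error symbol -/

theorem norm_backDiff_sub_self_le {z : ℂ} (hz : ‖z‖ ≤ 1) : ‖backDiff z - z‖ ≤ ‖z‖ ^ 2 := by
  have h := Complex.norm_exp_sub_one_sub_id_le (x := -z) (by simpa using hz)
  have e : backDiff z - z = -(Complex.exp (-z) - 1 - -z) := by rw [backDiff]; ring
  rw [e, norm_neg]
  simpa using h

theorem norm_backDiff_sub_taylor_le {z : ℂ} (hz : ‖z‖ ≤ 1) :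
    ‖backDiff z - z + z ^ 2 / 2‖ ≤ ‖z‖ ^ 3 := by
  have h := Complex.exp_bound (x := -z) (by simpa using hz) (n := 3) (by norm_num)
  have e : backDiff z - z + z ^ 2 / 2 =
      -(Complex.exp (-z) - ∑ m ∈ Finset.range 3, (-z) ^ m / (m.factorial : ℂ)) := by
    simp [Finset.sum_range_succ, backDiff, Nat.factorial]
    ring
  rw [e, norm_neg]
  refine h.trans ?_
  rw [norm_neg]
  norm_num [Nat.factorial]
  have : 0 ≤ ‖z‖ ^ 3 := by positivity
  linarith

/-- The BDF2 difference is second order: `D(e^{-z}) = z + O(z³)`. -/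
theorem norm_sq_sub_bdfSymbol_sq_le {z : ℂ} (hz : ‖z‖ ≤ 1 / 4) :
    ‖z ^ 2 - bdfSymbol (backDiff z) ^ 2‖ ≤ 8 * ‖z‖ ^ 4 := by
  set y := backDiff z with hy
  have h1 := norm_backDiff_sub_self_le (z := z) (by linarith)
  have h2 := norm_backDiff_sub_taylor_le (z := z) (by linarith)
  rw [← hy] at h1 h2
  have hn := norm_nonneg z
  have hyn : ‖y + z‖ ≤ 3 * ‖z‖ := by
    have e : y + z = (y - z) + 2 * z := by ring
    rw [e]
    refine (norm_add_le _ _).trans ?_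
    rw [norm_mul, Complex.norm_ofNat]
    nlinarith
  have hD : ‖bdfSymbol y - z‖ ≤ 5 / 2 * ‖z‖ ^ 3 := by
    have e : bdfSymbol y - z = (y - z + z ^ 2 / 2) + (y - z) * (y + z) / 2 := by
      rw [bdfSymbol]; ring
    rw [e]
    refine (norm_add_le _ _).trans ?_
    rw [norm_div, norm_mul, Complex.norm_ofNat]
    have : ‖y - z‖ * ‖y + z‖ ≤ ‖z‖ ^ 2 * (3 * ‖z‖) := by gcongr
    nlinarith
  have hD2 : ‖bdfSymbol y + z‖ ≤ 3 * ‖z‖ := by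
    have e : bdfSymbol y + z = (bdfSymbol y - z) + 2 * z := by ring
    rw [e]
    refine (norm_add_le _ _).trans ?_
    rw [norm_mul, Complex.norm_ofNat]
    have : ‖z‖ ^ 3 ≤ (1 / 4) ^ 2 * ‖z‖ := by
      rw [pow_succ]; gcongr
    linarith
  have e : z ^ 2 - bdfSymbol y ^ 2 = -((bdfSymbol y - z) * (bdfSymbol y + z)) := by ring
  rw [e, norm_neg, norm_mul]
  calc _ ≤ (5 / 2 * ‖z‖ ^ 3) * (3 * ‖z‖) := by gcongr
    _ ≤ _ := by nlinarith [pow_nonneg hn 4]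

/-- The weighting of the two time levels makes the Grünwald-Letnikov difference second order. -/
theorem norm_ratio_cpow_sub_cnWeight_le {α : ℝ} (h0 : 0 < α) (h1 : α < 1) {z : ℂ} (hz0 : z ≠ 0)
    (hz : ‖z‖ ≤ 1 / 4) :
    ‖(backDiff z / z) ^ (α : ℂ) - cnWeight α (backDiff z)‖ ≤ 6 * ‖z‖ ^ 2 := by
  have h2 := norm_backDiff_sub_self_le (z := z) (by linarith)
  have h3 := norm_backDiff_sub_taylor_le (z := z) (by linarith)
  set y := backDiff z with hy
  have hn : 0 < ‖z‖ := norm_pos_iff.2 hz0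
  have hh : ‖y / z - 1‖ ≤ ‖z‖ := by
    have : y / z - 1 = (y - z) / z := by field_simp
    rw [this, norm_div, div_le_iff₀ hn]
    linarith
  have hh2 : ‖y / z - 1 + z / 2‖ ≤ ‖z‖ ^ 2 := by
    have : y / z - 1 + z / 2 = (y - z + z ^ 2 / 2) / z := by field_simp
    rw [this, norm_div, div_le_iff₀ hn]
    linarith
  have ht := norm_cpow_sub_taylor_le h0 h1 (x := y / z) (by linarith)
  have e : (y / z) ^ (α : ℂ) - cnWeight α y = ((y / z) ^ (α : ℂ) - 1 - α * (y / z - 1)) +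
      (α : ℂ) * ((y / z - 1 + z / 2) + (y - z) / 2) := by
    rw [cnWeight]; ring
  rw [e]
  refine (norm_add_le _ _).trans ?_
  have h4 : ‖(y / z - 1 + z / 2) + (y - z) / 2‖ ≤ 2 * ‖z‖ ^ 2 := by
    refine (norm_add_le _ _).trans ?_
    rw [norm_div, Complex.norm_ofNat]
    nlinarith
  rw [norm_mul, Complex.norm_real, Real.norm_of_nonneg h0.le]
  have h5 : α * ‖(y / z - 1 + z / 2) + (y - z) / 2‖ ≤ 1 * (2 * ‖z‖ ^ 2) := by gcongr
  have h6 : ‖y / z - 1‖ ^ 2 ≤ ‖z‖ ^ 2 := by gcongr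
  linarith

/-- Consistency at low frequencies: the error symbol is `O(z² · z^{-α})`, uniformly in `λ`. -/
theorem norm_errorSymbol_le {α : ℝ} (h0 : 0 < α) (h1 : α < 1) {lam : ℝ} (hl : 0 ≤ lam)
    {z z0 : ℂ} (hz0 : 0 < z0.re) (hz0s : ‖z0‖ ≤ sectorConst α / 50)
    (hz : ‖z - z0‖ ≤ sectorConst α / 12 * ‖z0‖) :
    DifferentiableAt ℂ (errorSymbol α lam) z ∧
      ‖errorSymbol α lam z‖ ≤ 1000 / sectorConst α ^ 2 * ‖z0‖ ^ (2 - α) := by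
  have hc0 := sectorConst_pos h0 h1
  have hc1 := sectorConst_le_one α
  set c := sectorConst α with hc
  have hz00 : z0 ≠ 0 := fun h => by simp [h] at hz0
  have hZ : 0 < ‖z0‖ := norm_pos_iff.2 hz00
  have hzu : ‖z‖ ≤ 5 / 4 * ‖z0‖ := by
    have a1 := norm_add_le (z - z0) z0
    rw [sub_add_cancel] at a1
    nlinarith
  have hzl : 3 / 4 * ‖z0‖ ≤ ‖z‖ := by
    have := norm_sub_le z (z - z0)
    rw [sub_sub_cancel] at this
    nlinarith
  have hzn : z ≠ 0 := norm_pos_iff.1 (by linarith)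
  have hz14 : ‖z‖ ≤ 1 / 4 := by linarith
  have hyz := norm_backDiff_sub_self_le (z := z) (by linarith)
  have hrat := norm_ratio_cpow_sub_cnWeight_le h0 h1 hzn hz14
  have hDD := norm_sq_sub_bdfSymbol_sq_le hz14
  set y := backDiff z
  have hyz0 : ‖y - z0‖ ≤ c / 6 * ‖z0‖ := by
    have e : y - z0 = (y - z) + (z - z0) := by ring
    rw [e]
    refine (norm_add_le _ _).trans ?_
    nlinarith
  have hyn : ‖y‖ ≤ c / 2 := by
    have a1 := norm_add_le (y - z0) z0
    rw [sub_add_cancel] at a1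
    nlinarith
  have hq1 : ‖cnWeight α y - 1‖ ≤ c / 2 := by
    have e : cnWeight α y - 1 = -((α / 2 : ℝ) * y) := by rw [cnWeight]; push_cast; ring
    rw [e, norm_neg, norm_mul, Complex.norm_real, Real.norm_of_nonneg (by linarith)]
    calc α / 2 * ‖y‖ ≤ 1 * (c / 2) := by gcongr; linarith
      _ = c / 2 := one_mul _
  obtain ⟨hsA, hA⟩ := sector_lower_bound_perturb h0 h1 (q := 1) (q0 := 1) hz0 (by simp)
    (by simp [le_total]) hl (y := z) (by nlinarith) (by simp; positivity)
  obtain ⟨hsB, hB⟩ := sector_lower_bound_perturb h0 h1 (q := cnWeight α y) (q0 := 1) hz0 (by simp)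
    (by simp [le_total]) hl hyz0 (by simpa using hq1)
  simp only [norm_one, mul_one] at hA hB
  have hP : 0 < ‖z0‖ ^ α := by positivity
  set S := ‖z0‖ ^ α + lam with hS
  have hSpos : 0 < S := by positivity
  have hSS : 0 < c / 2 * S := by positivity
  have hA0 := norm_pos_iff.1 (hSS.trans_le hA)
  have hB0 := norm_pos_iff.1 (hSS.trans_le hB)
  refine ⟨(differentiableAt_exactSymbol hsA hA0).sub (differentiableAt_discreteSymbol hzn hsB hB0),
    ?_⟩
  -- `z / z0`, `y / z` and `y / z0` are all close to `1`, so no branch cut is met when the power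
  -- of a product is split
  have hfac : y ^ (α : ℂ) = z ^ (α : ℂ) * (y / z) ^ (α : ℂ) := by
    have r1 : 0 < (z / z0).re := by
      apply re_pos_of_norm_sub_one_le
      have : z / z0 - 1 = (z - z0) / z0 := by field_simp
      rw [this, norm_div, div_le_iff₀ hZ]
      nlinarith
    have r2 : 0 < (y / z).re := by
      apply re_pos_of_norm_sub_one_le
      have : y / z - 1 = (y - z) / z := by field_simp
      rw [this, norm_div, div_le_iff₀ (norm_pos_iff.2 hzn)]
      nlinarith [norm_nonneg z]
    have r3 : 0 < (z / z0 * (y / z)).re := by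
      apply re_pos_of_norm_sub_one_le
      have : z / z0 * (y / z) - 1 = (y - z0) / z0 := by field_simp
      rw [this, norm_div, div_le_iff₀ hZ]
      nlinarith
    have e1 : y = z0 * (z / z0 * (y / z)) := by field_simp
    have e2 : z = z0 * (z / z0) := by field_simp
    conv_lhs => rw [e1, mul_cpow_of_re_pos hz0 r3, mul_cpow_of_re_pos r1 r2, ← mul_assoc,
      ← mul_cpow_of_re_pos hz0 r1, ← e2]
  have hzα : ‖z ^ (α : ℂ)‖ ≤ 2 * ‖z0‖ ^ α := by
    rw [norm_cpow_ofReal hzn]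
    calc ‖z‖ ^ α ≤ (2 * ‖z0‖) ^ α := by gcongr; linarith
      _ = 2 ^ α * ‖z0‖ ^ α := Real.mul_rpow (by norm_num) hZ.le
      _ ≤ 2 ^ (1 : ℝ) * ‖z0‖ ^ α := by
        gcongr; norm_num
      _ = _ := by rw [Real.rpow_one]
  have hqn : ‖cnWeight α y‖ ≤ 2 := by
    have := norm_cnWeight_le h0 h1 y
    linarith
  set A := z ^ (α : ℂ) + lam with hAd
  set B := y ^ (α : ℂ) + lam * cnWeight α y with hBd
  have hAn : ‖A‖ ≤ 2 * S := by
    refine (norm_add_le _ _).trans ?_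
    rw [Complex.norm_real, Real.norm_of_nonneg hl]
    linarith
  -- over the common denominator both consistency errors appear as explicit factors
  have hN : errorSymbol α lam z =
      (z ^ 2 * (z ^ (α : ℂ) * ((y / z) ^ (α : ℂ) - cnWeight α y)) +
        (z ^ 2 - bdfSymbol y ^ 2) * (cnWeight α y * A)) / (z ^ 2 * (A * B)) := by
    have h3 : errorSymbol α lam z = A⁻¹ - bdfSymbol y ^ 2 * cnWeight α y / (z ^ 2 * B) := rfl
    rw [h3]
    have h4 : z ^ (α : ℂ) * ((y / z) ^ (α : ℂ) - cnWeight α y) = B - cnWeight α y * A := by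
      rw [mul_sub, ← hfac, hAd, hBd]; ring
    rw [h4]
    field_simp
    ring
  rw [hN, norm_div]
  have hden : ‖z‖ ^ 2 * (c / 2 * S * (c / 2 * S)) ≤ ‖z ^ 2 * (A * B)‖ := by
    rw [norm_mul, norm_mul, norm_pow]; gcongr
  have hnum : ‖z ^ 2 * (z ^ (α : ℂ) * ((y / z) ^ (α : ℂ) - cnWeight α y)) +
        (z ^ 2 - bdfSymbol y ^ 2) * (cnWeight α y * A)‖ ≤ 44 * ‖z‖ ^ 4 * S := by
    refine (norm_add_le _ _).trans ?_
    rw [norm_mul, norm_mul, norm_mul, norm_mul, norm_pow]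
    calc _ ≤ ‖z‖ ^ 2 * ((2 * ‖z0‖ ^ α) * (6 * ‖z‖ ^ 2)) + 8 * ‖z‖ ^ 4 * (2 * (2 * S)) := by gcongr
      _ = 12 * ‖z‖ ^ 4 * ‖z0‖ ^ α + 32 * ‖z‖ ^ 4 * S := by ring
      _ ≤ 12 * ‖z‖ ^ 4 * S + 32 * ‖z‖ ^ 4 * S := by gcongr; linarith
      _ = _ := by ring
  have hzpos : 0 < ‖z‖ := norm_pos_iff.2 hzn
  calc _ ≤ 44 * ‖z‖ ^ 4 * S / (‖z‖ ^ 2 * (c / 2 * S * (c / 2 * S))) := by gcongr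
    _ = 176 / c ^ 2 * (‖z‖ ^ 2 * S⁻¹) := by field_simp; norm_num
    _ ≤ 176 / c ^ 2 * ((5 / 4 * ‖z0‖) ^ 2 * (‖z0‖ ^ α)⁻¹) := by
      gcongr; linarith
    _ = 275 / c ^ 2 * (‖z0‖ ^ 2 / ‖z0‖ ^ α) := by field_simp; norm_num
    _ ≤ _ := by
      rw [Real.rpow_sub hZ, Real.rpow_two]
      gcongr; norm_num

/-- Cauchy's estimate for the third derivative. -/
theorem norm_iteratedDeriv_three_le {f : ℂ → ℂ} {z0 : ℂ} {R M : ℝ} (hR : 0 < R)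
    (h : ∀ z, ‖z - z0‖ ≤ R → DifferentiableAt ℂ f z ∧ ‖f z‖ ≤ M) :
    ‖iteratedDeriv 3 f z0‖ ≤ 6 * M / R ^ 3 := by
  have hd : DifferentiableOn ℂ f (Metric.closedBall z0 R) := fun z hz =>
    (h z (by simpa [dist_eq_norm] using hz)).1.differentiableWithinAt
  have := Complex.norm_iteratedDeriv_le_of_forall_mem_sphere_norm_le (c := z0) (C := M) 3 hR
    (hd.diffContOnCl_ball (subset_refl _))
    (fun z hz => (h z (by
      have := Metric.sphere_subset_closedBall hz
      simpa [dist_eq_norm] using this)).2)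
  simpa [Nat.factorial] using this

theorem norm_iteratedDeriv_exactSymbol_le {α : ℝ} (h0 : 0 < α) (h1 : α < 1) :
    ∃ C : ℝ, 0 < C ∧ ∀ lam : ℝ, 0 ≤ lam → ∀ z : ℂ, 0 < z.re →
      ‖iteratedDeriv 3 (exactSymbol α lam) z‖ ≤ C * ‖z‖ ^ (-α - 3) := by
  have hc0 := sectorConst_pos h0 h1
  refine ⟨6 * (2 / sectorConst α) / (sectorConst α / 6) ^ 3, by positivity, ?_⟩
  intro lam hl z hz
  have hn : 0 < ‖z‖ := norm_pos_iff.2 (fun h => by simp [h] at hz)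
  refine (norm_iteratedDeriv_three_le (R := sectorConst α / 6 * ‖z‖) (by positivity)
    (fun w hw => norm_exactSymbol_le h0 h1 hl hz hw)).trans (le_of_eq ?_)
  rw [Real.rpow_sub hn, mul_pow]
  norm_cast
  field_simp

theorem norm_iteratedDeriv_discreteSymbol_le {α : ℝ} (h0 : 0 < α) (h1 : α < 1) :
    ∃ C : ℝ, 0 < C ∧ ∀ lam : ℝ, 0 ≤ lam → ∀ z : ℂ, 0 < z.re →
      ‖iteratedDeriv 3 (discreteSymbol α lam) z‖ ≤
        C * (‖backDiff z‖ ^ (-1 - α) * (‖z‖ ^ 2)⁻¹) := by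
  have hc0 := sectorConst_pos h0 h1
  have h1' : 0 < 1 - α := by linarith
  refine ⟨6 * (1000 / sectorConst α) / (sectorConst α * (1 - α) / 12) ^ 3, by positivity, ?_⟩
  intro lam hl z hz
  have hn : 0 < ‖backDiff z‖ := norm_pos_iff.2
    (fun h => by have := backDiff_re_pos hz; simp [h] at this)
  refine (norm_iteratedDeriv_three_le (R := sectorConst α * (1 - α) / 12 * ‖backDiff z‖)
    (by positivity) (fun w hw => norm_discreteSymbol_le h0 h1 hl hz hw)).trans (le_of_eq ?_)
  have e : (-1 - α : ℝ) = (2 - α) - 3 := by ring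
  rw [e, Real.rpow_sub hn (2 - α) 3, mul_pow]
  norm_cast
  field_simp

theorem differentiableAt_errorSymbol {α : ℝ} (h0 : 0 < α) (h1 : α < 1) {lam : ℝ} (hl : 0 ≤ lam)
    {z : ℂ} (hz : 0 < z.re) : DifferentiableAt ℂ (errorSymbol α lam) z := by
  have hc0 := sectorConst_pos h0 h1
  have h1' : 0 < 1 - α := by linarith
  exact (norm_exactSymbol_le h0 h1 hl hz (by simp; positivity)).1.sub
    (norm_discreteSymbol_le h0 h1 hl hz (by simp; positivity)).1

theorem isOpen_rightHalfPlane : IsOpen {z : ℂ | 0 < z.re} :=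
  isOpen_lt continuous_const Complex.continuous_re

theorem contDiffAt_of_differentiableOn_rightHalfPlane {f : ℂ → ℂ}
    (hf : ∀ z : ℂ, 0 < z.re → DifferentiableAt ℂ f z) {n : WithTop ℕ∞} {z : ℂ} (hz : 0 < z.re) :
    ContDiffAt ℂ n f z := by
  have hd : DifferentiableOn ℂ f {z : ℂ | 0 < z.re} :=
    fun w hw => (hf w hw).differentiableWithinAt
  exact (hd.analyticAt (isOpen_rightHalfPlane.mem_nhds hz)).contDiffAt

/-- The third derivative of the error symbol, for all frequencies. -/
theorem norm_iteratedDeriv_errorSymbol_le {α : ℝ} (h0 : 0 < α) (h1 : α < 1) :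
    ∃ C : ℝ, 0 < C ∧ ∀ lam : ℝ, 0 ≤ lam → ∀ z : ℂ, 0 < z.re →
      ‖iteratedDeriv 3 (errorSymbol α lam) z‖ ≤
        C * (‖backDiff z‖ ^ (-1 - α) * (‖z‖ ^ 2)⁻¹) := by
  obtain ⟨C1, hC1, H1⟩ := norm_iteratedDeriv_exactSymbol_le h0 h1
  obtain ⟨C2, hC2, H2⟩ := norm_iteratedDeriv_discreteSymbol_le h0 h1
  refine ⟨C1 * 2 ^ (1 + α) + C2, by positivity, fun lam hl z hz => ?_⟩
  have hc0 := sectorConst_pos h0 h1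
  have h1' : 0 < 1 - α := by linarith
  have hn : 0 < ‖z‖ := norm_pos_iff.2 (fun h => by simp [h] at hz)
  have hy : 0 < ‖backDiff z‖ := norm_pos_iff.2
    (fun h => by have := backDiff_re_pos hz; simp [h] at this)
  have hd1 : ContDiffAt ℂ ((3 : ℕ) : WithTop ℕ∞) (exactSymbol α lam) z :=
    contDiffAt_of_differentiableOn_rightHalfPlane
      (fun w hw => (norm_exactSymbol_le h0 h1 hl hw (by simp; positivity)).1) hz
  have hd2 : ContDiffAt ℂ ((3 : ℕ) : WithTop ℕ∞) (discreteSymbol α lam) z :=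
    contDiffAt_of_differentiableOn_rightHalfPlane
      (fun w hw => (norm_discreteSymbol_le h0 h1 hl hw (by simp; positivity)).1) hz
  have e : errorSymbol α lam = exactSymbol α lam - discreteSymbol α lam := rfl
  rw [e, iteratedDeriv_sub hd1 hd2, add_mul]
  refine (norm_sub_le _ _).trans (add_le_add ((H1 lam hl z hz).trans ?_) (H2 lam hl z hz))
  have e1 : ‖z‖ ^ (-α - 3) = ‖z‖ ^ (-1 - α) * (‖z‖ ^ 2)⁻¹ := by
    rw [← Real.rpow_two, ← Real.rpow_neg hn.le, ← Real.rpow_add hn]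
    congr 1; ring
  rw [e1, mul_assoc C1]
  have e2 : ‖z‖ ^ (-1 - α) ≤ 2 ^ (1 + α) * ‖backDiff z‖ ^ (-1 - α) := by
    have h3 : (‖backDiff z‖ / 2) ^ (1 + α) ≤ ‖z‖ ^ (1 + α) := by
      gcongr
      linarith [norm_backDiff_le hz]
    have e3 : (-1 - α : ℝ) = -(1 + α) := by ring
    rw [e3, Real.rpow_neg hn.le, Real.rpow_neg hy.le]
    rw [Real.div_rpow hy.le (by norm_num)] at h3
    have h5 : 0 < ‖backDiff z‖ ^ (1 + α) := by positivity
    have := inv_anti₀ (by positivity) h3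
    rw [inv_div] at this
    rwa [← div_eq_mul_inv]
  calc _ ≤ C1 * (2 ^ (1 + α) * ‖backDiff z‖ ^ (-1 - α) * (‖z‖ ^ 2)⁻¹) := by gcongr
    _ = _ := by ring

/-- The third derivative of the error symbol at low frequencies. -/
theorem norm_iteratedDeriv_errorSymbol_le_of_small {α : ℝ} (h0 : 0 < α) (h1 : α < 1) :
    ∃ C : ℝ, 0 < C ∧ ∀ lam : ℝ, 0 ≤ lam → ∀ z : ℂ, 0 < z.re → ‖z‖ ≤ sectorConst α / 50 →
      ‖iteratedDeriv 3 (errorSymbol α lam) z‖ ≤ C * ‖z‖ ^ (-1 - α) := by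
  have hc0 := sectorConst_pos h0 h1
  refine ⟨6 * (1000 / sectorConst α ^ 2) / (sectorConst α / 12) ^ 3, by positivity, ?_⟩
  intro lam hl z hz hzs
  have hn : 0 < ‖z‖ := norm_pos_iff.2 (fun h => by simp [h] at hz)
  refine (norm_iteratedDeriv_three_le (R := sectorConst α / 12 * ‖z‖) (by positivity)
    (fun w hw => norm_errorSymbol_le h0 h1 hl hz hzs hw)).trans (le_of_eq ?_)
  have e : (-1 - α : ℝ) = (2 - α) - 3 := by ring
  rw [e, Real.rpow_sub hn (2 - α) 3, mul_pow]
  norm_cast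
  field_simp

/-! ### Integrals of the error symbol along vertical lines -/

theorem integrable_rpow_add_abs {α : ℝ} (h0 : 0 < α) {s : ℝ} (hs : 0 < s) :
    Integrable (fun v : ℝ => (s + |v|) ^ (-1 - α)) ∧
      ∫ v : ℝ, (s + |v|) ^ (-1 - α) = (∫ v : ℝ, (1 + |v|) ^ (-1 - α)) * s ^ (-α) := by
  have hi : Integrable (fun v : ℝ => (1 + |v|) ^ (-1 - α)) := by
    have := integrable_one_add_norm (E := ℝ) (μ := volume) (r := 1 + α) (by simpa using h0)
    simp only [Real.norm_eq_abs, neg_add] at this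
    exact this
  have e : (fun v : ℝ => (s + |v|) ^ (-1 - α)) =
      fun v => s ^ (-1 - α) * (1 + |s⁻¹ * v|) ^ (-1 - α) := by
    ext v
    rw [← Real.mul_rpow hs.le (by positivity), abs_mul, abs_inv, abs_of_pos hs, mul_add]
    congr 2
    · ring
    · field_simp
  rw [e]
  refine ⟨(hi.comp_mul_left' (inv_ne_zero hs.ne')).const_mul _, ?_⟩
  rw [integral_const_mul, Measure.integral_comp_mul_left (fun v => (1 + |v|) ^ (-1 - α)) s⁻¹,
    inv_inv, abs_of_pos hs, smul_eq_mul]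
  have : s ^ (-α) = s ^ (-1 - α) * s := by
    conv_rhs => rw [← Real.rpow_one s, ← Real.rpow_mul hs.le, ← Real.rpow_add hs]
    ring_nf
  rw [this]; ring

theorem vertical_re (s w : ℝ) : ((s : ℂ) + 2 * Real.pi * w * Complex.I).re = s := by
  simp

theorem vertical_im (s w : ℝ) : ((s : ℂ) + 2 * Real.pi * w * Complex.I).im = 2 * Real.pi * w := by
  simp

theorem half_min_le_one_sub_exp_neg {s : ℝ} (hs : 0 < s) :
    min s 1 / 2 ≤ 1 - Real.exp (-s) := by
  have h1 : Real.exp (-s) ≤ (1 + s)⁻¹ := by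
    rw [Real.exp_neg]
    exact inv_anti₀ (by positivity) (by linarith [Real.add_one_le_exp s])
  have h2 : min s 1 / 2 ≤ 1 - (1 + s)⁻¹ := by
    have : 1 - (1 + s)⁻¹ = s / (1 + s) := by field_simp; ring
    rw [this, div_le_div_iff₀ (by norm_num) (by positivity)]
    rcases le_total s 1 with h | h
    · rw [min_eq_left h]; nlinarith
    · rw [min_eq_right h]; linarith
  linarith

theorem half_min_le_norm_backDiff {z : ℂ} (hz : 0 < z.re) : min z.re 1 / 2 ≤ ‖backDiff z‖ := by
  refine (half_min_le_one_sub_exp_neg hz).trans ?_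
  have := norm_sub_norm_le (1 : ℂ) (Complex.exp (-z))
  rw [Complex.norm_exp, norm_one, Complex.neg_re] at this
  exact this

/-- On the vertical line `Re z = s` the function `1 - e^{-z}` vanishes to first order at the points
of `s + 2πiℤ` and nowhere else. -/
theorem add_abs_le_norm_backDiff {s : ℝ} (hs : 0 < s) (hs1 : s ≤ 1) (m : ℤ) {w : ℝ}
    (hw : |w - m| ≤ 1 / 2) :
    (s + |w - m|) / 4 ≤ ‖backDiff ((s : ℂ) + 2 * Real.pi * w * Complex.I)‖ := by
  have h1 := half_min_le_norm_backDiff (z := (s : ℂ) + 2 * Real.pi * w * Complex.I)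
    (by rw [vertical_re]; exact hs)
  rw [vertical_re, min_eq_left hs1] at h1
  set v := w - m with hv
  have e : backDiff ((s : ℂ) + 2 * Real.pi * w * Complex.I) =
      1 - (Real.exp (-s) : ℝ) * Complex.exp ((-(2 * Real.pi * v) : ℝ) * Complex.I) := by
    rw [backDiff, Complex.ofReal_exp, ← Complex.exp_add]
    congr 1
    have : (-((s : ℂ) + 2 * Real.pi * w * Complex.I)) =
        ((-s : ℝ) : ℂ) + (-(2 * Real.pi * v) : ℝ) * Complex.I +
          (-m : ℤ) * (2 * Real.pi * Complex.I) := by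
      rw [hv]; push_cast; ring
    rw [this, Complex.exp_add, Complex.exp_int_mul_two_pi_mul_I, mul_one]
  have h2 : |v| ≤ ‖backDiff ((s : ℂ) + 2 * Real.pi * w * Complex.I)‖ := by
    rw [e]
    have hpi := Real.pi_pos
    rcases le_or_gt |v| (1 / 4) with h | h
    · refine le_trans ?_ (Complex.abs_im_le_norm _)
      rw [Complex.sub_im, Complex.one_im, zero_sub, abs_neg, Complex.im_ofReal_mul,
        Complex.exp_ofReal_mul_I_im, Real.sin_neg, abs_mul, abs_neg, abs_of_pos (Real.exp_pos _)]
      have hs2 : 4 * |v| ≤ |Real.sin (2 * Real.pi * v)| := by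
        have := Real.mul_abs_le_abs_sin (x := 2 * Real.pi * v)
          (by rw [abs_mul, abs_of_pos (by positivity)]; nlinarith)
        rw [abs_mul, abs_of_pos (by positivity : 0 < 2 * Real.pi)] at this
        have e2 : 2 / Real.pi * (2 * Real.pi * |v|) = 4 * |v| := by field_simp; ring
        linarith
      have hs3 : 1 / 4 ≤ Real.exp (-s) := by
        have h4 : Real.exp (-1) ≤ Real.exp (-s) := Real.exp_le_exp.2 (by linarith)
        have h5 : (1 : ℝ) / 4 ≤ Real.exp (-1) := by
          rw [Real.exp_neg, one_div]
          exact inv_anti₀ (Real.exp_pos _) (by linarith [Real.exp_one_lt_d9])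
        linarith
      calc |v| = 1 / 4 * (4 * |v|) := by ring
        _ ≤ _ := by gcongr
    · refine le_trans ?_ (Complex.re_le_norm _)
      rw [Complex.sub_re, Complex.one_re, Complex.re_ofReal_mul, Complex.exp_ofReal_mul_I_re,
        Real.cos_neg]
      have hc : Real.cos (2 * Real.pi * v) ≤ 0 := by
        rw [← Real.cos_abs, abs_mul, abs_of_pos (by positivity : 0 < 2 * Real.pi)]
        refine Real.cos_nonpos_of_pi_div_two_le_of_le (by nlinarith) (by nlinarith)
      nlinarith [Real.exp_pos (-s)]
  linarith

/-- A pointwise bound uniform in the period of `1 - e^{-z}`. -/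
theorem norm_iteratedDeriv_errorSymbol_le' {α : ℝ} (h0 : 0 < α) (h1 : α < 1) :
    ∃ C : ℝ, 0 < C ∧ ∀ lam : ℝ, 0 ≤ lam → ∀ z : ℂ, 0 < z.re →
      ‖iteratedDeriv 3 (errorSymbol α lam) z‖ ≤
        C * (‖backDiff z‖ ^ (-1 - α) * (1 + z.im ^ 2)⁻¹) := by
  obtain ⟨C1, hC1, H1⟩ := norm_iteratedDeriv_errorSymbol_le h0 h1
  obtain ⟨C2, hC2, H2⟩ := norm_iteratedDeriv_errorSymbol_le_of_small h0 h1
  have hc0 := sectorConst_pos h0 h1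
  have hc1 := sectorConst_le_one α
  set s := sectorConst α / 50 with hs
  have hs0 : 0 < s := by positivity
  have hs1 : s ≤ 1 := by linarith
  refine ⟨C1 * (1 / s ^ 2 + 1) + C2 * 2 ^ (1 + α) * 2, by positivity, fun lam hl z hz => ?_⟩
  have hn : 0 < ‖z‖ := norm_pos_iff.2 (fun h => by simp [h] at hz)
  have hy : 0 < ‖backDiff z‖ := norm_pos_iff.2
    (fun h => by have := backDiff_re_pos hz; simp [h] at this)
  have him : z.im ^ 2 ≤ ‖z‖ ^ 2 := by
    rw [← sq_abs]; gcongr; exact Complex.abs_im_le_norm z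
  have hyp : 0 < ‖backDiff z‖ ^ (-1 - α) := by positivity
  rw [add_mul]
  rcases le_or_gt ‖z‖ s with h | h
  · have e2 : ‖z‖ ^ (-1 - α) ≤ 2 ^ (1 + α) * ‖backDiff z‖ ^ (-1 - α) := by
      have h3 : (2 * ‖z‖) ^ (-1 - α) ≤ ‖backDiff z‖ ^ (-1 - α) :=
        Real.rpow_le_rpow_of_nonpos hy (norm_backDiff_le hz) (by linarith)
      rw [Real.mul_rpow (by norm_num) hn.le] at h3
      have e3 : (2 : ℝ) ^ (1 + α) * 2 ^ (-1 - α) = 1 := by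
        rw [← Real.rpow_add (by norm_num)]; norm_num
      calc ‖z‖ ^ (-1 - α) = 2 ^ (1 + α) * (2 ^ (-1 - α) * ‖z‖ ^ (-1 - α)) := by
            rw [← mul_assoc, e3, one_mul]
        _ ≤ _ := by gcongr
    have h4 : (1 : ℝ) ≤ 2 * (1 + z.im ^ 2)⁻¹ := by
      rw [← div_eq_mul_inv, le_div_iff₀ (by positivity)]
      nlinarith
    refine le_trans ?_ (le_add_of_nonneg_left (by positivity))
    calc _ ≤ C2 * ‖z‖ ^ (-1 - α) := H2 lam hl z hz h
      _ ≤ C2 * (2 ^ (1 + α) * ‖backDiff z‖ ^ (-1 - α)) * 1 := by rw [mul_one]; gcongr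
      _ ≤ C2 * (2 ^ (1 + α) * ‖backDiff z‖ ^ (-1 - α)) * (2 * (1 + z.im ^ 2)⁻¹) := by gcongr
      _ = _ := by ring
  · refine le_trans ?_ (le_add_of_nonneg_right (by positivity))
    have h4 : (‖z‖ ^ 2)⁻¹ ≤ (1 / s ^ 2 + 1) * (1 + z.im ^ 2)⁻¹ := by
      rw [← div_eq_mul_inv, le_div_iff₀ (by positivity), inv_mul_le_iff₀ (by positivity)]
      have : 1 ≤ ‖z‖ ^ 2 * (1 / s ^ 2) := by
        rw [mul_one_div, le_div_iff₀ (by positivity), one_mul]; gcongr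
      nlinarith
    calc _ ≤ C1 * (‖backDiff z‖ ^ (-1 - α) * (‖z‖ ^ 2)⁻¹) := H1 lam hl z hz
      _ ≤ C1 * (‖backDiff z‖ ^ (-1 - α) * ((1 / s ^ 2 + 1) * (1 + z.im ^ 2)⁻¹)) := by gcongr
      _ = _ := by ring

/-- For fixed `λ` the third derivative decays quadratically on every half plane `Re z ≥ a > 0`, as
needed for Laplace inversion. -/
theorem errorSymbol_decay {α : ℝ} (h0 : 0 < α) (h1 : α < 1) {lam : ℝ} (hl : 0 ≤ lam) {a : ℝ}
    (ha : 0 < a) : ∃ M : ℝ, ∀ z : ℂ, a ≤ z.re →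
      ‖iteratedDeriv 3 (errorSymbol α lam) z‖ ≤ M * (1 + z.im ^ 2)⁻¹ := by
  obtain ⟨C, hC, H⟩ := norm_iteratedDeriv_errorSymbol_le' h0 h1
  refine ⟨C * (min a 1 / 2) ^ (-1 - α), fun z hz => ?_⟩
  have hm : 0 < min a 1 := lt_min ha one_pos
  refine (H lam hl z (by linarith)).trans ?_
  rw [mul_assoc]
  have h3 : ‖backDiff z‖ ^ (-1 - α) ≤ (min a 1 / 2) ^ (-1 - α) := by
    refine Real.rpow_le_rpow_of_nonpos (by positivity) ?_ (by linarith)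
    refine le_trans ?_ (half_min_le_norm_backDiff (by linarith))
    gcongr
  gcongr

theorem differentiableAt_iteratedDeriv_rightHalfPlane {F : ℂ → ℂ}
    (hF : ∀ z : ℂ, 0 < z.re → DifferentiableAt ℂ F z) {z : ℂ} (hz : 0 < z.re) (n : ℕ) :
    DifferentiableAt ℂ (iteratedDeriv n F) z := by
  have hd : DifferentiableOn ℂ F {z : ℂ | 0 < z.re} :=
    fun z hz => (hF z hz).differentiableWithinAt
  rw [iteratedDeriv_eq_iterate]
  exact ((hd.analyticAt (isOpen_rightHalfPlane.mem_nhds hz)).iterated_deriv n).differentiableAt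

theorem continuous_iteratedDeriv_vertical {F : ℂ → ℂ}
    (hF : ∀ z : ℂ, 0 < z.re → DifferentiableAt ℂ F z) {s : ℝ} (hs : 0 < s) (n : ℕ) :
    Continuous fun w : ℝ => iteratedDeriv n F ((s : ℂ) + 2 * Real.pi * w * Complex.I) := by
  rw [continuous_iff_continuousAt]
  intro w
  have h1 : ContinuousAt (iteratedDeriv n F) ((s : ℂ) + 2 * Real.pi * w * Complex.I) :=
    (differentiableAt_iteratedDeriv_rightHalfPlane hF (by rw [vertical_re]; exact hs)
      n).continuousAt
  exact ContinuousAt.comp (f := fun w : ℝ => (s : ℂ) + 2 * Real.pi * w * Complex.I) h1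
    (by fun_prop)

/-- The integral of the third derivative of the error symbol over `Re z = s` is `O(s^{-α})`. -/
theorem integral_norm_iteratedDeriv_errorSymbol_le {α : ℝ} (h0 : 0 < α) (h1 : α < 1) :
    ∃ C : ℝ, 0 < C ∧ ∀ lam : ℝ, 0 ≤ lam → ∀ s : ℝ, 0 < s →
      ∫ w : ℝ, ‖iteratedDeriv 3 (errorSymbol α lam) ((s : ℂ) + 2 * Real.pi * w * Complex.I)‖ ≤
        C * s ^ (-α) := by
  obtain ⟨C1, hC1, H1⟩ := norm_iteratedDeriv_errorSymbol_le h0 h1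
  obtain ⟨C2, hC2, H2⟩ := norm_iteratedDeriv_errorSymbol_le' h0 h1
  set J := ∫ v : ℝ, (1 + |v|) ^ (-1 - α) with hJ
  have hJ0 : 0 ≤ J := integral_nonneg fun v => by positivity
  have hsum : Summable fun m : ℤ => (1 + (m : ℝ) ^ 2)⁻¹ := by
    have h2 := (Real.summable_one_div_int_pow (p := 2)).2 (by norm_num)
    refine (Summable.of_norm_bounded_eventually (g := fun m : ℤ => 1 / (m : ℝ) ^ 2) h2 ?_)
    filter_upwards [(Set.finite_singleton (0 : ℤ)).compl_mem_cofinite] with m hm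
    have hm0 : (m : ℝ) ≠ 0 := by exact_mod_cast hm
    rw [Real.norm_of_nonneg (by positivity), one_div]
    exact inv_anti₀ (by positivity) (by linarith)
  set S := ∑' m : ℤ, (1 + (m : ℝ) ^ 2)⁻¹ with hS
  have hS0 : 0 ≤ S := tsum_nonneg fun m => by positivity
  refine ⟨C1 * 2 ^ (1 + α) * 2 * J + C2 * 4 ^ (1 + α) * 2 * J * S + 1, by positivity,
    fun lam hl s hs => ?_⟩
  obtain ⟨hi, hie⟩ := integrable_rpow_add_abs h0 hs
  have hsα : 0 < s ^ (-α) := by positivity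
  rcases le_or_gt s 1 with hs1 | hs1
  -- For `s ≤ 1` the line is cut into the unit intervals around the zeros `2 π i m` of `1 - e^{-z}`.
  -- Each contributes a multiple of `s ^ (-α)`, and the factor `(1 + m²)⁻¹` makes the sum converge.
  · have hcont := continuous_iteratedDeriv_vertical
      (fun z hz => differentiableAt_errorSymbol h0 h1 hl hz) hs 3
    set Φ := fun w : ℝ =>
      iteratedDeriv 3 (errorSymbol α lam) ((s : ℂ) + 2 * Real.pi * w * Complex.I) with hΦ
    rw [integral_norm_eq_lintegral_enorm hcont.aestronglyMeasurable]
    refine ENNReal.toReal_le_of_le_ofReal (by positivity) ?_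
    rw [← setLIntegral_univ, ← iUnion_Ioc_add_intCast (-(1 / 2) : ℝ),
      lintegral_iUnion (fun m => measurableSet_Ioc) (pairwise_disjoint_Ioc_add_intCast _)]
    have hterm : ∀ m : ℤ, ∫⁻ w in Ioc (-(1 / 2) + (m : ℝ)) (-(1 / 2) + m + 1), ‖Φ w‖ₑ ≤
        ENNReal.ofReal (C2 * 4 ^ (1 + α) * 2 * J * s ^ (-α) * (1 + (m : ℝ) ^ 2)⁻¹) := by
      intro m
      have hb : ∀ w ∈ Ioc (-(1 / 2) + (m : ℝ)) (-(1 / 2) + m + 1), ‖Φ w‖ₑ ≤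
          ENNReal.ofReal (C2 * 4 ^ (1 + α) * 2 * (1 + (m : ℝ) ^ 2)⁻¹ *
            (s + |w - m|) ^ (-1 - α)) := by
        intro w hw
        have hwm : |w - m| ≤ 1 / 2 := abs_le.2 ⟨by linarith [hw.1], by linarith [hw.2]⟩
        rw [← ofReal_norm]
        refine ENNReal.ofReal_le_ofReal ?_
        refine (H2 lam hl _ (by rw [vertical_re]; exact hs)).trans ?_
        rw [vertical_im]
        have hy := add_abs_le_norm_backDiff hs hs1 m hwm
        have hpos : 0 < s + |w - m| := by positivity
        have a1 : ‖backDiff ((s : ℂ) + 2 * Real.pi * w * Complex.I)‖ ^ (-1 - α) ≤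
            4 ^ (1 + α) * (s + |w - m|) ^ (-1 - α) := by
          refine (Real.rpow_le_rpow_of_nonpos (by positivity) hy (by linarith)).trans
            (le_of_eq ?_)
          rw [Real.div_rpow hpos.le (by norm_num), div_eq_mul_inv, ← Real.rpow_neg (by norm_num)]
          ring_nf
        have a2 : (1 + (2 * Real.pi * w) ^ 2)⁻¹ ≤ 2 * (1 + (m : ℝ) ^ 2)⁻¹ := by
          rw [← div_eq_mul_inv, le_div_iff₀ (by positivity), inv_mul_le_iff₀ (by positivity)]
          have b1 : w ^ 2 ≤ (2 * Real.pi * w) ^ 2 := by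
            rw [mul_pow]
            have : 1 ≤ (2 * Real.pi) ^ 2 := by nlinarith [Real.pi_gt_three]
            nlinarith [sq_nonneg w]
          have b2 : (w - m) ^ 2 ≤ (1 / 2) ^ 2 := by
            rw [← sq_abs]; gcongr
          nlinarith [sq_nonneg (w - (m - w)), sq_nonneg (w - m - w)]
        calc C2 * (‖backDiff ((s : ℂ) + 2 * Real.pi * w * Complex.I)‖ ^ (-1 - α) *
              (1 + (2 * Real.pi * w) ^ 2)⁻¹) ≤
            C2 * ((4 ^ (1 + α) * (s + |w - m|) ^ (-1 - α)) * (2 * (1 + (m : ℝ) ^ 2)⁻¹)) := by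
              gcongr
          _ = _ := by ring
      refine (setLIntegral_mono_ae' measurableSet_Ioc (ae_of_all _ hb)).trans ?_
      refine (setLIntegral_le_lintegral _ _).trans ?_
      rw [← ofReal_integral_eq_lintegral_ofReal ((hi.comp_sub_right (m : ℝ)).const_mul _)
        (ae_of_all _ fun w => by positivity)]
      refine ENNReal.ofReal_le_ofReal (le_of_eq ?_)
      rw [integral_const_mul, integral_sub_right_eq_self (fun w => (s + |w|) ^ (-1 - α)), hie]
      ring
    refine (ENNReal.tsum_le_tsum hterm).trans ?_
    rw [← ENNReal.ofReal_tsum_of_nonneg (fun m => by positivity) (hsum.mul_left _), tsum_mul_left]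
    refine ENNReal.ofReal_le_ofReal ?_
    have : 0 ≤ C1 * 2 ^ (1 + α) * 2 * J * s ^ (-α) := by positivity
    nlinarith
  -- For `s > 1` the factor `1 - e^{-z}` stays away from its zeros.
  · have hb : ∀ w : ℝ,
        ‖iteratedDeriv 3 (errorSymbol α lam) ((s : ℂ) + 2 * Real.pi * w * Complex.I)‖ ≤
          C1 * 2 ^ (1 + α) * 2 * (s + |w|) ^ (-1 - α) := by
      intro w
      set z := (s : ℂ) + 2 * Real.pi * w * Complex.I with hz
      have hzre : z.re = s := vertical_re s w
      have hzim : z.im = 2 * Real.pi * w := vertical_im s w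
      refine (H1 lam hl z (by rw [hzre]; exact hs)).trans ?_
      have hy := half_min_le_norm_backDiff (z := z) (by rw [hzre]; exact hs)
      rw [hzre, min_eq_right hs1.le] at hy
      have a1 : ‖backDiff z‖ ^ (-1 - α) ≤ 2 ^ (1 + α) := by
        refine (Real.rpow_le_rpow_of_nonpos (by positivity) hy (by linarith)).trans
          (le_of_eq ?_)
        rw [one_div, Real.inv_rpow (by norm_num), ← Real.rpow_neg (by norm_num)]
        ring_nf
      have a2 : (‖z‖ ^ 2)⁻¹ ≤ 2 * (s + |w|) ^ (-1 - α) := by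
        have b1 : (s + |w|) ^ 2 ≤ 2 * ‖z‖ ^ 2 := by
          rw [Complex.sq_norm, Complex.normSq_apply, hzre, hzim]
          have : w * w ≤ (2 * Real.pi * w) * (2 * Real.pi * w) := by
            have : 1 ≤ (2 * Real.pi) ^ 2 := by nlinarith [Real.pi_gt_three]
            nlinarith [mul_self_nonneg w]
          nlinarith [sq_nonneg (s - |w|), abs_mul_abs_self w]
        have b2 : (s + |w|) ^ (1 + α) ≤ (s + |w|) ^ 2 := by
          rw [← Real.rpow_two]
          exact Real.rpow_le_rpow_of_exponent_le (by linarith [abs_nonneg w]) (by linarith)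
        have hp : 0 < s + |w| := by positivity
        have e : (-1 - α : ℝ) = -(1 + α) := by ring
        rw [e, Real.rpow_neg hp.le]
        have hp2 : 0 < (s + |w|) ^ (1 + α) := by positivity
        have : (‖z‖ ^ 2)⁻¹ ≤ ((s + |w|) ^ (1 + α) / 2)⁻¹ :=
          inv_anti₀ (by positivity) (by linarith)
        refine this.trans (le_of_eq ?_)
        field_simp
      calc C1 * (‖backDiff z‖ ^ (-1 - α) * (‖z‖ ^ 2)⁻¹) ≤
          C1 * (2 ^ (1 + α) * (2 * (s + |w|) ^ (-1 - α))) := by gcongr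
        _ = _ := by ring
    refine (integral_mono_of_nonneg (ae_of_all _ fun w => norm_nonneg _)
      (hi.const_mul (C1 * 2 ^ (1 + α) * 2)) (ae_of_all _ hb)).trans ?_
    rw [integral_const_mul, hie]
    have : 0 ≤ C2 * 4 ^ (1 + α) * 2 * J * S * s ^ (-α) := by positivity
    nlinarith

/-! ### The Laplace transform and its inversion -/

/-- The Laplace transform `∫_0^∞ f(t) e^{-zt} dt` of a real function. -/
noncomputable def laplace (f : ℝ → ℝ) (z : ℂ) : ℂ :=
  ∫ t in Ioi (0 : ℝ), (f t : ℂ) * Complex.exp (-z * t)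

/-- The Laplace integral of `f` converges absolutely on the half-plane `Re z > s₀`. -/
def LaplaceAbs (f : ℝ → ℝ) (s0 : ℝ) : Prop :=
  ∀ s : ℝ, s0 < s → IntegrableOn (fun t => f t * Real.exp (-s * t)) (Ioi 0)

theorem LaplaceAbs.aestronglyMeasurable {f : ℝ → ℝ} {s0 : ℝ} (h : LaplaceAbs f s0) :
    AEStronglyMeasurable f (volume.restrict (Ioi 0)) := by
  have h1 := (h (s0 + 1) (by linarith)).aestronglyMeasurable
  have h2 : AEStronglyMeasurable (fun t : ℝ => Real.exp ((s0 + 1) * t))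
      (volume.restrict (Ioi 0)) := by fun_prop
  refine (h1.mul h2).congr (ae_of_all _ fun t => ?_)
  simp only [Pi.mul_apply]
  rw [mul_assoc, ← Real.exp_add, show -(s0 + 1) * t + (s0 + 1) * t = 0 by ring, Real.exp_zero,
    mul_one]

theorem norm_ofReal_mul_cexp (a : ℝ) (z : ℂ) (t : ℝ) :
    ‖(a : ℂ) * Complex.exp (-z * t)‖ = |a| * Real.exp (-z.re * t) := by
  rw [norm_mul, Complex.norm_real, Complex.norm_exp, Real.norm_eq_abs]
  simp

theorem LaplaceAbs.integrableOn {f : ℝ → ℝ} {s0 : ℝ} (h : LaplaceAbs f s0) {z : ℂ}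
    (hz : s0 < z.re) : IntegrableOn (fun t : ℝ => (f t : ℂ) * Complex.exp (-z * t)) (Ioi 0) := by
  refine (h z.re hz).norm.mono' ?_ (ae_of_all _ fun t => ?_)
  · refine AEStronglyMeasurable.mul ?_ (by fun_prop)
    exact Complex.continuous_ofReal.comp_aestronglyMeasurable h.aestronglyMeasurable
  · rw [norm_ofReal_mul_cexp, norm_mul, Real.norm_eq_abs, Real.norm_of_nonneg (Real.exp_pos _).le]

theorem LaplaceAbs.mul_neg_id {f : ℝ → ℝ} {s0 : ℝ} (h : LaplaceAbs f s0) :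
    LaplaceAbs (fun t => -t * f t) s0 := by
  intro s hs
  set d := (s - s0) / 2 with hd
  have hd0 : 0 < d := by rw [hd]; linarith
  have h1 := (h (s0 + d) (by linarith)).norm.const_mul d⁻¹
  refine h1.mono' ?_ ?_
  · have := h.aestronglyMeasurable
    exact (continuous_neg.aestronglyMeasurable.mul this).mul (by fun_prop)
  · filter_upwards [ae_restrict_mem measurableSet_Ioi] with t ht
    have ht0 : 0 < t := ht
    rw [norm_mul, norm_mul, norm_mul, norm_neg, Real.norm_of_nonneg ht0.le,
      Real.norm_of_nonneg (Real.exp_pos _).le, Real.norm_of_nonneg (Real.exp_pos _).le]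
    have e : Real.exp (-(s0 + d) * t) = Real.exp (-s * t) * Real.exp (d * t) := by
      rw [← Real.exp_add]; congr 1; rw [hd]; ring
    have h2 : t ≤ d⁻¹ * Real.exp (d * t) := by
      rw [inv_mul_eq_div, le_div_iff₀ hd0]
      linarith [Real.add_one_le_exp (d * t)]
    rw [e]
    calc t * ‖f t‖ * Real.exp (-s * t) ≤
        (d⁻¹ * Real.exp (d * t)) * ‖f t‖ * Real.exp (-s * t) := by gcongr
      _ = _ := by ring

theorem LaplaceAbs.neg_pow_mul {f : ℝ → ℝ} {s0 : ℝ} (h : LaplaceAbs f s0) (n : ℕ) :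
    LaplaceAbs (fun t => (-t) ^ n * f t) s0 := by
  induction n with
  | zero => simpa using h
  | succ n ih =>
    have := ih.mul_neg_id
    convert this using 2
    ring

theorem hasDerivAt_laplace {f : ℝ → ℝ} {s0 : ℝ} (h : LaplaceAbs f s0) {z : ℂ} (hz : s0 < z.re) :
    HasDerivAt (laplace f) (laplace (fun t => -t * f t) z) z := by
  set s1 := (s0 + z.re) / 2 with hs1
  have h01 : s0 < s1 := by rw [hs1]; linarith
  have h1z : s1 < z.re := by rw [hs1]; linarith
  have hU : {w : ℂ | s1 < w.re} ∈ 𝓝 z :=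
    (isOpen_lt continuous_const Complex.continuous_re).mem_nhds h1z
  have hm := h.aestronglyMeasurable
  have hmc : AEStronglyMeasurable (fun t : ℝ => (f t : ℂ)) (volume.restrict (Ioi 0)) :=
    Complex.continuous_ofReal.comp_aestronglyMeasurable hm
  refine (hasDerivAt_integral_of_dominated_loc_of_deriv_le (μ := volume.restrict (Ioi (0 : ℝ)))
    (F := fun (w : ℂ) (t : ℝ) => (f t : ℂ) * Complex.exp (-w * t))
    (F' := fun (w : ℂ) (t : ℝ) => ((-t * f t : ℝ) : ℂ) * Complex.exp (-w * t))
    (bound := fun t => ‖-t * f t * Real.exp (-s1 * t)‖)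
    hU (Eventually.of_forall fun w => hmc.mul (by fun_prop)) (h.integrableOn hz)
    (h.mul_neg_id.integrableOn hz).aestronglyMeasurable ?_ (h.mul_neg_id s1 h01).norm ?_).2
  · filter_upwards [ae_restrict_mem measurableSet_Ioi] with t ht w hw
    have ht0 : (0 : ℝ) < t := ht
    have hw' : s1 < w.re := hw
    rw [norm_ofReal_mul_cexp, norm_mul, Real.norm_eq_abs, Real.norm_of_nonneg (Real.exp_pos _).le]
    gcongr
  · refine ae_of_all _ fun t w _ => ?_
    have h3 : HasDerivAt (fun w : ℂ => -w * (t : ℂ)) (-1 * t) w :=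
      ((hasDerivAt_id w).neg).mul_const _
    have h4 := (h3.cexp.const_mul (f t : ℂ))
    refine h4.congr_deriv ?_
    push_cast
    ring

theorem iteratedDeriv_laplace {f : ℝ → ℝ} {s0 : ℝ} (h : LaplaceAbs f s0) (n : ℕ) {z : ℂ}
    (hz : s0 < z.re) :
    iteratedDeriv n (laplace f) z = laplace (fun t => (-t) ^ n * f t) z := by
  induction n generalizing z with
  | zero => simp
  | succ n ih =>
    rw [iteratedDeriv_succ]
    have hU : {w : ℂ | s0 < w.re} ∈ 𝓝 z :=
      (isOpen_lt continuous_const Complex.continuous_re).mem_nhds hz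
    have he : iteratedDeriv n (laplace f) =ᶠ[𝓝 z] laplace (fun t => (-t) ^ n * f t) := by
      filter_upwards [hU] with w hw using ih hw
    rw [he.deriv_eq, (hasDerivAt_laplace (h.neg_pow_mul n) hz).deriv]
    congr 1
    ext t
    ring

/-- The integral over a vertical line does not change when the line is moved within the right
half-plane. -/
theorem integral_vertical_eq {Φ : ℂ → ℂ} (hΦ : ∀ z : ℂ, 0 < z.re → DifferentiableAt ℂ Φ z)
    {a b M : ℝ} (ha : 0 < a) (hab : a ≤ b)
    (hM : ∀ z : ℂ, a ≤ z.re → z.re ≤ b → ‖Φ z‖ ≤ M * (1 + z.im ^ 2)⁻¹) :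
    ∫ y : ℝ, Φ (a + y * Complex.I) = ∫ y : ℝ, Φ (b + y * Complex.I) := by
  have hcont : ∀ x : ℝ, 0 < x → Continuous fun y : ℝ => Φ (x + y * Complex.I) := by
    intro x hx
    rw [continuous_iff_continuousAt]
    intro y
    exact ContinuousAt.comp (f := fun y : ℝ => (x : ℂ) + y * Complex.I)
      (hΦ _ (by simpa using hx)).continuousAt (by fun_prop)
  have hint : ∀ x : ℝ, a ≤ x → x ≤ b → Integrable fun y : ℝ => Φ (x + y * Complex.I) := by
    intro x hx hxb
    refine (integrable_inv_one_add_sq.const_mul M).mono'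
      (hcont x (by linarith)).aestronglyMeasurable (ae_of_all _ fun y => ?_)
    simpa using hM (x + y * Complex.I) (by simpa using hx) (by simpa using hxb)
  have hrect : ∀ R : ℝ,
      Complex.I * (∫ y : ℝ in (-R)..R, Φ (b + y * Complex.I)) -
        Complex.I * (∫ y : ℝ in (-R)..R, Φ (a + y * Complex.I)) =
      (∫ x : ℝ in a..b, Φ (x + (R : ℝ) * Complex.I)) -
        ∫ x : ℝ in a..b, Φ (x + ((-R : ℝ) : ℂ) * Complex.I) := by
    intro R
    have := Complex.integral_boundary_rect_eq_zero_of_differentiableOn Φ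
      ((a : ℂ) + (-R : ℝ) * Complex.I) (b + (R : ℝ) * Complex.I) (by
        intro z hz
        refine (hΦ z ?_).differentiableWithinAt
        have hz1 := hz.1
        simp only [mem_preimage, Complex.add_re, Complex.ofReal_re, Complex.mul_re, Complex.I_re,
          Complex.ofReal_im, mul_zero, zero_mul, sub_zero, add_zero] at hz1
        rw [uIcc_of_le hab] at hz1
        linarith [hz1.1])
    simp only [Complex.add_re, Complex.ofReal_re, Complex.mul_re, Complex.I_re,
      Complex.ofReal_im, mul_zero, sub_zero, add_zero, Complex.add_im, Complex.mul_im,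
      Complex.I_im, mul_one, zero_add, smul_eq_mul] at this
    linear_combination this
  have hL : Tendsto (fun R : ℝ => Complex.I * (∫ y : ℝ in (-R)..R, Φ (b + y * Complex.I)) -
        Complex.I * (∫ y : ℝ in (-R)..R, Φ (a + y * Complex.I))) atTop
      (𝓝 (Complex.I * (∫ y : ℝ, Φ (b + y * Complex.I)) -
        Complex.I * (∫ y : ℝ, Φ (a + y * Complex.I)))) :=
    ((intervalIntegral_tendsto_integral (hint b hab le_rfl) tendsto_neg_atTop_atBot
      tendsto_id).const_mul _).sub
      ((intervalIntegral_tendsto_integral (hint a le_rfl hab) tendsto_neg_atTop_atBot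
        tendsto_id).const_mul _)
  have hinv : Tendsto (fun R : ℝ => M * (1 + R ^ 2)⁻¹ * |b - a|) atTop (𝓝 0) := by
    have h2 : Tendsto (fun R : ℝ => (1 + R ^ 2)⁻¹) atTop (𝓝 0) :=
      tendsto_inv_atTop_zero.comp
        (tendsto_atTop_add_const_left _ _ (tendsto_pow_atTop (by norm_num)))
    simpa using (h2.const_mul M).mul_const |b - a|
  have hside : ∀ s : ℝ → ℝ, (∀ R, s R ^ 2 = R ^ 2) →
      Tendsto (fun R : ℝ => ∫ x : ℝ in a..b, Φ (x + (s R : ℝ) * Complex.I)) atTop (𝓝 0) := by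
    intro s hs
    refine squeeze_zero_norm (fun R => ?_) hinv
    refine intervalIntegral.norm_integral_le_of_norm_le_const fun x hx => ?_
    rw [uIoc_of_le hab] at hx
    have := hM (x + (s R : ℝ) * Complex.I) (by simpa using hx.1.le) (by simpa using hx.2)
    simpa [hs] using this
  have hR := (hside (fun R => R) (fun R => rfl)).sub (hside (fun R => -R) (fun R => by ring))
  have hlim := tendsto_nhds_unique (hL.congr hrect) hR
  have h0 : Complex.I * ((∫ y : ℝ, Φ (b + y * Complex.I)) -
      ∫ y : ℝ, Φ (a + y * Complex.I)) = 0 := by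
    rw [mul_sub, hlim, sub_zero]
  have := (mul_eq_zero.1 h0).resolve_left Complex.I_ne_zero
  exact (sub_eq_zero.1 this).symm

/-- Inversion of the Laplace transform: as `t³ f(t)` has the Laplace transform `-F'''`, its size at
`t = r` is controlled by the integral of `F'''` over any line `Re z = s` in the half-plane to which
`F` extends analytically. -/
theorem pow_three_mul_abs_le_of_laplace_eq {f : ℝ → ℝ} {F : ℂ → ℂ} {s0 : ℝ} (hs0 : 0 ≤ s0)
    (hf : LaplaceAbs f s0) (hL : ∀ z : ℂ, s0 < z.re → laplace f z = F z)
    (hF : ∀ z : ℂ, 0 < z.re → DifferentiableAt ℂ F z)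
    (hdec : ∀ a : ℝ, 0 < a → ∃ M : ℝ, ∀ z : ℂ, a ≤ z.re →
      ‖iteratedDeriv 3 F z‖ ≤ M * (1 + z.im ^ 2)⁻¹)
    {r s : ℝ} (hr : 0 < r) (hs : 0 < s) (hc : ContinuousAt f r) :
    r ^ 3 * |f r| ≤ Real.exp (s * r) *
      ∫ w : ℝ, ‖iteratedDeriv 3 F ((s : ℂ) + 2 * Real.pi * w * Complex.I)‖ := by
  set s1 := s0 + s + 1 with hs1
  have h01 : s0 < s1 := by linarith
  have hs1p : 0 < s1 := by linarith
  set h : ℝ → ℂ := (Ioi (0 : ℝ)).indicator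
    (fun t => (((-t) ^ 3 * f t : ℝ) : ℂ) * Complex.exp (-(s1 : ℂ) * t)) with hh
  have hint : Integrable h := by
    rw [hh, integrable_indicator_iff measurableSet_Ioi]
    exact (hf.neg_pow_mul 3).integrableOn (by simpa using h01)
  have hfour : ∀ w : ℝ, FourierTransform.fourier h w =
      iteratedDeriv 3 F ((s1 : ℂ) + 2 * Real.pi * w * Complex.I) := by
    intro w
    have hre : s0 < ((s1 : ℂ) + 2 * Real.pi * w * Complex.I).re := by rw [vertical_re]; exact h01
    have he : laplace f =ᶠ[𝓝 ((s1 : ℂ) + 2 * Real.pi * w * Complex.I)] F := by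
      filter_upwards [(isOpen_lt continuous_const Complex.continuous_re).mem_nhds hre]
        with z hz using hL z hz
    rw [← he.iteratedDeriv_eq, iteratedDeriv_laplace hf 3 hre, Real.fourier_real_eq_integral_exp_smul,
      laplace, ← integral_indicator measurableSet_Ioi]
    congr 1
    ext t
    rw [hh]
    by_cases ht : t ∈ Ioi (0 : ℝ)
    · rw [indicator_of_mem ht, indicator_of_mem ht, smul_eq_mul, mul_left_comm, ← Complex.exp_add]
      congr 2
      push_cast
      ring
    · rw [indicator_of_notMem ht, indicator_of_notMem ht, smul_zero]
  have hcontV := continuous_iteratedDeriv_vertical hF hs1p 3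
  have hfint : Integrable (FourierTransform.fourier h) := by
    obtain ⟨M, hM⟩ := hdec s1 hs1p
    have hi : Integrable fun w : ℝ => M * (1 + (2 * Real.pi * w) ^ 2)⁻¹ :=
      (integrable_inv_one_add_sq.comp_mul_left' (by positivity)).const_mul M
    rw [show FourierTransform.fourier h = fun w : ℝ =>
      iteratedDeriv 3 F ((s1 : ℂ) + 2 * Real.pi * w * Complex.I) from funext hfour]
    refine hi.mono' hcontV.aestronglyMeasurable (ae_of_all _ fun w => ?_)
    have := hM ((s1 : ℂ) + 2 * Real.pi * w * Complex.I) (by rw [vertical_re])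
    rwa [vertical_im] at this
  have hcr : ContinuousAt h r := by
    have h1 : ContinuousAt (fun t : ℝ => (((-t) ^ 3 * f t : ℝ) : ℂ) *
        Complex.exp (-(s1 : ℂ) * t)) r := by
      refine ContinuousAt.mul ?_ (by fun_prop)
      exact Complex.continuous_ofReal.continuousAt.comp
        (ContinuousAt.mul (by fun_prop) hc)
    refine h1.congr ?_
    filter_upwards [Ioi_mem_nhds hr] with t ht
    rw [hh, indicator_of_mem (show t ∈ Ioi (0 : ℝ) from ht)]
  have hinv := hint.fourierInv_fourier_eq hfint hcr
  rw [Real.fourierInv_eq'] at hinv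
  -- the integrand of the inversion formula is analytic, so that the line may be moved
  set Φ : ℂ → ℂ := fun z => Complex.exp (z * r) * iteratedDeriv 3 F z with hΦ
  have hΦd : ∀ z : ℂ, 0 < z.re → DifferentiableAt ℂ Φ z := fun z hz =>
    DifferentiableAt.mul (by fun_prop) (differentiableAt_iteratedDeriv_rightHalfPlane hF hz 3)
  have hexp : ∀ z : ℂ, ‖Complex.exp (z * r)‖ = Real.exp (z.re * r) := by
    intro z; rw [Complex.norm_exp]; simp
  obtain ⟨M, hM⟩ := hdec s hs
  have hshift := integral_vertical_eq hΦd (a := s) (b := s1) (M := Real.exp (s1 * r) * M) hs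
    (by linarith) (fun z hz hz1 => by
      rw [hΦ, norm_mul, hexp, mul_assoc]
      have h2 := hM z hz
      gcongr)
  have hscale : ∀ x : ℝ, ∫ w : ℝ, Φ ((x : ℂ) + 2 * Real.pi * w * Complex.I) =
      |(2 * Real.pi)⁻¹| • ∫ y : ℝ, Φ (x + y * Complex.I) := by
    intro x
    rw [← Measure.integral_comp_mul_left (fun y : ℝ => Φ (x + y * Complex.I))]
    congr 1
    ext w
    push_cast
    rfl
  have hkey : h r = Complex.exp (-(s1 : ℂ) * r) *
      ∫ w : ℝ, Φ ((s : ℂ) + 2 * Real.pi * w * Complex.I) := by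
    rw [hscale s, hshift, ← hscale s1, ← integral_const_mul, ← hinv]
    congr 1
    ext w
    rw [hfour w, hΦ, smul_eq_mul, ← mul_assoc, ← Complex.exp_add]
    congr 2
    have : inner ℝ w r = r * w := rfl
    rw [this]
    push_cast
    ring
  have hnorm : ‖h r‖ = r ^ 3 * |f r| * ‖Complex.exp (-(s1 : ℂ) * r)‖ := by
    rw [hh, indicator_of_mem (show r ∈ Ioi (0 : ℝ) from hr), norm_mul, Complex.norm_real, norm_mul,
      norm_pow, norm_neg, Real.norm_of_nonneg hr.le, Real.norm_eq_abs]
  have he0 : 0 < ‖Complex.exp (-(s1 : ℂ) * r)‖ := by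
    rw [Complex.norm_exp]; positivity
  have heq : r ^ 3 * |f r| = ‖∫ w : ℝ, Φ ((s : ℂ) + 2 * Real.pi * w * Complex.I)‖ := by
    have := congrArg norm hkey
    rw [norm_mul, hnorm, mul_comm] at this
    exact mul_left_cancel₀ he0.ne' this
  rw [heq, ← integral_const_mul]
  refine (norm_integral_le_integral_norm _).trans (le_of_eq ?_)
  congr 1
  ext w
  rw [hΦ, norm_mul, hexp, vertical_re]

/-! ### The kernel of the exact solution operator -/

theorem norm_mul_exp_eq {φ : ℝ → ℝ} {t : ℝ} (h : 0 ≤ φ t) (s : ℝ) :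
    ‖φ t * Real.exp (-s * t)‖ = φ t * Real.exp (-s * t) :=
  Real.norm_of_nonneg (mul_nonneg h (Real.exp_pos _).le)

theorem re_laplace_ofReal (φ : ℝ → ℝ) (s : ℝ) :
    (laplace φ s).re = ∫ t in Ioi (0 : ℝ), φ t * Real.exp (-s * t) := by
  rw [laplace, ← Complex.ofReal_re (∫ t in Ioi (0 : ℝ), φ t * Real.exp (-s * t)),
    ← integral_complex_ofReal]
  congr 2
  ext t
  push_cast
  rfl

/-- Termwise Laplace transformation of a series of nonnegative functions. -/
theorem laplace_tsum {c : ℕ → ℝ} {φ : ℕ → ℝ → ℝ} (hφ0 : ∀ i t, 0 < t → 0 ≤ φ i t)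
    (hφ : ∀ i, LaplaceAbs (φ i) 0) {s0 : ℝ} (hs0 : 0 ≤ s0)
    (hsum : ∀ s : ℝ, s0 < s → Summable fun i => |c i| * (laplace (φ i) s).re)
    (hmeas : AEStronglyMeasurable (fun t => ∑' i, c i * φ i t) (volume.restrict (Ioi 0))) :
    LaplaceAbs (fun t => ∑' i, c i * φ i t) s0 ∧
      ∀ z : ℂ, s0 < z.re → laplace (fun t => ∑' i, c i * φ i t) z = ∑' i, c i * laplace (φ i) z := by
  have hint : ∀ i (s : ℝ), s0 < s →
      ∫ t in Ioi (0 : ℝ), ‖c i * φ i t * Real.exp (-s * t)‖ = |c i| * (laplace (φ i) s).re := by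
    intro i s hs
    rw [re_laplace_ofReal, ← integral_const_mul]
    refine setIntegral_congr_fun measurableSet_Ioi fun t ht => ?_
    rw [mul_assoc, norm_mul, norm_mul_exp_eq (hφ0 i t ht), Real.norm_eq_abs]
  refine ⟨fun s hs => ⟨hmeas.mul (by fun_prop), ?_⟩, fun z hz => ?_⟩
  · have hs' : 0 < s := by linarith
    refine lt_of_le_of_lt (b := ∑' i, ∫⁻ t in Ioi (0 : ℝ), ‖c i * φ i t * Real.exp (-s * t)‖ₑ) ?_ ?_
    · rw [← lintegral_tsum fun i => ?_]
      · refine lintegral_mono fun t => ?_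
        simp only
        rw [← tsum_mul_right]
        exact enorm_tsum_le_tsum_enorm
      · have := ((hφ i s hs').const_mul (c i)).aestronglyMeasurable.enorm
        simpa only [mul_assoc] using this
    · have : ∀ i, ∫⁻ t in Ioi (0 : ℝ), ‖c i * φ i t * Real.exp (-s * t)‖ₑ =
          ENNReal.ofReal (|c i| * (laplace (φ i) s).re) := by
        intro i
        rw [← hint i s hs, ofReal_integral_norm_eq_lintegral_enorm]
        have := (hφ i s hs').const_mul (c i)
        simpa only [mul_assoc] using this
      simp_rw [this]
      exact (hsum s hs).tsum_ofReal_lt_top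
  · have h1 := hasSum_integral_of_summable_integral_norm (μ := volume.restrict (Ioi (0 : ℝ)))
      (F := fun i (t : ℝ) => ((c i * φ i t : ℝ) : ℂ) * Complex.exp (-z * t))
      (fun i => by
        have := ((hφ i).integrableOn (z := z) (by linarith)).const_mul (c i : ℂ)
        push_cast
        simpa only [mul_assoc] using this)
      (by
        refine (hsum z.re hz).congr fun i => ?_
        rw [← hint i z.re hz]
        refine integral_congr_ae (ae_of_all _ fun t => ?_)
        simp only
        rw [norm_ofReal_mul_cexp, norm_mul, Real.norm_eq_abs,
          Real.norm_of_nonneg (Real.exp_pos _).le])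
    rw [laplace]
    have e : ∀ t : ℝ, ((∑' i, c i * φ i t : ℝ) : ℂ) * Complex.exp (-z * t) =
        ∑' i, ((c i * φ i t : ℝ) : ℂ) * Complex.exp (-z * t) := by
      intro t
      rw [Complex.ofReal_tsum, tsum_mul_right]
    simp_rw [e]
    rw [← h1.tsum_eq]
    congr 1
    ext i
    rw [laplace, ← integral_const_mul]
    congr 1
    ext t
    push_cast
    ring

/-- The kernel `t^{β-1} / Γ(β)` of the fractional integral of order `β`. -/
noncomputable def fracKernel (β t : ℝ) : ℝ := t ^ (β - 1) / Real.Gamma β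

theorem fracKernel_nonneg {β t : ℝ} (hβ : 0 < β) (ht : 0 ≤ t) : 0 ≤ fracKernel β t :=
  div_nonneg (Real.rpow_nonneg ht _) (Real.Gamma_pos_of_pos hβ).le

theorem laplaceAbs_fracKernel {β : ℝ} (hβ : 0 < β) : LaplaceAbs (fracKernel β) 0 := by
  intro s hs
  have h := Real.integral_rpow_mul_exp_neg_mul_Ioi hβ hs
  have hi : IntegrableOn (fun t : ℝ => t ^ (β - 1) * Real.exp (-(s * t))) (Ioi 0) := by
    by_contra hc
    rw [integral_undef hc] at h
    have : 0 < (1 / s) ^ β * Real.Gamma β := by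
      have := Real.Gamma_pos_of_pos hβ
      positivity
    linarith
  refine (hi.const_mul (Real.Gamma β)⁻¹).congr (ae_of_all _ fun t => ?_)
  simp only [fracKernel]
  rw [neg_mul]
  ring

/-- A Laplace transform is determined on its half-plane by its values at large real points. -/
theorem laplace_eq_of_eq_ofReal {f : ℝ → ℝ} {s0 s1 : ℝ} (hf : LaplaceAbs f s0) {G : ℂ → ℂ}
    (hG : ∀ z : ℂ, s0 < z.re → DifferentiableAt ℂ G z) (hs : s0 ≤ s1)
    (h : ∀ s : ℝ, s1 < s → laplace f s = G s) {z : ℂ} (hz : s0 < z.re) : laplace f z = G z := by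
  set U : Set ℂ := {z : ℂ | s0 < z.re} with hU
  have hUo : IsOpen U := isOpen_lt continuous_const Complex.continuous_re
  have hUc : IsPreconnected U := (convex_halfSpace_re_gt s0).isPreconnected
  have h1 : AnalyticOnNhd ℂ (laplace f) U := DifferentiableOn.analyticOnNhd
    (fun w hw => (hasDerivAt_laplace hf hw).differentiableAt.differentiableWithinAt) hUo
  have h2 : AnalyticOnNhd ℂ G U := DifferentiableOn.analyticOnNhd
    (fun w hw => (hG w hw).differentiableWithinAt) hUo
  have h0 : ((s1 + 1 : ℝ) : ℂ) ∈ U := by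
    change s0 < ((s1 + 1 : ℝ) : ℂ).re
    rw [Complex.ofReal_re]; linarith
  refine h1.eqOn_of_preconnected_of_frequently_eq h2 hUc h0 ?_ hz
  have ht : Tendsto (fun x : ℝ => (x : ℂ)) (𝓝[≠] (s1 + 1)) (𝓝[≠] ((s1 + 1 : ℝ) : ℂ)) := by
    refine tendsto_nhdsWithin_of_tendsto_nhds_of_eventually_within _
      (Complex.continuous_ofReal.continuousAt.tendsto.mono_left nhdsWithin_le_nhds) ?_
    filter_upwards [self_mem_nhdsWithin] with x hx h0
    exact hx (Complex.ofReal_injective h0)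
  refine ht.frequently (Eventually.frequently ?_)
  have : ∀ᶠ x : ℝ in 𝓝[≠] (s1 + 1), s1 < x :=
    nhdsWithin_le_nhds (Ioi_mem_nhds (by linarith))
  filter_upwards [this] with x hx using h x hx

theorem laplace_fracKernel {β : ℝ} (hβ : 0 < β) {z : ℂ} (hz : 0 < z.re) :
    laplace (fracKernel β) z = z⁻¹ ^ (β : ℂ) := by
  refine laplace_eq_of_eq_ofReal (laplaceAbs_fracKernel hβ) (G := fun z => z⁻¹ ^ (β : ℂ))
    (fun w hw => ?_) le_rfl (fun s hs => ?_) hz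
  · have hw0 : w ≠ 0 := fun h => by simp [h] at hw
    refine DifferentiableAt.cpow_const (differentiableAt_inv hw0) (Or.inl ?_)
    rw [Complex.inv_re]
    exact div_pos hw (Complex.normSq_pos.2 hw0)
  have h := Complex.integral_cpow_mul_exp_neg_mul_Ioi (a := (β : ℂ)) (r := s) (by simpa using hβ) hs
  have hG : Complex.Gamma β ≠ 0 := Complex.Gamma_ne_zero_of_re_pos (by simpa using hβ)
  rw [laplace, ← one_div]
  have : ∀ t ∈ Ioi (0 : ℝ), (fracKernel β t : ℂ) * Complex.exp (-s * t) =
      (Complex.Gamma β)⁻¹ * ((t : ℂ) ^ ((β : ℂ) - 1) * Complex.exp (-(s * t))) := by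
    intro t ht
    rw [fracKernel, Complex.ofReal_div, Complex.ofReal_cpow (le_of_lt ht), ← Complex.Gamma_ofReal]
    push_cast
    rw [neg_mul]
    ring
  rw [setIntegral_congr_fun measurableSet_Ioi this, integral_const_mul, h]
  field_simp

theorem rpow_mul_exp_neg_le_Gamma {s R : ℝ} (hs : 1 ≤ s) (hR : 0 < R) :
    R ^ (s - 1) * Real.exp (-R) ≤ Real.Gamma s := by
  rw [Real.Gamma_eq_integral (by linarith)]
  have h1 : ∫ x in Ioi R, R ^ (s - 1) * Real.exp (-x) = R ^ (s - 1) * Real.exp (-R) := by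
    rw [integral_const_mul, integral_exp_neg_Ioi]
  have hG := Real.GammaIntegral_convergent (s := s) (by linarith)
  rw [← h1]
  refine le_trans (b := ∫ x in Ioi R, Real.exp (-x) * x ^ (s - 1)) ?_ ?_
  · refine setIntegral_mono_on ((integrableOn_exp_neg_Ioi R).const_mul _)
      (hG.mono_set (Ioi_subset_Ioi hR.le)) measurableSet_Ioi fun x hx => ?_
    rw [mul_comm]
    have : R ≤ x := le_of_lt hx
    gcongr
  · refine setIntegral_mono_set hG ?_ (Ioi_subset_Ioi hR.le).eventuallyLE
    filter_upwards [ae_restrict_mem measurableSet_Ioi] with x hx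
    have : (0 : ℝ) < x := hx
    simp only [Pi.zero_apply]
    positivity

/-- Mittag-Leffler series converge everywhere. -/
theorem summable_pow_div_Gamma {α : ℝ} (hα : 0 < α) (β : ℝ) {x : ℝ} (hx : 0 ≤ x) :
    Summable fun k : ℕ => x ^ k / Real.Gamma (α * k + β) := by
  set R := (2 * x + 1) ^ (1 / α) with hR
  have hR0 : 0 < R := by positivity
  have hRα : R ^ α = 2 * x + 1 := by
    rw [hR, ← Real.rpow_mul (by positivity), one_div_mul_cancel hα.ne', Real.rpow_one]
  have hgeo : Summable fun k : ℕ => Real.exp R * R ^ (1 - β) * (x / (2 * x + 1)) ^ k :=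
    (summable_geometric_of_lt_one (by positivity)
      (by rw [div_lt_one (by positivity)]; linarith)).mul_left _
  refine Summable.of_norm_bounded_eventually_nat hgeo ?_
  have hev : ∀ᶠ k : ℕ in atTop, 1 ≤ α * (k : ℝ) + β := by
    have : Tendsto (fun k : ℕ => α * (k : ℝ) + β) atTop atTop :=
      tendsto_atTop_add_const_right _ _ (tendsto_natCast_atTop_atTop.const_mul_atTop hα)
    exact this.eventually_ge_atTop 1
  filter_upwards [hev] with k hk
  have hG := rpow_mul_exp_neg_le_Gamma hk hR0
  have hpos : 0 < R ^ (α * (k : ℝ) + β - 1) * Real.exp (-R) := by positivity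
  rw [Real.norm_of_nonneg (div_nonneg (by positivity) (hpos.trans_le hG).le)]
  refine (div_le_div_of_nonneg_left (by positivity) hpos hG).trans (le_of_eq ?_)
  have e : R ^ (α * (k : ℝ) + β - 1) = (2 * x + 1) ^ k * R ^ (β - 1) := by
    rw [add_sub_assoc, Real.rpow_add hR0, Real.rpow_mul hR0.le, hRα, Real.rpow_natCast]
  have e2 : R ^ (1 - β) = (R ^ (β - 1))⁻¹ := by rw [← Real.rpow_neg hR0.le]; ring_nf
  rw [e, e2, Real.exp_neg, div_pow]
  have : 0 < R ^ (β - 1) := by positivity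
  field_simp

/-- The kernel `r^{α-1} E_{α,α}(-λ r^α)` of the solution operator of `∂^α u + λ u = f`. -/
noncomputable def exactKernel (α lam r : ℝ) : ℝ :=
  ∑' k : ℕ, (-lam) ^ k * fracKernel (α * (k + 1)) r

theorem summable_exactKernel_bound {α : ℝ} (hα : 0 < α) {lam : ℝ} (hl : 0 ≤ lam) {a b : ℝ}
    (ha : 0 < a) (hb : 0 < b) :
    (Summable fun k : ℕ => a⁻¹ * (b ^ α * ((lam * b ^ α) ^ k / Real.Gamma (α * k + α)))) ∧
    ∀ (k : ℕ), ∀ r ∈ Icc a b, ‖(-lam) ^ k * fracKernel (α * (k + 1)) r‖ ≤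
      a⁻¹ * (b ^ α * ((lam * b ^ α) ^ k / Real.Gamma (α * k + α))) := by
  refine ⟨((summable_pow_div_Gamma hα α (by positivity)).mul_left _).mul_left _, ?_⟩
  intro k r hr
  have hr0 : 0 < r := ha.trans_le hr.1
  have hpos : 0 < α * ((k : ℝ) + 1) := by positivity
  rw [norm_mul, norm_pow, norm_neg, Real.norm_of_nonneg hl,
    Real.norm_of_nonneg (fracKernel_nonneg hpos hr0.le), fracKernel,
    Real.rpow_sub_one hr0.ne', Real.rpow_mul hr0.le,
    show α * ((k : ℝ) + 1) = α * k + α by ring]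
  have hG : 0 < Real.Gamma (α * k + α) := Real.Gamma_pos_of_pos (by positivity)
  have h1 : (r ^ α) ^ ((k : ℝ) + 1) ≤ (b ^ α) ^ (k + 1) := by
    rw [← Nat.cast_add_one, Real.rpow_natCast]
    gcongr
    exact hr.2
  have h2 : r⁻¹ ≤ a⁻¹ := inv_anti₀ ha hr.1
  calc lam ^ k * ((r ^ α) ^ ((k : ℝ) + 1) / r / Real.Gamma (α * k + α)) =
      r⁻¹ * (lam ^ k * ((r ^ α) ^ ((k : ℝ) + 1) / Real.Gamma (α * k + α))) := by
        field_simp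
    _ ≤ a⁻¹ * (lam ^ k * ((b ^ α) ^ (k + 1) / Real.Gamma (α * k + α))) := by gcongr
    _ = _ := by rw [mul_pow, pow_succ]; ring

theorem continuousOn_exactKernel {α : ℝ} (hα : 0 < α) {lam : ℝ} (hl : 0 ≤ lam) :
    ContinuousOn (exactKernel α lam) (Ioi 0) := by
  intro r hr
  have hr0 : (0 : ℝ) < r := hr
  obtain ⟨hs, hb⟩ := summable_exactKernel_bound hα hl (half_pos hr0) (b := 2 * r) (by linarith)
  have h1 : ContinuousOn (exactKernel α lam) (Icc (r / 2) (2 * r)) := by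
    refine continuousOn_tsum (fun k => ?_) hs hb
    refine continuousOn_const.mul (ContinuousOn.div_const ?_ _)
    exact fun x hx => (Real.continuousAt_rpow_const _ _
      (Or.inl (by linarith [hx.1]))).continuousWithinAt
  exact (h1.continuousAt (Icc_mem_nhds (by linarith) (by linarith))).continuousWithinAt

theorem laplace_exactKernel {α : ℝ} (hα : 0 < α) {lam : ℝ} (hl : 0 ≤ lam) :
    LaplaceAbs (exactKernel α lam) (lam ^ (1 / α)) ∧
      ∀ z : ℂ, lam ^ (1 / α) < z.re → laplace (exactKernel α lam) z = exactSymbol α lam z := by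
  have hs0 : 0 ≤ lam ^ (1 / α) := by positivity
  have hβ : ∀ k : ℕ, 0 < α * ((k : ℝ) + 1) := fun k => by positivity
  have hpow : ∀ (z : ℂ) (k : ℕ), z⁻¹ ^ ((α * ((k : ℝ) + 1) : ℝ) : ℂ) = (z⁻¹ ^ (α : ℂ)) ^ (k + 1) := by
    intro z k
    rw [← Complex.cpow_nat_mul]
    congr 1
    push_cast
    ring
  have hlt : ∀ z : ℂ, lam ^ (1 / α) < z.re → lam * ‖z⁻¹ ^ (α : ℂ)‖ < 1 := by
    intro z hz
    have hre : 0 < z.re := by linarith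
    have hz0 : z ≠ 0 := fun h => by simp [h] at hre
    have hn : 0 < ‖z‖ := norm_pos_iff.2 hz0
    rw [norm_cpow_ofReal (inv_ne_zero hz0), norm_inv, Real.inv_rpow hn.le, ← div_eq_mul_inv,
      div_lt_one (by positivity)]
    have h1 : lam ^ (1 / α) < ‖z‖ := hz.trans_le (Complex.re_le_norm z)
    calc lam = (lam ^ (1 / α)) ^ α := by
          rw [← Real.rpow_mul hl, one_div_mul_cancel hα.ne', Real.rpow_one]
      _ < ‖z‖ ^ α := by gcongr
  obtain ⟨h1, h2⟩ := laplace_tsum (c := fun k => (-lam) ^ k)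
    (φ := fun k => fracKernel (α * (k + 1))) (s0 := lam ^ (1 / α))
    (fun k t ht => fracKernel_nonneg (hβ k) ht.le) (fun k => laplaceAbs_fracKernel (hβ k)) hs0
    (by
      intro s hs
      have hs' : 0 < s := by linarith
      have h3 := hlt s (by simpa using hs)
      have h4 : Summable fun k : ℕ => ‖(s : ℂ)⁻¹ ^ (α : ℂ)‖ * (lam * ‖(s : ℂ)⁻¹ ^ (α : ℂ)‖) ^ k :=
        (summable_geometric_of_lt_one (by positivity) h3).mul_left _
      refine Summable.of_norm_bounded h4 fun k => ?_
      rw [laplace_fracKernel (hβ k) (by simpa using hs'), hpow, norm_mul, abs_pow, abs_neg,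
        abs_of_nonneg hl, norm_pow, Real.norm_of_nonneg hl, Real.norm_eq_abs]
      refine (mul_le_mul_of_nonneg_left (Complex.abs_re_le_norm _) (by positivity)).trans
        (le_of_eq ?_)
      rw [norm_pow, mul_pow]
      ring)
    ((continuousOn_exactKernel hα hl).aestronglyMeasurable measurableSet_Ioi)
  refine ⟨h1, fun z hz => (h2 z hz).trans ?_⟩
  have hre : 0 < z.re := by linarith
  have hz0 : z ≠ 0 := fun h => by simp [h] at hre
  have e : ∀ k : ℕ, (((-lam) ^ k : ℝ) : ℂ) * laplace (fracKernel (α * (k + 1))) z =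
      z⁻¹ ^ (α : ℂ) * (-(lam * z⁻¹ ^ (α : ℂ))) ^ k := by
    intro k
    rw [laplace_fracKernel (hβ k) hre, hpow]
    push_cast
    rw [pow_succ, neg_pow (lam : ℂ), neg_pow ((lam : ℂ) * _), mul_pow]
    ring
  have hzα : z ^ (α : ℂ) ≠ 0 := by
    rw [← norm_pos_iff, norm_cpow_ofReal hz0]
    have := norm_pos_iff.2 hz0
    positivity
  have hnorm : ‖-(lam * z⁻¹ ^ (α : ℂ))‖ < 1 := by
    rw [norm_neg, norm_mul, Complex.norm_real, Real.norm_of_nonneg hl]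
    exact hlt z hz
  have hne : 1 - -((lam : ℂ) * z⁻¹ ^ (α : ℂ)) ≠ 0 := by
    intro h0
    have : -((lam : ℂ) * z⁻¹ ^ (α : ℂ)) = 1 := (sub_eq_zero.1 h0).symm
    rw [this, norm_one] at hnorm
    exact lt_irrefl _ hnorm
  simp_rw [e]
  rw [tsum_mul_left, tsum_geometric_of_norm_lt_one hnorm, exactSymbol]
  have harg : z.arg ≠ Real.pi := by
    have := (abs_lt.1 (Complex.abs_arg_lt_pi_div_two_iff.2 (Or.inl hre))).2
    have := Real.pi_pos
    linarith
  rw [Complex.inv_cpow _ _ harg] at hne ⊢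
  rw [← mul_inv_rev]
  congr 1
  field_simp
  ring

/-! ### The kernel of the discrete solution operator -/

/-- The value at `ξ` of a real power series. -/
noncomputable def psEval (f : PowerSeries ℝ) (ξ : ℂ) : ℂ := ∑' n, ((PowerSeries.coeff n f : ℝ) : ℂ) * ξ ^ n

/-- The power series `f` converges absolutely on the circle of radius `ρ`. -/
def PsAbs (f : PowerSeries ℝ) (ρ : ℝ) : Prop := Summable fun n => |PowerSeries.coeff n f| * ρ ^ n

theorem PsAbs.summable_norm {f : PowerSeries ℝ} {ξ : ℂ} (h : PsAbs f ‖ξ‖) :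
    Summable fun n => ‖((PowerSeries.coeff n f : ℝ) : ℂ) * ξ ^ n‖ := by
  refine h.congr fun n => ?_
  rw [norm_mul, norm_pow, Complex.norm_real, Real.norm_eq_abs]

theorem PsAbs.mul {f g : PowerSeries ℝ} {ρ : ℝ} (hρ : 0 ≤ ρ) (hf : PsAbs f ρ) (hg : PsAbs g ρ) :
    PsAbs (f * g) ρ := by
  have e : ∀ h : PowerSeries ℝ, ∀ n, ‖PowerSeries.coeff n h * ρ ^ n‖ =
      |PowerSeries.coeff n h| * ρ ^ n := by
    intro h n
    rw [norm_mul, Real.norm_eq_abs, Real.norm_of_nonneg (by positivity)]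
  have h1 := summable_norm_sum_mul_antidiagonal_of_summable_norm
    (f := fun n => PowerSeries.coeff n f * ρ ^ n) (g := fun n => PowerSeries.coeff n g * ρ ^ n)
    (by simp only [e]; exact hf) (by simp only [e]; exact hg)
  refine h1.congr fun n => ?_
  rw [← e, PowerSeries.coeff_mul, Finset.sum_mul]
  congr 1
  refine Finset.sum_congr rfl fun x hx => ?_
  rw [← Finset.HasAntidiagonal.mem_antidiagonal.1 hx, pow_add]
  ring

theorem psEval_mul {f g : PowerSeries ℝ} {ξ : ℂ} (hf : PsAbs f ‖ξ‖) (hg : PsAbs g ‖ξ‖) :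
    psEval (f * g) ξ = psEval f ξ * psEval g ξ := by
  rw [psEval, psEval, psEval,
    tsum_mul_tsum_eq_tsum_sum_antidiagonal_of_summable_norm hf.summable_norm hg.summable_norm]
  congr 1
  ext n
  rw [PowerSeries.coeff_mul, Complex.ofReal_sum, Finset.sum_mul]
  refine Finset.sum_congr rfl fun x hx => ?_
  rw [← Finset.HasAntidiagonal.mem_antidiagonal.1 hx, pow_add]
  push_cast
  ring

theorem PsAbs.of_abs_le {f : PowerSeries ℝ} {M ρ : ℝ} (hρ : 0 ≤ ρ) (hM : 0 ≤ M) (h : M * ρ < 1)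
    (hf : ∀ n, |PowerSeries.coeff n f| ≤ M ^ n) : PsAbs f ρ := by
  refine Summable.of_nonneg_of_le (fun n => by positivity) (fun n => ?_)
    (summable_geometric_of_lt_one (by positivity) h)
  rw [mul_pow]
  gcongr
  exact hf n

theorem psAbs_of_eq_zero {f : PowerSeries ℝ} {m : ℕ}
    (hf : ∀ n, m ≤ n → PowerSeries.coeff n f = 0) (ρ : ℝ) : PsAbs f ρ :=
  summable_of_ne_finset_zero (s := Finset.range m) fun n hn => by
    rw [hf n (by simpa using hn), abs_zero, zero_mul]

theorem psEval_eq_sum {f : PowerSeries ℝ} {m : ℕ}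
    (hf : ∀ n, m ≤ n → PowerSeries.coeff n f = 0) (ξ : ℂ) :
    psEval f ξ = ∑ n ∈ Finset.range m, ((PowerSeries.coeff n f : ℝ) : ℂ) * ξ ^ n :=
  tsum_eq_sum fun n hn => by rw [hf n (by simpa using hn), Complex.ofReal_zero, zero_mul]

theorem abs_coeff_inv_le {P : PowerSeries ℝ} {B : ℝ} (hP : ∀ n, |PowerSeries.coeff n P| ≤ B)
    (h0 : 1 ≤ PowerSeries.constantCoeff P) (n : ℕ) :
    |PowerSeries.coeff n P⁻¹| ≤ (1 + B) ^ n := by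
  have hB : 0 ≤ B := (abs_nonneg _).trans (hP 0)
  have hinv : |(PowerSeries.constantCoeff P)⁻¹| ≤ 1 := by
    rw [abs_of_pos (by positivity)]
    exact inv_le_one_of_one_le₀ h0
  induction n using Nat.strong_induction_on with
  | _ n ih =>
    rw [PowerSeries.coeff_inv]
    split_ifs with hn
    · simpa [hn] using hinv
    · rw [abs_mul, abs_neg]
      have h1 : |∑ x ∈ Finset.HasAntidiagonal.antidiagonal n,
          if x.2 < n then PowerSeries.coeff x.1 P * PowerSeries.coeff x.2 P⁻¹ else 0| ≤
          ∑ i ∈ Finset.range n, B * (1 + B) ^ i := by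
        rw [Finset.Nat.sum_antidiagonal_eq_sum_range_succ_mk, Finset.sum_range_succ',
          ← Finset.sum_range_reflect (fun i => B * (1 + B) ^ i)]
        simp only [Nat.sub_zero, lt_self_iff_false, if_false, add_zero]
        refine (Finset.abs_sum_le_sum_abs _ _).trans (Finset.sum_le_sum fun j hj => ?_)
        have hj' := Finset.mem_range.1 hj
        have e : n - (j + 1) = n - 1 - j := by omega
        rw [if_pos (by omega), abs_mul, e]
        exact mul_le_mul (hP _) (ih _ (by omega)) (abs_nonneg _) hB
      have h2 : ∑ i ∈ Finset.range n, B * (1 + B) ^ i = (1 + B) ^ n - 1 := by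
        have := geom_sum_mul (1 + B) n
        rw [← Finset.mul_sum, ← this]; ring
      calc _ ≤ 1 * ((1 + B) ^ n - 1) := by
            rw [← h2]
            exact mul_le_mul hinv h1 (abs_nonneg _) zero_le_one
        _ ≤ _ := by linarith

theorem abs_glCoeff_le {α : ℝ} (h0 : 0 < α) (h1 : α < 1) (n : ℕ) : |glCoeff α n| ≤ 1 := by
  induction n with
  | zero => simp [glCoeff]
  | succ n ih =>
    rw [glCoeff, abs_mul]
    have h3 : (α + 1) / ((n : ℝ) + 1) ≤ α + 1 := by
      rw [div_le_iff₀ (by positivity)]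
      nlinarith [(Nat.cast_nonneg n : (0 : ℝ) ≤ n)]
    have h4 : 0 ≤ (α + 1) / ((n : ℝ) + 1) := by positivity
    have h2 : |1 - (α + 1) / ((n : ℝ) + 1)| ≤ 1 := by
      rw [abs_le]; constructor <;> linarith
    calc _ ≤ 1 * 1 := mul_le_mul h2 ih (abs_nonneg _) zero_le_one
      _ = 1 := one_mul 1

theorem glCoeff_eq_choose (α : ℝ) (n : ℕ) : glCoeff α n = (-1) ^ n * Ring.choose α n := by
  induction n with
  | zero => simp [glCoeff]
  | succ n ih =>
    have h1 := Ring.descPochhammer_eq_factorial_smul_choose α n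
    have h2 := Ring.descPochhammer_eq_factorial_smul_choose α (n + 1)
    rw [descPochhammer_succ_right, Polynomial.smeval_mul, h1, Nat.factorial_succ] at h2
    simp only [nsmul_eq_mul, Polynomial.smeval_sub, Polynomial.smeval_X, Polynomial.smeval_natCast,
      pow_one, pow_zero, Nat.cast_mul, Nat.cast_succ, mul_one] at h2
    have hf : (n.factorial : ℝ) ≠ 0 := by positivity
    have h3 : Ring.choose α n * (α - n) = ((n : ℝ) + 1) * Ring.choose α (n + 1) := by
      apply mul_left_cancel₀ hf
      linarith
    have h4 : Ring.choose α (n + 1) = Ring.choose α n * (α - n) / ((n : ℝ) + 1) := by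
      rw [eq_div_iff (by positivity), h3]; ring
    rw [glCoeff, ih, h4, pow_succ]
    field_simp
    ring

/-- The generating function `(1 - ξ)^α` of the Grünwald-Letnikov coefficients. -/
noncomputable def glSeries (α : ℝ) : PowerSeries ℝ := PowerSeries.mk (glCoeff α)

/-- The generating function of the weights of the two time levels. -/
noncomputable def weightSeries (α : ℝ) : PowerSeries ℝ :=
  PowerSeries.C (1 - α / 2) + PowerSeries.C (α / 2) * PowerSeries.X

/-- The generating function of the BDF2 difference. -/
noncomputable def bdfSeries : PowerSeries ℝ :=
  PowerSeries.C (3 / 2) - PowerSeries.C 2 * PowerSeries.X + PowerSeries.C (1 / 2) * PowerSeries.X ^ 2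

/-- The generating function of the operator of the scheme, with step `1`. -/
noncomputable def schemeSeries (α lam : ℝ) : PowerSeries ℝ :=
  glSeries α + PowerSeries.C lam * weightSeries α

/-- The generating function of the weights with which the discrete solution depends on the second
primitive of the source. -/
noncomputable def solutionSeries (α lam : ℝ) : PowerSeries ℝ :=
  bdfSeries ^ 2 * weightSeries α * (schemeSeries α lam)⁻¹

theorem coeff_weightSeries (α : ℝ) (n : ℕ) : PowerSeries.coeff n (weightSeries α) =
    if n = 0 then 1 - α / 2 else if n = 1 then α / 2 else 0 := by
  rw [weightSeries, map_add, PowerSeries.coeff_C, PowerSeries.coeff_C_mul, PowerSeries.coeff_X]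
  split_ifs <;> simp_all

theorem coeff_bdfSeries (n : ℕ) : PowerSeries.coeff n bdfSeries =
    if n = 0 then 3 / 2 else if n = 1 then -2 else if n = 2 then 1 / 2 else 0 := by
  rw [bdfSeries, map_add, map_sub, PowerSeries.coeff_C, PowerSeries.coeff_C_mul,
    PowerSeries.coeff_C_mul, PowerSeries.coeff_X, PowerSeries.coeff_X_pow]
  split_ifs <;> simp_all

theorem constantCoeff_schemeSeries (α lam : ℝ) :
    PowerSeries.constantCoeff (schemeSeries α lam) = 1 + lam * (1 - α / 2) := by
  rw [← PowerSeries.coeff_zero_eq_constantCoeff_apply, schemeSeries, map_add,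
    PowerSeries.coeff_C_mul, coeff_weightSeries, glSeries, PowerSeries.coeff_mk]
  simp [glCoeff]

theorem abs_coeff_schemeSeries_le {α : ℝ} (h0 : 0 < α) (h1 : α < 1) {lam : ℝ} (hl : 0 ≤ lam)
    (n : ℕ) : |PowerSeries.coeff n (schemeSeries α lam)| ≤ 1 + lam := by
  rw [schemeSeries, map_add, PowerSeries.coeff_C_mul, glSeries, PowerSeries.coeff_mk,
    coeff_weightSeries]
  refine (abs_add_le _ _).trans (add_le_add (abs_glCoeff_le h0 h1 n) ?_)
  rw [abs_mul, abs_of_nonneg hl]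
  have : |if n = 0 then 1 - α / 2 else if n = 1 then α / 2 else 0| ≤ 1 := by
    split_ifs <;> rw [abs_le] <;> constructor <;> linarith
  nlinarith

theorem psAbs_glSeries {α : ℝ} (h0 : 0 < α) (h1 : α < 1) {ρ : ℝ} (hρ : 0 ≤ ρ) (hρ1 : ρ < 1) :
    PsAbs (glSeries α) ρ :=
  PsAbs.of_abs_le hρ zero_le_one (by linarith) fun n => by
    rw [glSeries, PowerSeries.coeff_mk, one_pow]; exact abs_glCoeff_le h0 h1 n

theorem psEval_glSeries {α : ℝ} {ξ : ℂ} (hξ : ‖ξ‖ < 1) :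
    psEval (glSeries α) ξ = (1 - ξ) ^ (α : ℂ) := by
  have h := (Complex.one_add_cpow_hasFPowerSeriesOnBall_zero (a := (α : ℂ))).hasSum (y := -ξ)
    (by simpa [Metric.mem_eball, edist_zero_right, enorm_eq_nnnorm, ← NNReal.coe_lt_coe] using hξ)
  simp only [binomialSeries_apply, zero_add] at h
  rw [← sub_eq_add_neg] at h
  rw [psEval, ← h.tsum_eq]
  congr 1
  ext n
  rw [glSeries, PowerSeries.coeff_mk, glCoeff_eq_choose]
  simp only [List.ofFn_const, List.prod_replicate, smul_eq_mul, Complex.ofReal_mul,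
    Complex.ofReal_pow, Complex.ofReal_neg, Complex.ofReal_one, Complex.ofReal_choose]
  rw [neg_pow ξ]
  ring

theorem psEval_weightSeries (α : ℝ) (ξ : ℂ) :
    psEval (weightSeries α) ξ = cnWeight α (1 - ξ) := by
  rw [psEval_eq_sum (m := 2) (fun n hn => by
    rw [coeff_weightSeries, if_neg (by omega), if_neg (by omega)])]
  simp [Finset.sum_range_succ, coeff_weightSeries, cnWeight]
  ring

theorem psEval_bdfSeries (ξ : ℂ) : psEval bdfSeries ξ = bdfSymbol (1 - ξ) := by
  rw [psEval_eq_sum (m := 3) (fun n hn => by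
    rw [coeff_bdfSeries, if_neg (by omega), if_neg (by omega), if_neg (by omega)])]
  simp [Finset.sum_range_succ, coeff_bdfSeries, bdfSymbol]
  ring

theorem psAbs_weightSeries (α ρ : ℝ) : PsAbs (weightSeries α) ρ :=
  psAbs_of_eq_zero (m := 2) (fun n hn => by
    rw [coeff_weightSeries, if_neg (by omega), if_neg (by omega)]) ρ

theorem psAbs_bdfSeries (ρ : ℝ) : PsAbs bdfSeries ρ :=
  psAbs_of_eq_zero (m := 3) (fun n hn => by
    rw [coeff_bdfSeries, if_neg (by omega), if_neg (by omega), if_neg (by omega)]) ρ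

theorem psEval_schemeSeries {α : ℝ} (h0 : 0 < α) (h1 : α < 1) (lam : ℝ) {ξ : ℂ} (hξ : ‖ξ‖ < 1) :
    PsAbs (schemeSeries α lam) ‖ξ‖ ∧
    psEval (schemeSeries α lam) ξ = (1 - ξ) ^ (α : ℂ) + lam * cnWeight α (1 - ξ) := by
  have h2 := psAbs_glSeries h0 h1 (norm_nonneg ξ) hξ
  have h3 := psAbs_weightSeries α ‖ξ‖
  constructor
  · refine Summable.of_nonneg_of_le (fun n => by positivity) (fun n => ?_)
      (h2.add (h3.mul_left |lam|))
    rw [schemeSeries, map_add, PowerSeries.coeff_C_mul, ← mul_assoc, ← add_mul, ← abs_mul]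
    gcongr
    exact abs_add_le _ _
  · rw [← psEval_glSeries hξ, ← psEval_weightSeries, psEval, psEval, psEval, ← tsum_mul_left,
      ← h2.summable_norm.of_norm.tsum_add (h3.summable_norm.of_norm.mul_left _)]
    congr 1
    ext n
    rw [schemeSeries, map_add, PowerSeries.coeff_C_mul]
    push_cast
    ring

theorem solutionSeries_mul_schemeSeries {α : ℝ} (h1 : α < 1) {lam : ℝ} (hl : 0 ≤ lam) :
    solutionSeries α lam * schemeSeries α lam = bdfSeries ^ 2 * weightSeries α := by
  have : PowerSeries.constantCoeff (schemeSeries α lam) ≠ 0 := by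
    rw [constantCoeff_schemeSeries]; nlinarith
  rw [solutionSeries, mul_assoc, PowerSeries.inv_mul_cancel _ this, mul_one]

theorem psAbs_solutionSeries {α : ℝ} (h0 : 0 < α) (h1 : α < 1) {lam : ℝ} (hl : 0 ≤ lam) {ρ : ℝ}
    (hρ : 0 ≤ ρ) (h : (2 + lam) * ρ < 1) : PsAbs (solutionSeries α lam) ρ := by
  refine PsAbs.mul hρ (PsAbs.mul hρ ?_ (psAbs_weightSeries α ρ)) ?_
  · rw [pow_two]
    exact PsAbs.mul hρ (psAbs_bdfSeries ρ) (psAbs_bdfSeries ρ)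
  · refine PsAbs.of_abs_le hρ (M := 1 + (1 + lam)) (by linarith) (by linarith)
      (abs_coeff_inv_le (abs_coeff_schemeSeries_le h0 h1 hl) ?_)
    rw [constantCoeff_schemeSeries]
    nlinarith

theorem psEval_solutionSeries_mul {α : ℝ} (h0 : 0 < α) (h1 : α < 1) {lam : ℝ} (hl : 0 ≤ lam) {ξ : ℂ}
    (h : (2 + lam) * ‖ξ‖ < 1) :
    psEval (solutionSeries α lam) ξ * ((1 - ξ) ^ (α : ℂ) + lam * cnWeight α (1 - ξ)) =
      bdfSymbol (1 - ξ) ^ 2 * cnWeight α (1 - ξ) := by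
  have hξ : ‖ξ‖ < 1 := by nlinarith [norm_nonneg ξ]
  obtain ⟨h2, h3⟩ := psEval_schemeSeries h0 h1 lam hξ
  have h4 := psAbs_solutionSeries h0 h1 hl (norm_nonneg ξ) h
  have hb := psAbs_bdfSeries ‖ξ‖
  rw [← h3, ← psEval_mul h4 h2, solutionSeries_mul_schemeSeries h1 hl,
    psEval_mul (by rw [pow_two]; exact hb.mul (norm_nonneg ξ) hb) (psAbs_weightSeries α _), pow_two,
    psEval_mul hb hb, psEval_bdfSeries, psEval_weightSeries, pow_two]

/-- The ramp function `(t - j)₊`. -/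
noncomputable def ramp (j : ℕ) (t : ℝ) : ℝ := max (t - j) 0

theorem laplace_ramp (j : ℕ) : LaplaceAbs (ramp j) 0 ∧
    ∀ z : ℂ, 0 < z.re → laplace (ramp j) z = Complex.exp (-z) ^ j * (z ^ 2)⁻¹ := by
  have hsupp : ∀ x : ℝ, x ≤ 0 → max x 0 = 0 := fun x hx => max_eq_right hx
  constructor
  · intro s hs
    have h : IntegrableOn (fun t => Real.exp (-s * j) * (fracKernel 2 t * Real.exp (-s * t)))
        (Ioi 0) := (laplaceAbs_fracKernel (β := 2) (by norm_num) s hs).const_mul _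
    rw [← integrable_indicator_iff measurableSet_Ioi] at h ⊢
    refine (h.comp_sub_right (j : ℝ)).congr (ae_of_all _ fun t => ?_)
    by_cases h1 : t - j ∈ Ioi (0 : ℝ)
    · have h1' : 0 < t - j := h1
      have h2 : t ∈ Ioi (0 : ℝ) := by
        have : (0 : ℝ) ≤ j := Nat.cast_nonneg j
        exact lt_of_le_of_lt this (by linarith)
      simp only [indicator_of_mem h1, indicator_of_mem h2, ramp, fracKernel]
      rw [max_eq_left h1'.le, mul_left_comm, ← Real.exp_add]
      norm_num
      left
      ring
    · have h1' : t - j ≤ 0 := not_lt.1 h1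
      simp only [indicator_of_notMem h1]
      rw [indicator_apply]
      simp [ramp, hsupp _ h1']
  · intro z hz
    have h := laplace_fracKernel (β := 2) (by norm_num) hz
    have h2 : z⁻¹ ^ ((2 : ℝ) : ℂ) = (z ^ 2)⁻¹ := by
      rw [show ((2 : ℝ) : ℂ) = ((2 : ℕ) : ℂ) by norm_num, Complex.cpow_natCast, inv_pow]
    rw [h2] at h
    rw [← h, laplace, laplace, ← integral_indicator measurableSet_Ioi,
      ← integral_indicator measurableSet_Ioi,
      ← integral_sub_right_eq_self (((Ioi (0 : ℝ)).indicator fun t : ℝ =>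
        (fracKernel 2 t : ℂ) * Complex.exp (-z * t))) (j : ℝ), ← integral_const_mul]
    congr 1
    ext t
    by_cases h1 : t - j ∈ Ioi (0 : ℝ)
    · have h1' : 0 < t - j := h1
      have h2 : t ∈ Ioi (0 : ℝ) := by
        have : (0 : ℝ) ≤ j := Nat.cast_nonneg j
        exact lt_of_le_of_lt this (by linarith)
      simp only [indicator_of_mem h1, indicator_of_mem h2, ramp, fracKernel]
      rw [max_eq_left h1'.le, mul_left_comm, ← Complex.exp_nat_mul, ← Complex.exp_add]
      congr 1
      · norm_num
      · congr 1
        push_cast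
        ring
    · have h1' : t - j ≤ 0 := not_lt.1 h1
      rw [indicator_of_notMem h1, indicator_apply]
      simp [ramp, hsupp _ h1']

/-- The kernel of the discrete solution operator with step `1`: the convolution of `f` with it,
evaluated at an integer `n`, is the `n`-th value produced by the scheme for the source `f`. -/
noncomputable def discreteKernel (α lam r : ℝ) : ℝ :=
  ∑' j : ℕ, PowerSeries.coeff j (solutionSeries α lam) * ramp j r

theorem discreteKernel_eq_sum (α lam : ℝ) {r : ℝ} {n : ℕ} (hr : r ≤ n) :
    discreteKernel α lam r =
      ∑ j ∈ Finset.range n, PowerSeries.coeff j (solutionSeries α lam) * ramp j r :=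
  tsum_eq_sum fun j hj => by
    have : (n : ℝ) ≤ j := by exact_mod_cast (by simpa using hj : n ≤ j)
    rw [ramp, max_eq_right (by linarith), mul_zero]

theorem continuous_discreteKernel (α lam : ℝ) : Continuous (discreteKernel α lam) := by
  rw [continuous_iff_continuousAt]
  intro r
  obtain ⟨n, hn⟩ := exists_nat_gt r
  have h1 : ContinuousAt (fun r => ∑ j ∈ Finset.range n,
      PowerSeries.coeff j (solutionSeries α lam) * ramp j r) r := by
    unfold ramp; fun_prop
  refine h1.congr ?_
  filter_upwards [Iio_mem_nhds hn] with x hx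
  exact (discreteKernel_eq_sum α lam (le_of_lt hx)).symm

theorem laplace_discreteKernel {α : ℝ} (h0 : 0 < α) (h1 : α < 1) {lam : ℝ} (hl : 0 ≤ lam) :
    LaplaceAbs (discreteKernel α lam) (Real.log (2 + lam)) ∧
      ∀ z : ℂ, Real.log (2 + lam) < z.re →
        laplace (discreteKernel α lam) z = discreteSymbol α lam z := by
  have hlog : 0 ≤ Real.log (2 + lam) := Real.log_nonneg (by linarith)
  have hsmall : ∀ z : ℂ, Real.log (2 + lam) < z.re → (2 + lam) * ‖Complex.exp (-z)‖ < 1 := by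
    intro z hz
    rw [Complex.norm_exp, Complex.neg_re, Real.exp_neg, ← div_eq_mul_inv,
      div_lt_one (Real.exp_pos _)]
    exact (Real.log_lt_iff_lt_exp (by linarith)).1 hz
  obtain ⟨h2, h3⟩ := laplace_tsum (c := fun j => PowerSeries.coeff j (solutionSeries α lam))
    (φ := ramp) (s0 := Real.log (2 + lam)) (fun j t _ => le_max_right _ _)
    (fun j => (laplace_ramp j).1) hlog
    (by
      intro s hs
      have hs' : 0 < s := by linarith
      have hp := psAbs_solutionSeries h0 h1 hl (norm_nonneg _) (hsmall s (by simpa using hs))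
      refine (hp.mul_right ((s ^ 2)⁻¹)).congr fun j => ?_
      rw [(laplace_ramp j).2 s (by simpa using hs'), Complex.norm_exp, mul_assoc]
      congr 1
      have e : Complex.exp (-(s : ℂ)) ^ j * ((s : ℂ) ^ 2)⁻¹ =
          ((Real.exp (-s) ^ j * (s ^ 2)⁻¹ : ℝ) : ℂ) := by push_cast; rfl
      rw [e, Complex.ofReal_re, Complex.neg_re, Complex.ofReal_re])
    (continuous_discreteKernel α lam).aestronglyMeasurable
  refine ⟨h2, fun z hz => (h3 z hz).trans ?_⟩
  have hre : 0 < z.re := by linarith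
  have hz0 : z ≠ 0 := fun h => by simp [h] at hre
  have h4 := psEval_solutionSeries_mul h0 h1 hl (hsmall z hz)
  have hne : backDiff z ^ (α : ℂ) + lam * cnWeight α (backDiff z) ≠ 0 := by
    have h5 := sector_lower_bound h0 h1 (backDiff_re_pos hre)
      ((by linarith : (0 : ℝ) ≤ 1 - α).trans (cnWeight_re h0 hre))
      (opposite_im_cnWeight h0 (backDiff z)) hl
    have hy : 0 < ‖backDiff z‖ := norm_pos_iff.2
      (fun h => by have := backDiff_re_pos hre; simp [h] at this)
    have h6 := sectorConst_pos h0 h1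
    have h7 : 0 ≤ lam * ‖cnWeight α (backDiff z)‖ := by positivity
    have h8 : 0 < ‖backDiff z‖ ^ α := by positivity
    exact norm_pos_iff.1 (lt_of_lt_of_le (by positivity) h5)
  have e : ∀ j : ℕ, ((PowerSeries.coeff j (solutionSeries α lam) : ℝ) : ℂ) * laplace (ramp j) z =
      ((PowerSeries.coeff j (solutionSeries α lam) : ℝ) : ℂ) * Complex.exp (-z) ^ j * (z ^ 2)⁻¹ := by
    intro j
    rw [(laplace_ramp j).2 z hre, mul_assoc]
  simp_rw [e]
  rw [tsum_mul_right]
  change psEval (solutionSeries α lam) (Complex.exp (-z)) * _ = _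
  change _ * (backDiff z ^ (α : ℂ) + lam * cnWeight α (backDiff z)) =
    bdfSymbol (backDiff z) ^ 2 * cnWeight α (backDiff z) at h4
  rw [discreteSymbol, ← h4]
  field_simp

/-! ### The error kernel -/

/-- The error of the scheme with step `1` at an integer time is the convolution of the source with
this kernel. -/
noncomputable def errorKernel (α lam r : ℝ) : ℝ := exactKernel α lam r - discreteKernel α lam r

theorem continuousOn_errorKernel {α : ℝ} (hα : 0 < α) {lam : ℝ} (hl : 0 ≤ lam) :
    ContinuousOn (errorKernel α lam) (Ioi 0) :=
  (continuousOn_exactKernel hα hl).sub (continuous_discreteKernel α lam).continuousOn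

theorem LaplaceAbs.mono {f : ℝ → ℝ} {s0 s1 : ℝ} (h : LaplaceAbs f s0) (hs : s0 ≤ s1) :
    LaplaceAbs f s1 := fun s hs' => h s (hs.trans_lt hs')

theorem LaplaceAbs.sub {f g : ℝ → ℝ} {s0 : ℝ} (hf : LaplaceAbs f s0) (hg : LaplaceAbs g s0) :
    LaplaceAbs (fun t => f t - g t) s0 := by
  intro s hs
  refine ((hf s hs).sub (hg s hs)).congr (ae_of_all _ fun t => ?_)
  simp only [Pi.sub_apply]
  ring

theorem laplace_errorKernel {α : ℝ} (h0 : 0 < α) (h1 : α < 1) {lam : ℝ} (hl : 0 ≤ lam) :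
    ∃ s0 : ℝ, 0 ≤ s0 ∧ LaplaceAbs (errorKernel α lam) s0 ∧
      ∀ z : ℂ, s0 < z.re → laplace (errorKernel α lam) z = errorSymbol α lam z := by
  obtain ⟨a1, a2⟩ := laplace_exactKernel h0 hl
  obtain ⟨b1, b2⟩ := laplace_discreteKernel h0 h1 hl
  refine ⟨max (lam ^ (1 / α)) (Real.log (2 + lam)), le_max_of_le_left (by positivity),
    (a1.mono (le_max_left _ _)).sub (b1.mono (le_max_right _ _)), fun z hz => ?_⟩
  obtain ⟨hz1, hz2⟩ := max_lt_iff.1 hz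
  rw [errorSymbol, ← a2 z hz1, ← b2 z hz2, laplace, laplace, laplace,
    ← integral_sub (a1.integrableOn hz1) (b1.integrableOn hz2)]
  congr 1
  ext t
  rw [errorKernel]
  push_cast
  ring

/-- The decay of the error kernel, uniform in the eigenvalue `λ`. -/
theorem abs_errorKernel_le {α : ℝ} (h0 : 0 < α) (h1 : α < 1) :
    ∃ C : ℝ, 0 < C ∧ ∀ lam : ℝ, 0 ≤ lam → ∀ r : ℝ, 0 < r →
      |errorKernel α lam r| ≤ C * r ^ (α - 3) := by
  obtain ⟨C, hC, H⟩ := integral_norm_iteratedDeriv_errorSymbol_le h0 h1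
  refine ⟨Real.exp 1 * C, by positivity, fun lam hl r hr => ?_⟩
  obtain ⟨s0, hs0, ha, hL⟩ := laplace_errorKernel h0 h1 hl
  have key := pow_three_mul_abs_le_of_laplace_eq hs0 ha hL
    (fun z hz => differentiableAt_errorSymbol h0 h1 hl hz)
    (fun a ha => errorSymbol_decay h0 h1 hl ha) hr (inv_pos.2 hr)
    ((continuousOn_errorKernel h0 hl).continuousAt (Ioi_mem_nhds hr))
  have h2 := H lam hl r⁻¹ (inv_pos.2 hr)
  rw [inv_mul_cancel₀ hr.ne'] at key
  rw [Real.inv_rpow hr.le, Real.rpow_neg hr.le, inv_inv] at h2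
  have h3 : r ^ (α - 3) = r ^ α / r ^ 3 := by
    rw [Real.rpow_sub hr]; norm_cast
  rw [h3, mul_div_assoc', le_div_iff₀ (by positivity), mul_comm |_|, mul_assoc]
  exact key.trans (by gcongr)

/-! ### Convolution with a kernel whose first two moments vanish -/

/-- The Beta integral: fractional integrals form a semigroup. -/
theorem integral_fracKernel_mul {a b t : ℝ} (ha : 0 < a) (hb : 0 < b) (ht : 0 < t) :
    IntervalIntegrable (fun s => fracKernel a (t - s) * fracKernel b s) volume 0 t ∧
      ∫ s in (0 : ℝ)..t, fracKernel a (t - s) * fracKernel b s = fracKernel (a + b) t := by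
  have hGa := Real.Gamma_pos_of_pos ha
  have hGb := Real.Gamma_pos_of_pos hb
  have hGab := Real.Gamma_pos_of_pos (add_pos ha hb)
  have h1 := Complex.betaIntegral_scaled (b : ℂ) (a : ℂ) ht
  have h2 := Complex.Gamma_mul_Gamma_eq_betaIntegral (s := (b : ℂ)) (t := (a : ℂ))
    (by simpa using hb) (by simpa using ha)
  have h3 : ((∫ s in (0 : ℝ)..t, fracKernel a (t - s) * fracKernel b s : ℝ) : ℂ) =
      (fracKernel (a + b) t : ℂ) := by
    rw [← intervalIntegral.integral_ofReal]
    have e : ∀ s ∈ uIcc 0 t, ((fracKernel a (t - s) * fracKernel b s : ℝ) : ℂ) =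
        ((Real.Gamma a * Real.Gamma b)⁻¹ : ℝ) *
          ((s : ℂ) ^ ((b : ℂ) - 1) * ((t : ℂ) - s) ^ ((a : ℂ) - 1)) := by
      intro s hs
      rw [uIcc_of_le ht.le] at hs
      have h4 : ((s ^ (b - 1) : ℝ) : ℂ) = (s : ℂ) ^ ((b : ℂ) - 1) := by
        rw [Complex.ofReal_cpow hs.1]; push_cast; rfl
      have h5 : (((t - s) ^ (a - 1) : ℝ) : ℂ) = ((t : ℂ) - s) ^ ((a : ℂ) - 1) := by
        rw [Complex.ofReal_cpow (by linarith [hs.2])]; push_cast; rfl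
      rw [← h4, ← h5, fracKernel, fracKernel]
      push_cast
      field_simp
    rw [intervalIntegral.integral_congr e, intervalIntegral.integral_const_mul, h1]
    have h6 : Complex.betaIntegral b a =
        ((Real.Gamma b * Real.Gamma a / Real.Gamma (a + b) : ℝ) : ℂ) := by
      have hne : Complex.Gamma ((b : ℂ) + a) ≠ 0 :=
        Complex.Gamma_ne_zero_of_re_pos (by simpa using add_pos hb ha)
      push_cast
      rw [← Complex.Gamma_ofReal, ← Complex.Gamma_ofReal, ← Complex.Gamma_ofReal, h2]
      push_cast
      rw [add_comm (a : ℂ) b]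
      field_simp
    have h7 : (t : ℂ) ^ ((b : ℂ) + a - 1) = ((t ^ (a + b - 1) : ℝ) : ℂ) := by
      rw [Complex.ofReal_cpow ht.le, add_comm a b]; push_cast; rfl
    rw [h6, h7, fracKernel]
    push_cast
    have e1 : (Real.Gamma a : ℂ) ≠ 0 := by exact_mod_cast hGa.ne'
    have e2 : (Real.Gamma b : ℂ) ≠ 0 := by exact_mod_cast hGb.ne'
    field_simp
  have h4 := Complex.ofReal_injective h3
  refine ⟨?_, h4⟩
  by_contra hc
  rw [intervalIntegral.integral_undef hc] at h4
  have : 0 < fracKernel (a + b) t := by rw [fracKernel]; positivity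
  linarith

theorem integral_rpow_mul_rpow {p q t : ℝ} (hp : -1 < p) (hq : -1 < q) (ht : 0 < t) :
    IntervalIntegrable (fun s => (t - s) ^ p * s ^ q) volume 0 t ∧
      ∫ s in (0 : ℝ)..t, (t - s) ^ p * s ^ q = Real.Gamma (p + 1) * Real.Gamma (q + 1) /
        Real.Gamma (p + q + 2) * t ^ (p + q + 1) := by
  have h1 : 0 < p + 1 := by linarith
  have h2 : 0 < q + 1 := by linarith
  have hGa := Real.Gamma_pos_of_pos h1
  have hGb := Real.Gamma_pos_of_pos h2
  obtain ⟨hi, he⟩ := integral_fracKernel_mul h1 h2 ht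
  have e : ∀ s, (t - s) ^ p * s ^ q = Real.Gamma (p + 1) * Real.Gamma (q + 1) *
      (fracKernel (p + 1) (t - s) * fracKernel (q + 1) s) := by
    intro s
    rw [fracKernel, fracKernel, add_sub_cancel_right, add_sub_cancel_right]
    field_simp
  simp_rw [e]
  refine ⟨hi.const_mul _, ?_⟩
  rw [intervalIntegral.integral_const_mul, he, fracKernel,
    show p + 1 + (q + 1) = p + q + 2 by ring, show p + q + 2 - 1 = p + q + 1 by ring]
  ring

/-- A kernel on the half-line with the decay and the vanishing moments of the error kernel of a
second order scheme. -/
structure IsCancellingKernel (α M : ℝ) (k : ℝ → ℝ) : Prop where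
  continuousOn : ContinuousOn k (Ioi 0)
  integrableOn : IntegrableOn k (Ioi 0)
  bound : ∀ r : ℝ, 0 < r → |k r| ≤ M * r ^ (α - 3)
  integrableOn_mul : IntegrableOn (fun s => s * k s) (Ioi 0)
  integral_eq_zero : ∫ s in Ioi (0 : ℝ), k s = 0
  integral_mul_eq_zero : ∫ s in Ioi (0 : ℝ), s * k s = 0

namespace IsCancellingKernel

variable {α M : ℝ} {k : ℝ → ℝ}

theorem nonneg (h : IsCancellingKernel α M k) : 0 ≤ M := by
  have := (abs_nonneg _).trans (h.bound 1 one_pos)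
  simpa using this

/-- The first primitive of the kernel. -/
noncomputable def prim (k : ℝ → ℝ) (r : ℝ) : ℝ := ∫ s in (0 : ℝ)..r, k s

/-- The second primitive of the kernel. -/
noncomputable def prim₂ (k : ℝ → ℝ) (r : ℝ) : ℝ := r * prim k r - ∫ s in (0 : ℝ)..r, s * k s

theorem intervalIntegrable (h : IsCancellingKernel α M k) {r : ℝ} (hr : 0 ≤ r) :
    IntervalIntegrable k volume 0 r :=
  (intervalIntegrable_iff_integrableOn_Ioc_of_le hr).2 (h.integrableOn.mono_set Ioc_subset_Ioi_self)

theorem integral_eq_neg {f : ℝ → ℝ} (hf : IntegrableOn f (Ioi 0))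
    (h0 : ∫ s in Ioi (0 : ℝ), f s = 0) {r : ℝ} (hr : 0 ≤ r) :
    ∫ s in (0 : ℝ)..r, f s = -∫ s in Ioi r, f s := by
  rw [intervalIntegral.integral_of_le hr]
  have := setIntegral_union (Ioc_disjoint_Ioi_same (a := (0 : ℝ)) (b := r)) measurableSet_Ioi
    (hf.mono_set Ioc_subset_Ioi_self) (hf.mono_set (Ioi_subset_Ioi hr))
  rw [Ioc_union_Ioi_eq_Ioi hr, h0] at this
  linarith

/-- Since the mean vanishes, the primitive equals minus the tail integral, which is controlled also
for small `r`, where the bound on the kernel itself is not integrable. -/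
theorem abs_prim_le (h : IsCancellingKernel α M k) (h1 : α < 1) {r : ℝ} (hr : 0 < r) :
    |prim k r| ≤ M * r ^ (α - 2) := by
  have hM := h.nonneg
  rw [prim, integral_eq_neg h.integrableOn h.integral_eq_zero hr.le, abs_neg]
  have hi : IntegrableOn (fun s : ℝ => M * s ^ (α - 3)) (Ioi r) :=
    (integrableOn_Ioi_rpow_of_lt (by linarith) hr).const_mul M
  have h2 : ‖∫ s in Ioi r, k s‖ ≤ ∫ s in Ioi r, M * s ^ (α - 3) := by
    refine norm_integral_le_of_norm_le hi ?_
    filter_upwards [ae_restrict_mem measurableSet_Ioi] with s hs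
    exact h.bound s (hr.trans hs)
  rw [Real.norm_eq_abs, integral_const_mul, integral_Ioi_rpow_of_lt (by linarith) hr] at h2
  refine h2.trans ?_
  have e : -r ^ (α - 3 + 1) / (α - 3 + 1) = r ^ (α - 2) / (2 - α) := by
    rw [show α - 3 + 1 = -(2 - α) by ring, neg_div_neg_eq, neg_sub]
  rw [e]
  have : 0 < r ^ (α - 2) := by positivity
  have h3 : r ^ (α - 2) / (2 - α) ≤ r ^ (α - 2) := div_le_self this.le (by linarith)
  gcongr

theorem abs_prim₂_le (h : IsCancellingKernel α M k) (h1 : α < 1) {r : ℝ} (hr : 0 < r) :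
    |prim₂ k r| ≤ M / (1 - α) * r ^ (α - 1) := by
  have hM := h.nonneg
  have hk : IntegrableOn k (Ioi r) := h.integrableOn.mono_set (Ioi_subset_Ioi hr.le)
  have hsk : IntegrableOn (fun s => s * k s) (Ioi r) :=
    h.integrableOn_mul.mono_set (Ioi_subset_Ioi hr.le)
  have e : prim₂ k r = ∫ s in Ioi r, (s - r) * k s := by
    rw [prim₂, prim, integral_eq_neg h.integrableOn h.integral_eq_zero hr.le,
      integral_eq_neg h.integrableOn_mul h.integral_mul_eq_zero hr.le]
    simp_rw [sub_mul]
    rw [integral_sub hsk (hk.const_mul r), integral_const_mul]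
    ring
  have hi : IntegrableOn (fun s : ℝ => M * s ^ (α - 2)) (Ioi r) :=
    (integrableOn_Ioi_rpow_of_lt (by linarith) hr).const_mul M
  have h2 : ‖∫ s in Ioi r, (s - r) * k s‖ ≤ ∫ s in Ioi r, M * s ^ (α - 2) := by
    refine norm_integral_le_of_norm_le hi ?_
    filter_upwards [ae_restrict_mem measurableSet_Ioi] with s hs
    have hs' : r < s := hs
    have hs0 : 0 < s := hr.trans hs
    rw [norm_mul, Real.norm_of_nonneg (by linarith), Real.norm_eq_abs]
    have e3 : s ^ (α - 2) = s * s ^ (α - 3) := by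
      rw [show α - 2 = 1 + (α - 3) by ring, Real.rpow_add hs0, Real.rpow_one]
    calc (s - r) * |k s| ≤ s * (M * s ^ (α - 3)) := by
          gcongr
          · linarith
          · exact h.bound s hs0
      _ = M * s ^ (α - 2) := by rw [e3]; ring
  rw [e]
  rw [Real.norm_eq_abs, integral_const_mul, integral_Ioi_rpow_of_lt (by linarith) hr] at h2
  refine h2.trans (le_of_eq ?_)
  rw [show α - 2 + 1 = α - 1 by ring]
  have : (1 - α) ≠ 0 := by linarith
  have : (α - 1) ≠ 0 := by linarith
  field_simp
  ring

theorem continuousOn_integral {f : ℝ → ℝ} (hf : IntegrableOn f (Ioi 0)) (T : ℝ) :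
    ContinuousOn (fun r => ∫ s in (0 : ℝ)..r, f s) (Icc 0 T) := by
  rcases le_or_gt 0 T with hT | hT
  · have := intervalIntegral.continuousOn_primitive_interval (μ := volume) (a := 0) (b := T) (f := f)
      (by
        rw [uIcc_of_le hT, integrableOn_Icc_iff_integrableOn_Ioc]
        exact hf.mono_set Ioc_subset_Ioi_self)
    rwa [uIcc_of_le hT] at this
  · rw [Icc_eq_empty (by linarith)]; exact continuousOn_empty _

theorem continuousOn_prim (h : IsCancellingKernel α M k) (T : ℝ) :
    ContinuousOn (prim k) (Icc 0 T) := continuousOn_integral h.integrableOn T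

theorem continuousOn_prim₂ (h : IsCancellingKernel α M k) (T : ℝ) :
    ContinuousOn (prim₂ k) (Icc 0 T) :=
  (continuousOn_id.mul (h.continuousOn_prim T)).sub (continuousOn_integral h.integrableOn_mul T)

theorem hasDerivAt_integral {f : ℝ → ℝ} (hf : IntegrableOn f (Ioi 0)) (hc : ContinuousOn f (Ioi 0))
    {r : ℝ} (hr : 0 < r) : HasDerivAt (fun r => ∫ s in (0 : ℝ)..r, f s) (f r) r := by
  refine intervalIntegral.integral_hasDerivAt_right ?_ ?_ (hc.continuousAt (Ioi_mem_nhds hr))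
  · exact (intervalIntegrable_iff_integrableOn_Ioc_of_le hr.le).2
      (hf.mono_set Ioc_subset_Ioi_self)
  · exact ⟨Ioi 0, Ioi_mem_nhds hr, hc.aestronglyMeasurable measurableSet_Ioi⟩

theorem hasDerivAt_prim (h : IsCancellingKernel α M k) {r : ℝ} (hr : 0 < r) :
    HasDerivAt (prim k) (k r) r := hasDerivAt_integral h.integrableOn h.continuousOn hr

theorem hasDerivAt_prim₂ (h : IsCancellingKernel α M k) {r : ℝ} (hr : 0 < r) :
    HasDerivAt (prim₂ k) (prim k r) r := by
  have h1 := ((hasDerivAt_id r).mul (h.hasDerivAt_prim hr)).sub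
    (hasDerivAt_integral h.integrableOn_mul (continuousOn_id.mul h.continuousOn) hr)
  refine h1.congr_deriv ?_
  simp

/-- The kernel reversed in time is integrable. -/
theorem intervalIntegrable_comp_sub (h : IsCancellingKernel α M k) {a t : ℝ} (hat : a ≤ t) :
    IntervalIntegrable (fun s => k (t - s)) volume a t := by
  have := (h.intervalIntegrable (sub_nonneg.2 hat)).symm.comp_sub_left t
  simpa using this

theorem intervalIntegrable_prim₂_comp_sub (h : IsCancellingKernel α M k) {a t : ℝ} (hat : a ≤ t)
    {φ : ℝ → ℝ} (hφ : ContinuousOn φ (Icc a t)) :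
    IntervalIntegrable (fun s => prim₂ k (t - s) * φ s) volume a t := by
  refine ContinuousOn.intervalIntegrable ?_
  rw [uIcc_of_le hat]
  refine ContinuousOn.mul ((h.continuousOn_prim₂ (t - a)).comp (by fun_prop) ?_) hφ
  intro s hs
  exact ⟨by linarith [hs.2], by linarith [hs.1]⟩

/-- Two integrations by parts. -/
theorem integral_comp_sub_mul (h : IsCancellingKernel α M k) {a t : ℝ} (hat : a ≤ t)
    {φ φ' φ'' : ℝ → ℝ} (hφ : ∀ s ∈ Icc a t, HasDerivAt φ (φ' s) s)
    (hφ' : ∀ s ∈ Icc a t, HasDerivAt φ' (φ'' s) s) (hφ'' : ContinuousOn φ'' (Icc a t)) :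
    ∫ s in a..t, k (t - s) * φ s = prim k (t - a) * φ a + prim₂ k (t - a) * φ' a +
      ∫ s in a..t, prim₂ k (t - s) * φ'' s := by
  have hcφ : ContinuousOn φ (Icc a t) := fun s hs => (hφ s hs).continuousAt.continuousWithinAt
  have hcφ' : ContinuousOn φ' (Icc a t) := fun s hs => (hφ' s hs).continuousAt.continuousWithinAt
  have hi1 : IntervalIntegrable (fun s => k (t - s) * φ s) volume a t :=
    (h.intervalIntegrable_comp_sub hat).mul_continuousOn (by rwa [uIcc_of_le hat])
  have hi2 := h.intervalIntegrable_prim₂_comp_sub hat hφ''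
  have hmaps : MapsTo (fun s => t - s) (Icc a t) (Icc 0 (t - a)) :=
    fun s hs => ⟨by linarith [hs.2], by linarith [hs.1]⟩
  have key := intervalIntegral.integral_eq_sub_of_hasDerivAt_of_le hat
    (f := fun s => -(prim k (t - s) * φ s) - prim₂ k (t - s) * φ' s)
    (f' := fun s => k (t - s) * φ s - prim₂ k (t - s) * φ'' s)
    ((((h.continuousOn_prim (t - a)).comp (by fun_prop) hmaps).mul hcφ).neg.sub
      (((h.continuousOn_prim₂ (t - a)).comp (by fun_prop) hmaps).mul hcφ'))
    (fun s hs => by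
      have hs' : s ∈ Icc a t := Ioo_subset_Icc_self hs
      have hpos : 0 < t - s := by linarith [hs.2]
      have d : HasDerivAt (fun s => t - s) (-1) s := by
        simpa using (hasDerivAt_id s).const_sub t
      have d1 := (h.hasDerivAt_prim hpos).comp s d
      have d2 := (h.hasDerivAt_prim₂ hpos).comp s d
      refine ((d1.mul (hφ s hs')).neg.sub (d2.mul (hφ' s hs'))).congr_deriv ?_
      simp only [Function.comp_apply]
      ring)
    (hi1.sub hi2)
  rw [intervalIntegral.integral_sub hi1 hi2] at key
  have e0 : prim k 0 = 0 := by rw [prim, intervalIntegral.integral_same]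
  have e1 : prim₂ k 0 = 0 := by
    rw [prim₂, intervalIntegral.integral_same]; ring
  simp only [sub_self, e0, e1, zero_mul, neg_zero] at key
  linarith

theorem abs_integral_prim₂_le (h : IsCancellingKernel α M k) (h0 : 0 < α) (h1 : α < 1) {a t : ℝ}
    (hat : a ≤ t) {φ : ℝ → ℝ} {B : ℝ} (hφ : ∀ s ∈ Ioc a t, |φ s| ≤ B) :
    |∫ s in a..t, prim₂ k (t - s) * φ s| ≤ M / (1 - α) * B * ((t - a) ^ α / α) := by
  have hM := h.nonneg
  have hi : IntervalIntegrable (fun s => (t - s) ^ (α - 1)) volume a t := by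
    have := (intervalIntegral.intervalIntegrable_rpow' (a := 0) (b := t - a)
      (by linarith : -1 < α - 1)).symm.comp_sub_left t
    simpa using this
  have he : ∫ s in a..t, (t - s) ^ (α - 1) = (t - a) ^ α / α := by
    rw [intervalIntegral.integral_comp_sub_left (fun s => s ^ (α - 1)) t, sub_self,
      integral_rpow (Or.inl (by linarith))]
    rw [sub_add_cancel, Real.zero_rpow h0.ne', sub_zero]
  have h2 : ‖∫ s in a..t, prim₂ k (t - s) * φ s‖ ≤
      ∫ s in a..t, M / (1 - α) * B * (t - s) ^ (α - 1) := by
    refine intervalIntegral.norm_integral_le_of_norm_le hat ?_ (hi.const_mul _)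
    have hne : ∀ᵐ s : ℝ, s ≠ t := by simp [ae_iff]
    filter_upwards [hne] with s hst hs
    have hpos : 0 < t - s := by
      have := lt_of_le_of_ne hs.2 hst; linarith
    rw [norm_mul, Real.norm_eq_abs, Real.norm_eq_abs]
    have a1 := h.abs_prim₂_le h1 hpos
    calc |prim₂ k (t - s)| * |φ s| ≤ (M / (1 - α) * (t - s) ^ (α - 1)) * B :=
          mul_le_mul a1 (hφ s hs) (abs_nonneg _) ((abs_nonneg _).trans a1)
      _ = _ := by ring
  rw [intervalIntegral.integral_const_mul, he] at h2
  exact h2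

/-- Convolution with a power which may be singular at the origin. -/
theorem abs_integral_mul_rpow_le (h : IsCancellingKernel α M k) (h0 : 0 < α) (h1 : α < 1) {ν : ℝ}
    (hν0 : -1 < ν) (hν1 : ν < 1) {t : ℝ} (ht : 0 < t) :
    |∫ s in (0 : ℝ)..t, k (t - s) * s ^ ν| ≤
      (1 / (ν + 1) + 1 + 1 / (1 - α) + 2 / ((1 - α) * α)) * (1 / 2) ^ (α + ν - 2) * M *
        t ^ (α + ν - 2) := by
  have hM := h.nonneg
  have h1α : 0 < 1 - α := by linarith
  set a := t / 2 with ha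
  have ha0 : 0 < a := by rw [ha]; linarith
  have hta : t - a = a := by rw [ha]; ring
  have hat : a ≤ t := by linarith
  have hiν : IntervalIntegrable (fun s : ℝ => s ^ ν) volume 0 a :=
    intervalIntegral.intervalIntegrable_rpow' hν0
  -- near the origin only the decay of the kernel matters
  have hb1 : ∀ s ∈ Ioc 0 a, ‖k (t - s) * s ^ ν‖ ≤ M * a ^ (α - 3) * s ^ ν := by
    intro s hs
    have hs0 : 0 ≤ s ^ ν := Real.rpow_nonneg hs.1.le _
    rw [norm_mul, Real.norm_of_nonneg hs0, Real.norm_eq_abs]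
    have hts : a ≤ t - s := by linarith [hs.2]
    have h2 := h.bound (t - s) (by linarith)
    have h3 : (t - s) ^ (α - 3) ≤ a ^ (α - 3) :=
      Real.rpow_le_rpow_of_nonpos ha0 hts (by linarith)
    have h4 : |k (t - s)| ≤ M * a ^ (α - 3) := h2.trans (by gcongr)
    gcongr
  have hi1 : IntervalIntegrable (fun s => k (t - s) * s ^ ν) volume 0 a := by
    rw [intervalIntegrable_iff_integrableOn_Ioc_of_le ha0.le] at hiν ⊢
    refine (hiν.const_mul (M * a ^ (α - 3))).mono' ?_ ?_
    · have hks : IntervalIntegrable (fun s => k (t - s)) volume 0 a :=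
        (h.intervalIntegrable_comp_sub ht.le).mono_set (by
          rw [uIcc_of_le ha0.le, uIcc_of_le ht.le]; exact Icc_subset_Icc le_rfl hat)
      rw [intervalIntegrable_iff_integrableOn_Ioc_of_le ha0.le] at hks
      exact hks.aestronglyMeasurable.mul hiν.aestronglyMeasurable
    · filter_upwards [ae_restrict_mem measurableSet_Ioc] with s hs using hb1 s hs
  have hI1 : |∫ s in (0 : ℝ)..a, k (t - s) * s ^ ν| ≤ 1 / (ν + 1) * M * a ^ (α + ν - 2) := by
    have h2 := intervalIntegral.norm_integral_le_of_norm_le ha0.le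
      (ae_of_all _ fun s hs => hb1 s hs) (hiν.const_mul (M * a ^ (α - 3)))
    rw [intervalIntegral.integral_const_mul, integral_rpow (Or.inl hν0),
      Real.zero_rpow (by linarith), sub_zero] at h2
    refine h2.trans (le_of_eq ?_)
    have e : a ^ (α + ν - 2) = a ^ (α - 3) * a ^ (ν + 1) := by
      rw [← Real.rpow_add ha0]; ring_nf
    rw [e]; ring
  -- near `t` the cancellation of the kernel is used
  have hpos : ∀ s ∈ Icc a t, s ≠ 0 := fun s hs => by linarith [hs.1]
  have hI2 := h.integral_comp_sub_mul hat (φ := fun s => s ^ ν) (φ' := fun s => ν * s ^ (ν - 1))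
    (φ'' := fun s => ν * ((ν - 1) * s ^ (ν - 1 - 1)))
    (fun s hs => Real.hasDerivAt_rpow_const (Or.inl (hpos s hs)))
    (fun s hs => (Real.hasDerivAt_rpow_const (Or.inl (hpos s hs))).const_mul ν)
    (continuousOn_const.mul (continuousOn_const.mul
      (fun s hs => (Real.continuousAt_rpow_const _ _ (Or.inl (hpos s hs))).continuousWithinAt)))
  have hi2 : IntervalIntegrable (fun s => k (t - s) * s ^ ν) volume a t := by
    refine (h.intervalIntegrable_comp_sub hat).mul_continuousOn ?_
    rw [uIcc_of_le hat]
    exact fun s hs => (Real.continuousAt_rpow_const _ _ (Or.inl (hpos s hs))).continuousWithinAt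
  have hB : ∀ s ∈ Ioc a t, |ν * ((ν - 1) * s ^ (ν - 1 - 1))| ≤ 2 * a ^ (ν - 2) := by
    intro s hs
    have hs0 : 0 < s := ha0.trans hs.1
    rw [abs_mul, abs_mul, abs_of_pos (by positivity : 0 < s ^ (ν - 1 - 1)),
      show ν - 1 - 1 = ν - 2 by ring]
    have h2 : |ν| ≤ 1 := abs_le.2 ⟨by linarith, by linarith⟩
    have h3 : |ν - 1| ≤ 2 := abs_le.2 ⟨by linarith, by linarith⟩
    have h4 : s ^ (ν - 2) ≤ a ^ (ν - 2) :=
      Real.rpow_le_rpow_of_nonpos ha0 hs.1.le (by linarith)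
    calc |ν| * (|ν - 1| * s ^ (ν - 2)) ≤ 1 * (2 * a ^ (ν - 2)) := by gcongr
      _ = _ := one_mul _
  have hI3 := h.abs_integral_prim₂_le h0 h1 hat hB
  have hK1 := h.abs_prim_le h1 ha0
  have hK2 := h.abs_prim₂_le h1 ha0
  rw [hta] at hI2 hI3
  have t1 : |prim k a * a ^ ν| ≤ M * a ^ (α + ν - 2) := by
    rw [abs_mul, abs_of_pos (by positivity : 0 < a ^ ν)]
    calc _ ≤ M * a ^ (α - 2) * a ^ ν := by gcongr
      _ = _ := by rw [mul_assoc, ← Real.rpow_add ha0]; ring_nf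
  have t2 : |prim₂ k a * (ν * a ^ (ν - 1))| ≤ 1 / (1 - α) * M * a ^ (α + ν - 2) := by
    rw [abs_mul, abs_mul, abs_of_pos (by positivity : 0 < a ^ (ν - 1))]
    have h2 : |ν| ≤ 1 := abs_le.2 ⟨by linarith, by linarith⟩
    calc _ ≤ (M / (1 - α) * a ^ (α - 1)) * (1 * a ^ (ν - 1)) := by gcongr
      _ = 1 / (1 - α) * M * (a ^ (α - 1) * a ^ (ν - 1)) := by ring
      _ = _ := by rw [← Real.rpow_add ha0]; ring_nf
  have t3 : M / (1 - α) * (2 * a ^ (ν - 2)) * (a ^ α / α) =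
      2 / ((1 - α) * α) * M * a ^ (α + ν - 2) := by
    rw [show α + ν - 2 = (ν - 2) + α by ring, Real.rpow_add ha0]
    field_simp
  rw [t3] at hI3
  rw [← intervalIntegral.integral_add_adjacent_intervals hi1 hi2, hI2]
  have hfin : a ^ (α + ν - 2) = (1 / 2) ^ (α + ν - 2) * t ^ (α + ν - 2) := by
    rw [← Real.mul_rpow (by norm_num) ht.le, ha]; ring_nf
  refine (abs_add_le _ _).trans ((add_le_add hI1 ((abs_add_le _ _).trans
    (add_le_add ((abs_add_le _ _).trans (add_le_add t1 t2)) hI3))).trans (le_of_eq ?_))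
  rw [hfin]
  ring

/-- Convolution with a power cut off linearly at `ζ`. -/
theorem abs_integral_mul_rpow_mul_sub_le (h : IsCancellingKernel α M k) (h0 : 0 < α) (h1 : α < 1)
    {μ : ℝ} (hμ0 : -1 < μ) (hμ1 : μ < 0) {ζ t : ℝ} (hζ : 0 < ζ) (hζt : ζ < t) :
    |∫ s in ζ..t, k (t - s) * (s ^ μ * (s - ζ))| ≤
      (1 / (1 - α) + 4 / (1 - α) * (Real.Gamma α * Real.Gamma ((μ - 1) / 2 + 1) /
        Real.Gamma (α + (μ - 1) / 2 + 1))) * M *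
        ((t - ζ) ^ (α - 1) * ζ ^ μ + t ^ (α + (μ - 1) / 2) * ζ ^ ((μ - 1) / 2)) := by
  have hM := h.nonneg
  have h1α : 0 < 1 - α := by linarith
  have ht : 0 < t := hζ.trans hζt
  have hpos : ∀ s ∈ Icc ζ t, s ≠ 0 := fun s hs => by linarith [hs.1]
  have hpow : ∀ p : ℝ, ContinuousOn (fun s : ℝ => s ^ p) (Icc ζ t) := fun p s hs =>
    (Real.continuousAt_rpow_const _ _ (Or.inl (hpos s hs))).continuousWithinAt
  set φ'' : ℝ → ℝ := fun s => μ * ((μ - 1) * s ^ (μ - 1 - 1)) * (s - ζ) + 2 * (μ * s ^ (μ - 1))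
    with hφ''
  have hI := h.integral_comp_sub_mul hζt.le (φ := fun s => s ^ μ * (s - ζ))
    (φ' := fun s => μ * s ^ (μ - 1) * (s - ζ) + s ^ μ) (φ'' := φ'')
    (fun s hs => by
      have d1 := (Real.hasDerivAt_rpow_const (p := μ) (Or.inl (hpos s hs))).mul
        ((hasDerivAt_id s).sub_const ζ)
      refine d1.congr_deriv ?_
      simp)
    (fun s hs => by
      have d0 := Real.hasDerivAt_rpow_const (p := μ) (Or.inl (hpos s hs))
      have d1 := (((Real.hasDerivAt_rpow_const (p := μ - 1) (Or.inl (hpos s hs))).const_mul μ).mul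
        ((hasDerivAt_id s).sub_const ζ)).add d0
      refine d1.congr_deriv ?_
      rw [hφ'']
      simp only [id]
      ring)
    (((continuousOn_const.mul (continuousOn_const.mul (hpow _))).mul (by fun_prop)).add
      (continuousOn_const.mul (continuousOn_const.mul (hpow _))))
  simp only [sub_self, mul_zero, zero_add] at hI
  rw [hI]
  have hp : -1 < (μ - 1) / 2 := by linarith
  set p := (μ - 1) / 2 with hpd
  obtain ⟨hbi, hbe⟩ := integral_rpow_mul_rpow (p := α - 1) (q := p) (by linarith) hp ht
  rw [sub_add_cancel, show α - 1 + p + 2 = α + p + 1 by ring,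
    show α - 1 + p + 1 = α + p by ring] at hbe
  set G := Real.Gamma α * Real.Gamma (p + 1) / Real.Gamma (α + p + 1) with hG
  have hK2 := h.abs_prim₂_le h1 (sub_pos.2 hζt)
  have t1 : |prim₂ k (t - ζ) * ζ ^ μ| ≤ 1 / (1 - α) * M * ((t - ζ) ^ (α - 1) * ζ ^ μ) := by
    rw [abs_mul, abs_of_pos (by positivity : 0 < ζ ^ μ)]
    calc _ ≤ M / (1 - α) * (t - ζ) ^ (α - 1) * ζ ^ μ := by gcongr
      _ = _ := by ring
  have hφb : ∀ s, ζ ≤ s → |φ'' s| ≤ 4 * (ζ ^ p * s ^ p) := by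
    intro s hs
    have hs0 : 0 < s := by linarith
    have e1 : s ^ (μ - 1) = s ^ p * s ^ p := by
      rw [← Real.rpow_add hs0]; congr 1; rw [hpd]; ring
    have e2 : s ^ (μ - 1 - 1) * s = s ^ (μ - 1) := by
      rw [Real.rpow_sub_one hs0.ne' (μ - 1)]; field_simp
    have e3 : s ^ p ≤ ζ ^ p := Real.rpow_le_rpow_of_nonpos hζ hs (by linarith)
    have h2 : |μ| ≤ 1 := abs_le.2 ⟨by linarith, by linarith⟩
    have h3 : |μ - 1| ≤ 2 := abs_le.2 ⟨by linarith, by linarith⟩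
    have h4 : |s - ζ| ≤ s := abs_le.2 ⟨by linarith, by linarith⟩
    rw [hφ'']
    refine (abs_add_le _ _).trans ?_
    rw [abs_mul, abs_mul, abs_mul, abs_mul, abs_mul, abs_of_pos (by positivity : 0 < s ^ (μ - 1 - 1)),
      abs_of_pos (by positivity : 0 < s ^ (μ - 1)), abs_of_pos (by norm_num : (0 : ℝ) < 2)]
    calc _ ≤ 1 * (2 * s ^ (μ - 1 - 1)) * s + 2 * (1 * s ^ (μ - 1)) := by gcongr
      _ = 4 * s ^ (μ - 1) := by rw [← e2]; ring
      _ ≤ _ := by rw [e1]; gcongr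
  have t2 : |∫ s in ζ..t, prim₂ k (t - s) * φ'' s| ≤
      4 / (1 - α) * G * M * (t ^ (α + p) * ζ ^ p) := by
    have hbi' : IntervalIntegrable (fun s => (t - s) ^ (α - 1) * s ^ p) volume ζ t :=
      hbi.mono_set (by rw [uIcc_of_le hζt.le, uIcc_of_le ht.le]; exact Icc_subset_Icc hζ.le le_rfl)
    have h2 : ‖∫ s in ζ..t, prim₂ k (t - s) * φ'' s‖ ≤
        ∫ s in ζ..t, M / (1 - α) * 4 * ζ ^ p * ((t - s) ^ (α - 1) * s ^ p) := by
      refine intervalIntegral.norm_integral_le_of_norm_le hζt.le ?_ (hbi'.const_mul _)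
      have hne : ∀ᵐ s : ℝ, s ≠ t := by simp [ae_iff]
      filter_upwards [hne] with s hst hs
      have hpos : 0 < t - s := by
        have := lt_of_le_of_ne hs.2 hst; linarith
      rw [norm_mul, Real.norm_eq_abs, Real.norm_eq_abs]
      have a1 := h.abs_prim₂_le h1 hpos
      calc _ ≤ (M / (1 - α) * (t - s) ^ (α - 1)) * (4 * (ζ ^ p * s ^ p)) :=
            mul_le_mul a1 (hφb s hs.1.le) (abs_nonneg _) ((abs_nonneg _).trans a1)
        _ = _ := by ring
    have h3 : ∫ s in ζ..t, (t - s) ^ (α - 1) * s ^ p ≤ ∫ s in (0 : ℝ)..t, (t - s) ^ (α - 1) * s ^ p := by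
      refine intervalIntegral.integral_mono_interval hζ.le hζt.le le_rfl ?_ hbi
      filter_upwards [ae_restrict_mem measurableSet_Ioc] with s hs
      have : 0 ≤ t - s := by linarith [hs.2]
      have : 0 ≤ s := hs.1.le
      simp only [Pi.zero_apply]
      positivity
    rw [intervalIntegral.integral_const_mul] at h2
    refine h2.trans ?_
    calc _ ≤ M / (1 - α) * 4 * ζ ^ p * (G * t ^ (α + p)) := by
          rw [← hbe]; gcongr
      _ = _ := by ring
  have hG0 : 0 ≤ G := by
    have := Real.Gamma_pos_of_pos h0
    have := Real.Gamma_pos_of_pos (by linarith : 0 < p + 1)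
    have hnn : 0 ≤ ∫ s in (0 : ℝ)..t, (t - s) ^ (α - 1) * s ^ p := by
      refine intervalIntegral.integral_nonneg ht.le fun s hs => ?_
      have : 0 ≤ t - s := by linarith [hs.2]
      have : 0 ≤ s := hs.1
      positivity
    rw [hbe] at hnn
    exact nonneg_of_mul_nonneg_left hnn (by positivity)
  refine (abs_add_le _ _).trans ((add_le_add t1 t2).trans ?_)
  have p1 : 0 ≤ (t - ζ) ^ (α - 1) * ζ ^ μ :=
    mul_nonneg (Real.rpow_nonneg (by linarith) _) (by positivity)
  have p2 : 0 ≤ t ^ (α + p) * ζ ^ p := by positivity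
  have p3 : 0 ≤ 4 / (1 - α) * G * M := by positivity
  have p4 : 0 ≤ 1 / (1 - α) * M := by positivity
  nlinarith [mul_nonneg p3 p1, mul_nonneg p4 p2]

end IsCancellingKernel

/-! ### The moments of the error kernel -/

/-- The mean of an integrable function is read off from its Laplace transform at the origin. -/
theorem tendsto_integral_mul_exp {k : ℝ → ℝ} (hk : IntegrableOn k (Ioi 0)) :
    Tendsto (fun x : ℝ => ∫ t in Ioi (0 : ℝ), k t * Real.exp (-x * t)) (𝓝[>] 0)
      (𝓝 (∫ t in Ioi (0 : ℝ), k t)) := by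
  refine tendsto_integral_filter_of_dominated_convergence (fun t => ‖k t‖) ?_ ?_ hk.norm ?_
  · exact Eventually.of_forall fun x => hk.aestronglyMeasurable.mul (by fun_prop)
  · filter_upwards [self_mem_nhdsWithin] with x hx
    filter_upwards [ae_restrict_mem measurableSet_Ioi] with t ht
    have hx0 : (0 : ℝ) < x := hx
    have ht0 : (0 : ℝ) < t := ht
    rw [norm_mul, Real.norm_of_nonneg (Real.exp_pos _).le]
    refine mul_le_of_le_one_right (norm_nonneg _) (Real.exp_le_one_iff.2 ?_)
    nlinarith [mul_pos hx0 ht0]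
  · refine ae_of_all _ fun t => ?_
    have : Continuous fun x : ℝ => k t * Real.exp (-x * t) := by fun_prop
    have h := this.tendsto 0
    simp only [neg_zero, zero_mul, Real.exp_zero, mul_one] at h
    exact h.mono_left nhdsWithin_le_nhds

/-- If the mean vanishes, so that the Laplace transform vanishes at the origin, its derivative
there is the negative of the first moment. -/
theorem tendsto_integral_mul_exp_div {k : ℝ → ℝ} (hk : IntegrableOn k (Ioi 0))
    (hk1 : IntegrableOn (fun t => t * k t) (Ioi 0)) (h0 : ∫ t in Ioi (0 : ℝ), k t = 0) :
    Tendsto (fun x : ℝ => (∫ t in Ioi (0 : ℝ), k t * Real.exp (-x * t)) / x) (𝓝[>] 0)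
      (𝓝 (-∫ t in Ioi (0 : ℝ), t * k t)) := by
  have key : Tendsto (fun x : ℝ => ∫ t in Ioi (0 : ℝ), k t * ((Real.exp (-x * t) - 1) / x))
      (𝓝[>] 0) (𝓝 (∫ t in Ioi (0 : ℝ), -(t * k t))) := by
    refine tendsto_integral_filter_of_dominated_convergence (fun t => ‖t * k t‖) ?_ ?_ hk1.norm ?_
    · exact Eventually.of_forall fun x => hk.aestronglyMeasurable.mul (by fun_prop)
    · filter_upwards [self_mem_nhdsWithin] with x hx
      filter_upwards [ae_restrict_mem measurableSet_Ioi] with t ht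
      have hx0 : (0 : ℝ) < x := hx
      have ht0 : (0 : ℝ) < t := ht
      rw [norm_mul, norm_mul, mul_comm ‖t‖, norm_div, Real.norm_of_nonneg hx0.le,
        Real.norm_of_nonneg ht0.le]
      refine mul_le_mul_of_nonneg_left ?_ (norm_nonneg _)
      rw [div_le_iff₀ hx0, Real.norm_eq_abs, abs_le]
      have h1 : Real.exp (-x * t) ≤ 1 := Real.exp_le_one_iff.2 (by nlinarith [mul_pos hx0 ht0])
      have h2 := Real.add_one_le_exp (-x * t)
      constructor
      · linarith
      · nlinarith [mul_pos hx0 ht0]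
    · refine ae_of_all _ fun t => ?_
      have hd : HasDerivAt (fun x : ℝ => Real.exp (-x * t)) (-t) 0 := by
        have := ((hasDerivAt_id (0 : ℝ)).neg.mul_const t).exp
        simpa using this
      have h := hd.tendsto_slope_zero_right
      simp only [zero_add, neg_zero, zero_mul, Real.exp_zero, smul_eq_mul] at h
      have h' := h.const_mul (k t)
      rw [show k t * -t = -(t * k t) by ring] at h'
      refine h'.congr fun x => ?_
      rw [inv_mul_eq_div]
  rw [integral_neg] at key
  refine key.congr' ?_
  filter_upwards [self_mem_nhdsWithin] with x hx
  have hx0 : (0 : ℝ) < x := hx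
  have hi : IntegrableOn (fun t => k t * Real.exp (-x * t)) (Ioi 0) := by
    refine hk.norm.mono' (hk.aestronglyMeasurable.mul (by fun_prop)) ?_
    filter_upwards [ae_restrict_mem measurableSet_Ioi] with t ht
    have ht0 : (0 : ℝ) < t := ht
    rw [norm_mul, Real.norm_of_nonneg (Real.exp_pos _).le]
    refine mul_le_of_le_one_right (norm_nonneg _) (Real.exp_le_one_iff.2 ?_)
    nlinarith [mul_pos hx0 ht0]
  have e : ∀ t, k t * ((Real.exp (-x * t) - 1) / x) = x⁻¹ * (k t * Real.exp (-x * t) - k t) := by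
    intro t; field_simp
  simp_rw [e]
  rw [integral_const_mul, integral_sub hi hk, h0, sub_zero, inv_mul_eq_div]

theorem integrableOn_Ioi_of_laplaceAbs {k : ℝ → ℝ} {s0 B p : ℝ} (hL : LaplaceAbs k s0)
    (hp : p < -1) (hB : ∀ r : ℝ, 0 < r → |k r| ≤ B * r ^ p) : IntegrableOn k (Ioi 0) := by
  rw [← Ioc_union_Ioi_eq_Ioi zero_le_one, integrableOn_union]
  constructor
  · have h1 := (hL (s0 + 1) (by linarith)).mono_set (Ioc_subset_Ioi_self : Ioc (0 : ℝ) 1 ⊆ _)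
    rw [← intervalIntegrable_iff_integrableOn_Ioc_of_le zero_le_one] at h1 ⊢
    have h2 := h1.mul_continuousOn (g := fun t => Real.exp ((s0 + 1) * t)) (by fun_prop)
    refine h2.congr fun t _ => ?_
    rw [mul_assoc, ← Real.exp_add, show -(s0 + 1) * t + (s0 + 1) * t = 0 by ring, Real.exp_zero,
      mul_one]
  · refine ((integrableOn_Ioi_rpow_of_lt hp one_pos).const_mul B).mono'
      (hL.aestronglyMeasurable.mono_set (Ioi_subset_Ioi zero_le_one)) ?_
    filter_upwards [ae_restrict_mem measurableSet_Ioi] with t ht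
    exact hB t (lt_trans one_pos ht)

theorem isCancellingKernel_errorKernel {α : ℝ} (h0 : 0 < α) (h1 : α < 1) :
    ∃ C : ℝ, 0 < C ∧ ∀ lam : ℝ, 0 ≤ lam → IsCancellingKernel α C (errorKernel α lam) := by
  obtain ⟨C, hC, H⟩ := abs_errorKernel_le h0 h1
  refine ⟨C, hC, fun lam hl => ?_⟩
  obtain ⟨s0, hs0, hL, hLe⟩ := laplace_errorKernel h0 h1 hl
  set k := errorKernel α lam with hk
  have hcont : ContinuousOn k (Ioi 0) := continuousOn_errorKernel h0 hl
  have hint : IntegrableOn k (Ioi 0) :=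
    integrableOn_Ioi_of_laplaceAbs hL (by linarith : α - 3 < -1) (H lam hl)
  have hint1 : IntegrableOn (fun t => t * k t) (Ioi 0) := by
    have hn : IntegrableOn (fun t => -t * k t) (Ioi 0) := by
      refine integrableOn_Ioi_of_laplaceAbs hL.mul_neg_id (by linarith : α - 2 < -1) (B := C) ?_
      intro r hr
      rw [abs_mul, abs_neg, abs_of_pos hr, show α - 2 = 1 + (α - 3) by ring, Real.rpow_add hr,
        Real.rpow_one]
      nlinarith [H lam hl r hr]
    simpa using hn.neg
  -- absolute convergence of the Laplace integral on the whole right half-plane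
  have hL0 : LaplaceAbs k 0 := by
    intro s hs
    refine hint.norm.mono' (hint.aestronglyMeasurable.mul (by fun_prop)) ?_
    filter_upwards [ae_restrict_mem measurableSet_Ioi] with t ht
    have ht0 : (0 : ℝ) < t := ht
    rw [norm_mul, Real.norm_of_nonneg (Real.exp_pos _).le]
    refine mul_le_of_le_one_right (norm_nonneg _) (Real.exp_le_one_iff.2 ?_)
    nlinarith [mul_pos hs ht0]
  have hLz : ∀ z : ℂ, 0 < z.re → laplace k z = errorSymbol α lam z := fun z hz =>
    laplace_eq_of_eq_ofReal hL0 (fun w hw => differentiableAt_errorSymbol h0 h1 hl hw) hs0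
      (fun s hs => hLe s (by simpa using hs)) hz
  have hc := sectorConst_pos h0 h1
  set B := 1000 / sectorConst α ^ 2 with hB
  have hsmall : ∀ᶠ x : ℝ in 𝓝[>] 0,
      |∫ t in Ioi (0 : ℝ), k t * Real.exp (-x * t)| ≤ B * x ^ (2 - α) := by
    have : Ioo (0 : ℝ) (sectorConst α / 50) ∈ 𝓝[>] (0 : ℝ) := Ioo_mem_nhdsGT (by positivity)
    filter_upwards [this] with x hx
    have hnx : ‖(x : ℂ)‖ = x := by rw [Complex.norm_real, Real.norm_of_nonneg hx.1.le]
    have := (norm_errorSymbol_le h0 h1 hl (z := x) (z0 := x) (by simpa using hx.1)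
      (by rw [hnx]; exact hx.2.le) (by rw [sub_self, norm_zero]; positivity)).2
    rw [hnx, ← hLz x (by simpa using hx.1)] at this
    rw [← re_laplace_ofReal]
    exact (Complex.abs_re_le_norm _).trans this
  have hz : ∀ p : ℝ, 0 < p → Tendsto (fun x : ℝ => B * x ^ p) (𝓝[>] 0) (𝓝 0) := by
    intro p hp
    have h := ((Real.continuousAt_rpow_const 0 p (Or.inr hp.le)).tendsto.const_mul B)
    rw [Real.zero_rpow hp.ne', mul_zero] at h
    exact h.mono_left nhdsWithin_le_nhds
  have hm0 : ∫ t in Ioi (0 : ℝ), k t = 0 :=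
    tendsto_nhds_unique (tendsto_integral_mul_exp hint)
      (squeeze_zero_norm' hsmall (hz _ (by linarith)))
  have hm1 : -∫ t in Ioi (0 : ℝ), t * k t = 0 := by
    refine tendsto_nhds_unique (tendsto_integral_mul_exp_div hint hint1 hm0)
      (squeeze_zero_norm' (a := fun x => B * x ^ (1 - α)) ?_ (hz _ (by linarith)))
    filter_upwards [hsmall, self_mem_nhdsWithin] with x hx hx'
    have hx0 : (0 : ℝ) < x := hx'
    rw [Real.norm_eq_abs, abs_div, abs_of_pos hx0, div_le_iff₀ hx0, mul_assoc,
      ← Real.rpow_add_one hx0.ne', show 1 - α + 1 = 2 - α by ring]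
    exact hx
  exact ⟨hcont, hint, H lam hl, hint1, hm0, neg_eq_zero.1 hm1⟩

/-- Rescaling a cancelling kernel to the time step `τ` gains the factor `τ²`. -/
theorem IsCancellingKernel.scale {α M : ℝ} {k : ℝ → ℝ} (h : IsCancellingKernel α M k) {τ : ℝ}
    (hτ : 0 < τ) : IsCancellingKernel α (M * τ ^ 2) fun r => τ ^ (α - 1) * k (r / τ) := by
  have hi : ∀ {f : ℝ → ℝ}, IntegrableOn f (Ioi 0) → IntegrableOn (fun r => f (r / τ)) (Ioi 0) := by
    intro f hf
    have := (integrableOn_Ioi_comp_mul_right_iff f 0 (inv_pos.2 hτ)).2 (by simpa using hf)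
    simpa [div_eq_mul_inv] using this
  have he : ∀ f : ℝ → ℝ, ∫ r in Ioi (0 : ℝ), f (r / τ) = τ * ∫ r in Ioi (0 : ℝ), f r := by
    intro f
    have := integral_comp_mul_right_Ioi f 0 (inv_pos.2 hτ)
    simpa [div_eq_mul_inv] using this
  have e1 : ∀ r, r * (τ ^ (α - 1) * k (r / τ)) = τ ^ α * ((r / τ) * k (r / τ)) := by
    intro r
    rw [Real.rpow_sub_one hτ.ne']; field_simp
  refine ⟨?_, (hi h.integrableOn).const_mul _, ?_, ?_, ?_, ?_⟩
  · refine continuousOn_const.mul (h.continuousOn.comp (by fun_prop) fun r hr => ?_)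
    exact div_pos hr hτ
  · intro r hr
    rw [abs_mul, abs_of_pos (by positivity)]
    refine (mul_le_mul_of_nonneg_left (h.bound _ (div_pos hr hτ)) (by positivity)).trans
      (le_of_eq ?_)
    rw [Real.div_rpow hr.le hτ.le, show α - 1 = (α - 3) + 2 by ring, Real.rpow_add hτ,
      Real.rpow_two]
    have : τ ^ (α - 3) ≠ 0 := by positivity
    field_simp
  · simp_rw [e1]
    exact (hi h.integrableOn_mul).const_mul _
  · rw [integral_const_mul, he, h.integral_eq_zero]; simp
  · simp_rw [e1]
    rw [integral_const_mul, he (fun r => r * k r), h.integral_mul_eq_zero]; simp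

theorem exactKernel_scale {α : ℝ} (hα : 0 < α) (lam : ℝ) {τ r : ℝ} (hτ : 0 < τ) (hr : 0 < r) :
    τ ^ (α - 1) * exactKernel α (lam * τ ^ α) (r / τ) = exactKernel α lam r := by
  rw [exactKernel, exactKernel, ← tsum_mul_left]
  congr 1
  ext k
  rw [fracKernel, fracKernel, Real.div_rpow hr.le hτ.le]
  have e : τ ^ (α * ((k : ℝ) + 1) - 1) = (τ ^ α) ^ k * τ ^ (α - 1) := by
    rw [← Real.rpow_natCast, ← Real.rpow_mul hτ.le, ← Real.rpow_add hτ]; ring_nf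
  rw [e, ← neg_mul, mul_pow]
  have h1 : 0 < τ ^ (α - 1) := by positivity
  have h2 : 0 < (τ ^ α) ^ k := by positivity
  field_simp

/-! ### The resolvent equation of the exact kernel -/

theorem abs_exactKernel_le {α : ℝ} (hα : 0 < α) {lam : ℝ} (hl : 0 ≤ lam) (R : ℝ) :
    ∃ C : ℝ, 0 ≤ C ∧ ∀ r : ℝ, 0 < r → r ≤ R → |exactKernel α lam r| ≤ C * r ^ (α - 1) := by
  rcases le_or_gt R 0 with hR | hR
  · exact ⟨0, le_rfl, fun r h1 h2 => absurd (h1.trans_le h2) (not_lt.2 hR)⟩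
  have hs := summable_pow_div_Gamma hα α (x := lam * R ^ α) (by positivity)
  have hG : ∀ k : ℕ, 0 < Real.Gamma (α * k + α) := fun k => Real.Gamma_pos_of_pos (by positivity)
  refine ⟨∑' k : ℕ, (lam * R ^ α) ^ k / Real.Gamma (α * k + α),
    tsum_nonneg fun k => div_nonneg (by positivity) (hG k).le, fun r hr hrR => ?_⟩
  rw [← tsum_mul_right, exactKernel, ← Real.norm_eq_abs]
  refine tsum_of_norm_bounded (hs.mul_right _).hasSum fun k => ?_
  have hpos : 0 < α * ((k : ℝ) + 1) := by positivity
  rw [norm_mul, norm_pow, norm_neg, Real.norm_of_nonneg hl,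
    Real.norm_of_nonneg (fracKernel_nonneg hpos hr.le), fracKernel,
    show α * ((k : ℝ) + 1) = α * k + α by ring]
  have e : r ^ (α * (k : ℝ) + α - 1) = (r ^ α) ^ k * r ^ (α - 1) := by
    rw [← Real.rpow_natCast, ← Real.rpow_mul hr.le, ← Real.rpow_add hr]; ring_nf
  have h1 : (r ^ α) ^ k ≤ (R ^ α) ^ k := by gcongr
  have := hG k
  rw [e]
  calc lam ^ k * ((r ^ α) ^ k * r ^ (α - 1) / Real.Gamma (α * k + α)) ≤
      lam ^ k * ((R ^ α) ^ k * r ^ (α - 1) / Real.Gamma (α * k + α)) := by gcongr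
    _ = _ := by rw [mul_pow]; ring

theorem integrableOn_exactKernel {α : ℝ} (hα : 0 < α) {lam : ℝ} (hl : 0 ≤ lam) (R : ℝ) :
    IntegrableOn (exactKernel α lam) (Ioc 0 R) := by
  obtain ⟨C, hC, h⟩ := abs_exactKernel_le hα hl R
  have h1 : IntegrableOn (fun r : ℝ => C * r ^ (α - 1)) (Ioc 0 R) := by
    rcases le_or_gt R 0 with hR | hR
    · rw [Ioc_eq_empty (not_lt.2 hR)]; exact integrableOn_empty
    · rw [← intervalIntegrable_iff_integrableOn_Ioc_of_le hR.le]
      exact (intervalIntegral.intervalIntegrable_rpow' (by linarith)).const_mul C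
  refine h1.mono' (((continuousOn_exactKernel hα hl).mono Ioc_subset_Ioi_self).aestronglyMeasurable
    measurableSet_Ioc) ?_
  filter_upwards [ae_restrict_mem measurableSet_Ioc] with r hr
  exact h r hr.1 hr.2

/-- Fractional integration of the exact kernel, term by term. -/
theorem hasSum_integral_fracKernel_mul_exactKernel {α β : ℝ} (hα : 0 < α) (hβ : 0 < β) {lam : ℝ}
    (hl : 0 ≤ lam) {t : ℝ} (ht : 0 < t) :
    HasSum (fun k : ℕ => (-lam) ^ k * fracKernel (β + α * (k + 1)) t)
      (∫ s in (0 : ℝ)..t, fracKernel β (t - s) * exactKernel α lam s) := by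
  have hp : ∀ k : ℕ, 0 < α * ((k : ℝ) + 1) := fun k => by positivity
  set F : ℕ → ℝ → ℝ := fun k s =>
    (-lam) ^ k * (fracKernel β (t - s) * fracKernel (α * (k + 1)) s) with hF
  have hi : ∀ k, IntegrableOn (F k) (Ioc 0 t) := fun k => by
    rw [← intervalIntegrable_iff_integrableOn_Ioc_of_le ht.le]
    exact (integral_fracKernel_mul hβ (hp k) ht).1.const_mul _
  have he : ∀ k, ∫ s in Ioc 0 t, F k s = (-lam) ^ k * fracKernel (β + α * (k + 1)) t := fun k => by
    rw [← intervalIntegral.integral_of_le ht.le, intervalIntegral.integral_const_mul,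
      (integral_fracKernel_mul hβ (hp k) ht).2]
  have hn : ∀ k, ∫ s in Ioc 0 t, ‖F k s‖ = lam ^ k * fracKernel (β + α * (k + 1)) t := fun k => by
    rw [← (integral_fracKernel_mul hβ (hp k) ht).2, intervalIntegral.integral_of_le ht.le,
      ← integral_const_mul]
    refine setIntegral_congr_fun measurableSet_Ioc fun s hs => ?_
    simp only [hF]
    rw [norm_mul, norm_pow, norm_neg, Real.norm_of_nonneg hl, Real.norm_of_nonneg
      (mul_nonneg (fracKernel_nonneg hβ (by linarith [hs.2])) (fracKernel_nonneg (hp k) hs.1.le))]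
  have hs : Summable fun k => ∫ s in Ioc 0 t, ‖F k s‖ := by
    simp_rw [hn]
    refine ((summable_pow_div_Gamma hα (β + α) (x := lam * t ^ α) (by positivity)).mul_left
      (t ^ (β + α - 1))).congr fun k => ?_
    have e : t ^ (β + α * ((k : ℝ) + 1) - 1) = (t ^ α) ^ k * t ^ (β + α - 1) := by
      rw [← Real.rpow_natCast, ← Real.rpow_mul ht.le, ← Real.rpow_add ht]; ring_nf
    rw [fracKernel, e, mul_pow, show β + α * ((k : ℝ) + 1) = α * k + (β + α) by ring]
    ring
  have := hasSum_integral_of_summable_integral_norm hi hs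
  simp_rw [he] at this
  have e : (∫ s in (0 : ℝ)..t, fracKernel β (t - s) * exactKernel α lam s) =
      ∫ s in Ioc 0 t, ∑' k, F k s := by
    rw [intervalIntegral.integral_of_le ht.le]
    refine setIntegral_congr_fun measurableSet_Ioc fun s _ => ?_
    simp only [hF, exactKernel]
    rw [← tsum_mul_left]
    congr 1
    ext k
    ring
  rw [e]
  exact this

theorem fracKernel_one (t : ℝ) : fracKernel 1 t = 1 := by
  rw [fracKernel, sub_self, Real.rpow_zero, Real.Gamma_one, div_one]

/-- Termwise integration of the Mittag-Leffler series turns the left hand side into a telescoping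
sum, of which only the first term `1` remains. -/
theorem exactKernel_resolvent {α : ℝ} (h0 : 0 < α) (h1 : α < 1) {lam : ℝ}
    (hl : 0 ≤ lam) {t : ℝ} (ht : 0 < t) :
    (∫ s in (0 : ℝ)..t, fracKernel (1 - α) (t - s) * exactKernel α lam s) +
      lam * ∫ s in (0 : ℝ)..t, exactKernel α lam s = 1 := by
  have a := hasSum_integral_fracKernel_mul_exactKernel h0 (by linarith : 0 < 1 - α) hl ht
  have b := (hasSum_integral_fracKernel_mul_exactKernel h0 one_pos hl ht).mul_left lam
  simp_rw [fracKernel_one, one_mul] at b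
  have a' := (hasSum_nat_add_iff' (f := fun k : ℕ => (-lam) ^ k *
    fracKernel (1 - α + α * (k + 1)) t) 1).2 a
  have := a'.add b
  have hz : (fun k : ℕ => (-lam) ^ (k + 1) * fracKernel (1 - α + α * (((k + 1 : ℕ) : ℝ) + 1)) t +
      lam * ((-lam) ^ k * fracKernel (1 + α * ((k : ℝ) + 1)) t)) = fun _ => 0 := by
    ext k
    rw [show 1 - α + α * (((k + 1 : ℕ) : ℝ) + 1) = 1 + α * ((k : ℝ) + 1) by push_cast; ring]
    ring
  rw [hz] at this
  have h2 := this.unique hasSum_zero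
  simp only [Finset.sum_range_one, pow_zero, CharP.cast_eq_zero, zero_add, mul_one,
    sub_add_cancel, fracKernel_one] at h2
  linarith

/-! ### Representation of the exact solution -/

open scoped Convolution

/-- For functions cut off to `(0, T)` the convolution is the Volterra convolution. -/
theorem convolution_indicator_eq {T t : ℝ} (ht : 0 < t) (htT : t ≤ T) (p q : ℝ → ℝ) :
    ((Ioo 0 T).indicator p ⋆[ContinuousLinearMap.mul ℝ ℝ, volume] (Ioo 0 T).indicator q) t =
      ∫ s in (0 : ℝ)..t, p (t - s) * q s := by
  have e := intervalIntegral.integral_comp_sub_left (a := 0) (b := t) (fun s => p s * q (t - s)) t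
  simp only [sub_sub_cancel, sub_self, sub_zero] at e
  rw [e, convolution_def, intervalIntegral.integral_of_le ht.le, integral_Ioc_eq_integral_Ioo,
    ← integral_indicator measurableSet_Ioo]
  congr 1
  ext s
  simp only [ContinuousLinearMap.mul_apply']
  by_cases hs : s ∈ Ioo 0 t
  · rw [indicator_of_mem hs, indicator_of_mem (show s ∈ Ioo 0 T from ⟨hs.1, hs.2.trans_le htT⟩),
      indicator_of_mem
        (show t - s ∈ Ioo 0 T from ⟨by linarith [hs.2], by linarith [hs.1]⟩)]
  · rw [indicator_of_notMem hs]
    by_cases h0 : 0 < s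
    · have : t ≤ s := le_of_not_gt fun h => hs ⟨h0, h⟩
      rw [indicator_of_notMem (fun h => by linarith [h.1] : t - s ∉ Ioo 0 T), mul_zero]
    · rw [indicator_of_notMem (fun h => h0 h.1), zero_mul]

/-- A convolution with a function vanishing on `(-∞, 0]` is determined at times `t < T` by the
values of the other factor at such times. -/
theorem convolution_congr_of_lt {T t : ℝ} (htT : t < T) (p : ℝ → ℝ) {q r : ℝ → ℝ}
    (h : ∀ s < T, q s = r s) :
    ((Ioo 0 T).indicator p ⋆[ContinuousLinearMap.mul ℝ ℝ, volume] q) t =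
      ((Ioo 0 T).indicator p ⋆[ContinuousLinearMap.mul ℝ ℝ, volume] r) t := by
  rw [convolution_def, convolution_def]
  congr 1
  ext s
  by_cases h0 : 0 < s
  · rw [h _ (by linarith : t - s < T)]
  · rw [indicator_of_notMem (fun h => h0 h.1), map_zero]
    rfl

theorem convolution_indicator_of_nonpos {T t : ℝ} (ht : t ≤ 0) (p q : ℝ → ℝ) :
    ((Ioo 0 T).indicator p ⋆[ContinuousLinearMap.mul ℝ ℝ, volume] (Ioo 0 T).indicator q) t = 0 := by
  rw [convolution_def]
  refine integral_eq_zero_of_ae (ae_of_all _ fun s => ?_)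
  simp only [ContinuousLinearMap.mul_apply', Pi.zero_apply]
  by_cases h0 : 0 < s
  · rw [indicator_of_notMem (fun h => by linarith [h.1] : t - s ∉ Ioo 0 T), mul_zero]
  · rw [indicator_of_notMem (fun h => h0 h.1), zero_mul]

theorem ae_convolution_assoc {p q r : ℝ → ℝ} (hp : Integrable p) (hq : Integrable q)
    (hr : Integrable r) : ∀ᵐ t : ℝ,
    ((p ⋆[ContinuousLinearMap.mul ℝ ℝ, volume] q) ⋆[ContinuousLinearMap.mul ℝ ℝ, volume] r) t =
      (p ⋆[ContinuousLinearMap.mul ℝ ℝ, volume]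
        (q ⋆[ContinuousLinearMap.mul ℝ ℝ, volume] r)) t := by
  have h1 := hp.norm.ae_convolution_exists (ContinuousLinearMap.mul ℝ ℝ)
    (hq.norm.integrable_convolution (ContinuousLinearMap.mul ℝ ℝ) hr.norm)
  filter_upwards [h1] with t ht
  exact convolution_assoc (ContinuousLinearMap.mul ℝ ℝ) (ContinuousLinearMap.mul ℝ ℝ)
    (ContinuousLinearMap.mul ℝ ℝ) (ContinuousLinearMap.mul ℝ ℝ)
    (fun x y z => by simp [mul_assoc]) hp.aestronglyMeasurable hq.aestronglyMeasurable
    hr.aestronglyMeasurable (hp.ae_convolution_exists _ hq)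
    (hq.norm.ae_convolution_exists _ hr.norm) ht

theorem convolution_mul_comm (p q : ℝ → ℝ) :
    (p ⋆[ContinuousLinearMap.mul ℝ ℝ, volume] q) = q ⋆[ContinuousLinearMap.mul ℝ ℝ, volume] p := by
  rw [← convolution_flip, ContinuousLinearMap.flip_mul]

/-- The singularities of the two factors of a Volterra convolution sit at different ends. -/
theorem intervalIntegrable_comp_sub_mul {p q : ℝ → ℝ} {t : ℝ} (ht : 0 < t)
    (hp : IntervalIntegrable p volume 0 t) (hpc : ContinuousOn p (Ioc 0 t))
    (hq : IntervalIntegrable q volume 0 t) (hqc : ContinuousOn q (Ioc 0 t)) :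
    IntervalIntegrable (fun s => p (t - s) * q s) volume 0 t := by
  have hp' : IntervalIntegrable (fun s => p (t - s)) volume 0 t := by
    have := hp.symm.comp_sub_left t
    simpa using this
  have m0 : (0 : ℝ) ∈ uIcc 0 t := left_mem_uIcc
  have m1 : t / 2 ∈ uIcc 0 t := by rw [uIcc_of_le ht.le]; constructor <;> linarith
  have m2 : t ∈ uIcc 0 t := right_mem_uIcc
  refine IntervalIntegrable.trans (b := t / 2) ?_ ?_
  · refine (hq.mono_set (uIcc_subset_uIcc m0 m1)).continuousOn_mul ?_
    rw [uIcc_of_le (by linarith)]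
    refine hpc.comp (by fun_prop) fun s hs => ⟨by linarith [hs.2], by linarith [hs.1]⟩
  · refine (hp'.mono_set (uIcc_subset_uIcc m1 m2)).mul_continuousOn ?_
    rw [uIcc_of_le (by linarith)]
    exact hqc.mono fun s hs => ⟨by linarith [hs.1], hs.2⟩

theorem continuousOn_integral_comp_sub_mul {p q : ℝ → ℝ} {T C D a b : ℝ} (ha : 0 < a) (hb : 0 < b)
    (hpc : ContinuousOn p (Ioc 0 T)) (hqc : ContinuousOn q (Ioc 0 T))
    (hp : ∀ r ∈ Ioc 0 T, |p r| ≤ C * r ^ (a - 1)) (hq : ∀ r ∈ Ioc 0 T, |q r| ≤ D * r ^ (b - 1)) :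
    ContinuousOn (fun t => ∫ s in (0 : ℝ)..t, p (t - s) * q s) (Ioc 0 T) := by
  -- on the unit interval the integrand depends continuously on `t`
  have e : ∀ t ∈ Ioc 0 T, ∫ s in (0 : ℝ)..t, p (t - s) * q s =
      t * ∫ x in (0 : ℝ)..1, p (t * (1 - x)) * q (t * x) := by
    intro t ht
    have := intervalIntegral.mul_integral_comp_mul_left (a := 0) (b := 1)
      (f := fun s => p (t - s) * q s) t
    rw [mul_zero, mul_one] at this
    rw [← this]
    congr 2
    ext x
    congr 2
    ring
  refine ContinuousOn.congr (continuousOn_id.mul ?_) e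
  intro t0 ht0
  have hC : 0 ≤ C := by
    have := (abs_nonneg _).trans (hp t0 ht0)
    exact nonneg_of_mul_nonneg_left this (Real.rpow_pos_of_pos ht0.1 _)
  have hD : 0 ≤ D := by
    have := (abs_nonneg _).trans (hq t0 ht0)
    exact nonneg_of_mul_nonneg_left this (Real.rpow_pos_of_pos ht0.1 _)
  have hmem : ∀ {t x : ℝ}, t ∈ Ioc 0 T → x ∈ Ioo (0 : ℝ) 1 →
      t * (1 - x) ∈ Ioc 0 T ∧ t * x ∈ Ioc 0 T := by
    intro t x ht hx
    have h1 := ht.1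
    have h2 := hx.1
    have h3 : 0 < 1 - x := by linarith [hx.2]
    refine ⟨⟨by positivity, ?_⟩, ⟨by positivity, ?_⟩⟩
    · nlinarith [ht.2]
    · nlinarith [ht.2, hx.2]
  have hne : ∀ᵐ x : ℝ, x ≠ 1 := by simp [ae_iff]
  have hmeas : ∀ t ∈ Ioc 0 T, AEStronglyMeasurable (fun x => p (t * (1 - x)) * q (t * x))
      (volume.restrict (uIoc 0 1)) := by
    intro t ht
    rw [uIoc_of_le zero_le_one, ← restrict_Ioo_eq_restrict_Ioc]
    refine ContinuousOn.aestronglyMeasurable (ContinuousOn.mul ?_ ?_) measurableSet_Ioo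
    · exact hpc.comp (by fun_prop) fun x hx => (hmem ht hx).1
    · exact hqc.comp (by fun_prop) fun x hx => (hmem ht hx).2
  have hlow : ∀ᶠ t in 𝓝[Ioc 0 T] t0, t ∈ Ioc 0 T ∧ t0 / 2 < t := by
    have : Ioi (t0 / 2) ∈ 𝓝 t0 := Ioi_mem_nhds (by linarith [ht0.1])
    exact (eventually_mem_nhdsWithin).and (mem_nhdsWithin_of_mem_nhds this)
  have hpow : ∀ c : ℝ, ∃ B : ℝ, 0 ≤ B ∧ ∀ t : ℝ, t0 / 2 < t → t ≤ T → t ^ c ≤ B := by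
    intro c
    have h2 : 0 < t0 / 2 := by linarith [ht0.1]
    obtain ⟨B, hB⟩ := isCompact_Icc.bddAbove_image (K := Icc (t0 / 2) T) (f := fun t : ℝ => t ^ c)
      fun t ht => (Real.continuousAt_rpow_const _ _
        (Or.inl (by linarith [ht.1] : t ≠ 0))).continuousWithinAt
    refine ⟨max B 0, le_max_right _ _, fun t h3 h4 => le_max_of_le_left ?_⟩
    exact hB ⟨t, ⟨h3.le, h4⟩, rfl⟩
  obtain ⟨B1, hB1, hB1'⟩ := hpow (a - 1)
  obtain ⟨B2, hB2, hB2'⟩ := hpow (b - 1)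
  refine intervalIntegral.continuousWithinAt_of_dominated_interval
    (bound := fun x => C * D * B1 * B2 * ((1 - x) ^ (a - 1) * x ^ (b - 1))) ?_ ?_ ?_ ?_
  · filter_upwards [hlow] with t ht using hmeas t ht.1
  · filter_upwards [hlow] with t ht
    filter_upwards [hne] with x hx1 hx
    rw [uIoc_of_le zero_le_one] at hx
    have hx' : x ∈ Ioo (0 : ℝ) 1 := ⟨hx.1, lt_of_le_of_ne hx.2 hx1⟩
    have h3 : 0 < 1 - x := by linarith [hx'.2]
    have h4 := hx.1
    obtain ⟨m1, m2⟩ := hmem ht.1 hx'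
    rw [norm_mul, Real.norm_eq_abs, Real.norm_eq_abs]
    have n1 := hp _ m1
    have n2 := hq _ m2
    rw [Real.mul_rpow ht.1.1.le h3.le] at n1
    rw [Real.mul_rpow ht.1.1.le h4.le] at n2
    have o1 := hB1' t ht.2 ht.1.2
    have o2 := hB2' t ht.2 ht.1.2
    have q1 : 0 < (1 - x) ^ (a - 1) := by positivity
    have q2 : 0 < x ^ (b - 1) := by positivity
    calc |p (t * (1 - x))| * |q (t * x)| ≤
        (C * (t ^ (a - 1) * (1 - x) ^ (a - 1))) * (D * (t ^ (b - 1) * x ^ (b - 1))) :=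
          mul_le_mul n1 n2 (abs_nonneg _) ((abs_nonneg _).trans n1)
      _ ≤ (C * (B1 * (1 - x) ^ (a - 1))) * (D * (B2 * x ^ (b - 1))) := by
          have := ht.1.1
          gcongr
      _ = _ := by ring
  · exact (integral_rpow_mul_rpow (by linarith) (by linarith) one_pos).1.const_mul _
  · filter_upwards [hne] with x hx1 hx
    rw [uIoc_of_le zero_le_one] at hx
    have hx' : x ∈ Ioo (0 : ℝ) 1 := ⟨hx.1, lt_of_le_of_ne hx.2 hx1⟩
    refine ContinuousWithinAt.mul ?_ ?_
    · exact (hpc _ (hmem ht0 hx').1).comp (f := fun t => t * (1 - x)) (by fun_prop)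
        fun t ht => (hmem ht hx').1
    · exact (hqc _ (hmem ht0 hx').2).comp (f := fun t => t * x) (by fun_prop)
        fun t ht => (hmem ht hx').2

theorem continuousOn_fracKernel (β : ℝ) : ContinuousOn (fracKernel β) (Ioi 0) := fun _ hr =>
  ((Real.continuousAt_rpow_const _ _ (Or.inl (ne_of_gt hr))).div_const _).continuousWithinAt

theorem intervalIntegrable_fracKernel {β : ℝ} (hβ : 0 < β) (a b : ℝ) :
    IntervalIntegrable (fracKernel β) volume a b :=
  (intervalIntegral.intervalIntegrable_rpow' (by linarith)).div_const _

theorem integrable_indicator_Ioo {f : ℝ → ℝ} {T : ℝ} (hT : 0 < T)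
    (hf : IntervalIntegrable f volume 0 T) : Integrable ((Ioo 0 T).indicator f) :=
  ((intervalIntegrable_iff_integrableOn_Ioc_of_le hT.le).1 hf |>.mono_set
    Ioo_subset_Ioc_self).integrable_indicator measurableSet_Ioo

/-- Variation of constants, in integrated form: a solution `u` of the fractional equation has the
same primitive as the convolution of the exact kernel with the source. -/
theorem ae_integral_eq_integral_exactKernel {α lam T : ℝ} (h0 : 0 < α) (h1 : α < 1)
    (hl : 0 ≤ lam) (hT : 0 < T) {u f : ℝ → ℝ} (hu : IntervalIntegrable u volume 0 T)
    (huc : ContinuousOn u (Ioc 0 T)) (hf : IntervalIntegrable f volume 0 T)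
    (heq : ∀ t ∈ Ioc 0 T, (∫ s in (0 : ℝ)..t, fracKernel (1 - α) (t - s) * u s) +
      lam * (∫ s in (0 : ℝ)..t, u s) = ∫ s in (0 : ℝ)..t, f s) :
    IntervalIntegrable (fun t => ∫ s in (0 : ℝ)..t, exactKernel α lam (t - s) * f s) volume 0 T ∧
    ∀ᵐ t : ℝ, t ∈ Ioo 0 T → ∫ s in (0 : ℝ)..t, u s =
      ∫ t in (0 : ℝ)..t, ∫ s in (0 : ℝ)..t, exactKernel α lam (t - s) * f s := by
  set I : (ℝ → ℝ) → ℝ → ℝ := fun f => (Ioo 0 T).indicator f with hI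
  set p : ℝ → ℝ := fun s => fracKernel (1 - α) s + lam with hp
  set o : ℝ → ℝ := fun _ => 1 with ho
  set E := exactKernel α lam with hE
  set v : ℝ → ℝ := fun t => ∫ s in (0 : ℝ)..t, E (t - s) * f s with hv
  have h1α : 0 < 1 - α := by linarith
  have iE : IntervalIntegrable E volume 0 T :=
    (intervalIntegrable_iff_integrableOn_Ioc_of_le hT.le).2 (integrableOn_exactKernel h0 hl T)
  have ip : IntervalIntegrable p volume 0 T :=
    (intervalIntegrable_fracKernel h1α 0 T).add intervalIntegrable_const
  have io : IntervalIntegrable o volume 0 T := intervalIntegrable_const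
  have jE := integrable_indicator_Ioo hT iE
  have jp := integrable_indicator_Ioo hT ip
  have jo := integrable_indicator_Ioo hT io
  have ju := integrable_indicator_Ioo hT hu
  have jf := integrable_indicator_Ioo hT hf
  have hsub : ∀ {t : ℝ}, t ∈ Ioc 0 T → uIcc 0 t ⊆ uIcc 0 T := fun {t} ht => by
    rw [uIcc_of_le ht.1.le, uIcc_of_le hT.le]; exact Icc_subset_Icc le_rfl ht.2
  -- the sum of the two Volterra operators of the equation is one Volterra operator
  have hsplit : ∀ {q : ℝ → ℝ}, IntervalIntegrable q volume 0 T → ContinuousOn q (Ioc 0 T) →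
      ∀ t ∈ Ioc 0 T, ∫ s in (0 : ℝ)..t, p (t - s) * q s =
        (∫ s in (0 : ℝ)..t, fracKernel (1 - α) (t - s) * q s) + lam * ∫ s in (0 : ℝ)..t, q s := by
    intro q hq hqc t ht
    have hq' := hq.mono_set (hsub ht)
    rw [← intervalIntegral.integral_const_mul, ← intervalIntegral.integral_add
      (intervalIntegrable_comp_sub_mul ht.1 (intervalIntegrable_fracKernel h1α 0 t)
        ((continuousOn_fracKernel _).mono Ioc_subset_Ioi_self) hq'
        (hqc.mono (Ioc_subset_Ioc_right ht.2))) (hq'.const_mul lam)]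
    congr 1
    ext s
    rw [hp]
    ring
  have k1 : ∀ t < T, (I p ⋆[ContinuousLinearMap.mul ℝ ℝ, volume] I u) t =
      (I o ⋆[ContinuousLinearMap.mul ℝ ℝ, volume] I f) t := by
    intro t htT
    rcases le_or_gt t 0 with ht | ht
    · rw [convolution_indicator_of_nonpos ht, convolution_indicator_of_nonpos ht]
    · rw [convolution_indicator_eq ht htT.le, convolution_indicator_eq ht htT.le,
        hsplit hu huc t ⟨ht, htT.le⟩, heq t ⟨ht, htT.le⟩]
      simp [ho]
  have k2 : ∀ t < T, (I p ⋆[ContinuousLinearMap.mul ℝ ℝ, volume] I E) t = I o t := by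
    intro t htT
    rcases le_or_gt t 0 with ht | ht
    · rw [convolution_indicator_of_nonpos ht]
      exact (indicator_of_notMem (fun h : t ∈ Ioo 0 T => by linarith [h.1]) o).symm
    · rw [convolution_indicator_eq ht htT.le, hsplit iE
        ((continuousOn_exactKernel h0 hl).mono Ioc_subset_Ioi_self) t ⟨ht, htT.le⟩,
        exactKernel_resolvent h0 h1 hl ht]
      exact (indicator_of_mem (show t ∈ Ioo 0 T from ⟨ht, htT⟩) o).symm
  have k3 : ∀ t < T, (I E ⋆[ContinuousLinearMap.mul ℝ ℝ, volume] I f) t = I v t := by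
    intro t htT
    rcases le_or_gt t 0 with ht | ht
    · rw [convolution_indicator_of_nonpos ht]
      exact (indicator_of_notMem (fun h : t ∈ Ioo 0 T => by linarith [h.1]) v).symm
    · rw [convolution_indicator_eq ht htT.le]
      exact (indicator_of_mem (show t ∈ Ioo 0 T from ⟨ht, htT⟩) v).symm
  constructor
  · rw [intervalIntegrable_iff_integrableOn_Ioo_of_le hT.le]
    refine ((jE.integrable_convolution (ContinuousLinearMap.mul ℝ ℝ) jf).integrableOn
      (s := Ioo 0 T)).congr_fun (fun t ht => ?_) measurableSet_Ioo
    rw [k3 t ht.2]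
    exact indicator_of_mem ht _
  filter_upwards [ae_convolution_assoc ju jp jE, ae_convolution_assoc jE jo jf,
    ae_convolution_assoc jo jE jf] with t a1 a2 a3 ht
  have key : (I u ⋆[ContinuousLinearMap.mul ℝ ℝ, volume] I o) t =
      (I o ⋆[ContinuousLinearMap.mul ℝ ℝ, volume] I v) t := by
    rw [convolution_congr_of_lt ht.2 u (fun s hs => (k2 s hs).symm), ← a1,
      convolution_mul_comm (I u) (I p), convolution_mul_comm _ (I E),
      convolution_congr_of_lt ht.2 E k1, ← a2, convolution_mul_comm (I E) (I o), a3,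
      convolution_congr_of_lt ht.2 o k3]
  rw [convolution_mul_comm, convolution_indicator_eq ht.1 ht.2.le,
    convolution_indicator_eq ht.1 ht.2.le] at key
  simpa [ho] using key

/-- Variation of constants for the fractional equation, with a source of power-type singularity. -/
theorem eq_integral_exactKernel_mul {α lam T : ℝ} (h0 : 0 < α) (h1 : α < 1)
    (hl : 0 ≤ lam) (hT : 0 < T) {u f : ℝ → ℝ} (hu : IntervalIntegrable u volume 0 T)
    (huc : ContinuousOn u (Ioc 0 T)) (hfc : ContinuousOn f (Ioc 0 T)) {D μ : ℝ} (hμ : -1 < μ)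
    (hf : ∀ s ∈ Ioc 0 T, |f s| ≤ D * s ^ μ)
    (heq : ∀ t ∈ Ioc 0 T, (∫ s in (0 : ℝ)..t, fracKernel (1 - α) (t - s) * u s) +
      lam * (∫ s in (0 : ℝ)..t, u s) = ∫ s in (0 : ℝ)..t, f s) :
    ∀ t ∈ Ioc 0 T, u t = ∫ s in (0 : ℝ)..t, exactKernel α lam (t - s) * f s := by
  have hfi : IntervalIntegrable f volume 0 T := by
    rw [intervalIntegrable_iff_integrableOn_Ioc_of_le hT.le]
    have := (intervalIntegral.intervalIntegrable_rpow' (a := 0) (b := T) hμ).const_mul D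
    rw [intervalIntegrable_iff_integrableOn_Ioc_of_le hT.le] at this
    refine this.mono' (hfc.aestronglyMeasurable measurableSet_Ioc) ?_
    filter_upwards [ae_restrict_mem measurableSet_Ioc] with s hs using hf s hs
  obtain ⟨iv, hae⟩ := ae_integral_eq_integral_exactKernel h0 h1 hl hT hu huc hfi heq
  set v : ℝ → ℝ := fun t => ∫ s in (0 : ℝ)..t, exactKernel α lam (t - s) * f s with hv
  obtain ⟨C, hC, hE⟩ := abs_exactKernel_le h0 hl T
  have hvc : ContinuousOn v (Ioc 0 T) := continuousOn_integral_comp_sub_mul h0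
    (by linarith : 0 < μ + 1) ((continuousOn_exactKernel h0 hl).mono Ioc_subset_Ioi_self) hfc
    (fun r hr => hE r hr.1 hr.2) (by simpa using hf)
  have hd : ∀ {w : ℝ → ℝ}, IntervalIntegrable w volume 0 T → ContinuousOn w (Ioc 0 T) →
      ∀ t ∈ Ioo 0 T, HasDerivAt (fun t => ∫ s in (0 : ℝ)..t, w s) (w t) t := by
    intro w hw hwc t ht
    have hc : ContinuousOn w (Ioo 0 T) := hwc.mono Ioo_subset_Ioc_self
    refine intervalIntegral.integral_hasDerivAt_right (hw.mono_set ?_)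
      ⟨Ioo 0 T, Ioo_mem_nhds ht.1 ht.2, hc.aestronglyMeasurable measurableSet_Ioo⟩
      (hc.continuousAt (Ioo_mem_nhds ht.1 ht.2))
    rw [uIcc_of_le ht.1.le, uIcc_of_le hT.le]
    exact Icc_subset_Icc le_rfl ht.2.le
  have hprim : EqOn (fun t => ∫ s in (0 : ℝ)..t, u s) (fun t => ∫ s in (0 : ℝ)..t, v s)
      (Ioo 0 T) := by
    refine Measure.eqOn_open_of_ae_eq (μ := volume) ((ae_restrict_iff' measurableSet_Ioo).2 hae)
      isOpen_Ioo ?_ ?_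
    · exact fun t ht => (hd hu huc t ht).continuousAt.continuousWithinAt
    · exact fun t ht => (hd iv hvc t ht).continuousAt.continuousWithinAt
  have heqo : EqOn u v (Ioo 0 T) := by
    intro t ht
    have e : (fun t => ∫ s in (0 : ℝ)..t, u s) =ᶠ[𝓝 t] fun t => ∫ s in (0 : ℝ)..t, v s :=
      Filter.eventually_of_mem (Ioo_mem_nhds ht.1 ht.2) hprim
    exact (hd hu huc t ht).unique ((hd iv hvc t ht).congr_of_eventuallyEq e)
  refine heqo.of_subset_closure huc hvc Ioo_subset_Ioc_self ?_
  rw [closure_Ioo hT.ne]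
  exact Ioc_subset_Icc_self

/-! ### Representation of the discrete solution -/

open PowerSeries in
theorem coeff_bdfSeries_mul (F : PowerSeries ℝ) (n : ℕ) : coeff n (bdfSeries * F) =
    3 / 2 * coeff n F - 2 * (if 1 ≤ n then coeff (n - 1) F else 0) +
      1 / 2 * (if 2 ≤ n then coeff (n - 2) F else 0) := by
  rw [bdfSeries, add_mul, sub_mul, map_add, map_sub, mul_assoc, mul_assoc, coeff_C_mul,
    coeff_C_mul, coeff_C_mul, coeff_X_pow_mul', ← pow_one (X : PowerSeries ℝ), coeff_X_pow_mul']

open PowerSeries in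
theorem coeff_weightSeries_mul (α : ℝ) (F : PowerSeries ℝ) (n : ℕ) : coeff n (weightSeries α * F) =
    (1 - α / 2) * coeff n F + α / 2 * (if 1 ≤ n then coeff (n - 1) F else 0) := by
  rw [weightSeries, add_mul, map_add, mul_assoc, coeff_C_mul,
    coeff_C_mul, ← pow_one (X : PowerSeries ℝ), coeff_X_pow_mul']

open PowerSeries in
theorem coeff_mul_congr {R : Type*} [CommSemiring R] {F G : PowerSeries R} {n : ℕ}
    (h : ∀ m ≤ n, coeff m F = coeff m G) (H : PowerSeries R) :
    coeff n (H * F) = coeff n (H * G) := by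
  rw [coeff_mul, coeff_mul]
  refine Finset.sum_congr rfl fun x hx => ?_
  rw [h _ (by have := Finset.HasAntidiagonal.mem_antidiagonal.1 hx; omega)]

open PowerSeries in
/-- The generating function of a backward difference. -/
theorem bdf2_eq_coeff {τ : ℝ} (hτ : 0 < τ) {G : ℝ → ℝ} (hG : ∀ t ≤ 0, G t = 0) (n : ℕ) :
    bdf2 τ G (n * τ) = τ⁻¹ * coeff n (bdfSeries * mk fun m => G (m * τ)) := by
  rw [coeff_bdfSeries_mul, bdf2]
  simp only [coeff_mk, smul_eq_mul]
  have e1 : G (n * τ - τ) = if 1 ≤ n then G (((n - 1 : ℕ) : ℝ) * τ) else 0 := by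
    split_ifs with h
    · congr 1; push_cast [h]; ring
    · have : n = 0 := by omega
      subst this
      exact hG _ (by simp [hτ.le])
  have e2 : G (n * τ - 2 * τ) = if 2 ≤ n then G (((n - 2 : ℕ) : ℝ) * τ) else 0 := by
    split_ifs with h
    · congr 1; push_cast [h]; ring
    · refine hG _ ?_
      have : (n : ℝ) ≤ 2 := by exact_mod_cast (by omega : n ≤ 2)
      nlinarith
  rw [e1, e2]

open PowerSeries in
theorem cnApprox_eq_coeff {τ : ℝ} {U : ℤ → ℝ} (hU : ∀ k ≤ 0, U k = 0) (n : ℕ) :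
    cnApprox τ U n = τ⁻¹ * coeff n (bdfSeries * mk fun m => U m) := by
  rw [coeff_bdfSeries_mul, cnApprox]
  simp only [coeff_mk, smul_eq_mul]
  have e1 : U ((n : ℤ) - 1) = if 1 ≤ n then U ((n - 1 : ℕ) : ℤ) else 0 := by
    split_ifs with h
    · congr 1; push_cast [h]; ring
    · exact hU _ (by omega)
  have e2 : U ((n : ℤ) - 2) = if 2 ≤ n then U ((n - 2 : ℕ) : ℤ) else 0 := by
    split_ifs with h
    · congr 1; push_cast [h]; ring
    · exact hU _ (by omega)
  rw [e1, e2]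

open PowerSeries in
/-- The scheme for one eigenvalue, solved by generating functions. -/
theorem cnApprox_eq_sum {α lam τ : ℝ} (h1 : α < 1) (hl : 0 ≤ lam) (hτ : 0 < τ) {N : ℕ}
    {U : ℤ → ℝ} (hU : ∀ k ≤ 0, U k = 0) {G : ℝ → ℝ} (hG : ∀ t ≤ 0, G t = 0)
    (heq : ∀ n : ℕ, 1 ≤ n → n ≤ N →
      τ ^ (-α) * ∑ j ∈ Finset.range (n + 1), glCoeff α j * U ((n : ℤ) - j) +
        lam * ((1 - α / 2) * U n + α / 2 * U ((n : ℤ) - 1)) =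
      (1 - α / 2) * bdf2 τ G (n * τ) + α / 2 * bdf2 τ G (((n : ℝ) - 1) * τ))
    {n : ℕ} (hn : n ≤ N) :
    cnApprox τ U n = τ ^ (α - 2) * ∑ j ∈ Finset.range (n + 1),
      coeff j (solutionSeries α (lam * τ ^ α)) * G (((n : ℝ) - j) * τ) := by
  set Uh : PowerSeries ℝ := mk fun m => U m with hUh
  set Gh : PowerSeries ℝ := mk fun m => G (m * τ) with hGh
  have hl' : 0 ≤ lam * τ ^ α := by positivity
  have hτα : 0 < τ ^ α := by positivity
  have key : ∀ m ≤ N, coeff m (schemeSeries α (lam * τ ^ α) * Uh) =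
      coeff m (C (τ ^ (α - 1)) * (weightSeries α * (bdfSeries * Gh))) := by
    intro m hm
    have hgl : coeff m (glSeries α * Uh) =
        ∑ j ∈ Finset.range (m + 1), glCoeff α j * U ((m : ℤ) - j) := by
      rw [coeff_mul, Finset.Nat.sum_antidiagonal_eq_sum_range_succ
        (f := fun i j => coeff i (glSeries α) * coeff j Uh)]
      refine Finset.sum_congr rfl fun j hj => ?_
      have : j ≤ m := by have := Finset.mem_range.1 hj; omega
      rw [glSeries, hUh, coeff_mk, coeff_mk]
      push_cast [this]
      rfl
    rw [schemeSeries, add_mul, map_add, mul_assoc, coeff_C_mul, hgl, coeff_weightSeries_mul,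
      coeff_C_mul, coeff_weightSeries_mul]
    rcases Nat.eq_zero_or_pos m with rfl | (hm0 : 1 ≤ m)
    · have z1 : G ((0 : ℕ) * τ) = 0 := hG _ (by simp)
      simp only [zero_add, Finset.sum_range_one, coeff_bdfSeries_mul]
      simp [hUh, hGh, hU, hG]
    · have h2 := heq m hm0 hm
      have e1 : U ((m : ℤ) - 1) = U ((m - 1 : ℕ) : ℤ) := by congr 1; push_cast [hm0]; ring
      have e2 : ((m : ℝ) - 1) * τ = ((m - 1 : ℕ) : ℝ) * τ := by push_cast [hm0]; ring
      rw [e1, e2, bdf2_eq_coeff hτ hG, bdf2_eq_coeff hτ hG, Real.rpow_neg hτ.le] at h2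
      rw [if_pos hm0, if_pos hm0, hUh, coeff_mk, coeff_mk, Real.rpow_sub_one hτ.ne']
      have h3 := congrArg (fun x => τ ^ α * x) h2
      rw [mul_add, ← mul_assoc, mul_inv_cancel₀ hτα.ne', one_mul] at h3
      rw [mul_comm lam, mul_assoc (τ ^ α), h3]
      ring
  have h2 : bdfSeries * (schemeSeries α (lam * τ ^ α))⁻¹ *
      (schemeSeries α (lam * τ ^ α) * Uh) = bdfSeries * Uh := by
    have hne : constantCoeff (schemeSeries α (lam * τ ^ α)) ≠ 0 := by
      rw [constantCoeff_schemeSeries]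
      nlinarith
    rw [mul_assoc, ← mul_assoc _⁻¹, PowerSeries.inv_mul_cancel _ hne, one_mul]
  have h3 := coeff_mul_congr (n := n) (fun m hm => key m (hm.trans hn))
    (bdfSeries * (schemeSeries α (lam * τ ^ α))⁻¹)
  have h4 : bdfSeries * (schemeSeries α (lam * τ ^ α))⁻¹ *
      (C (τ ^ (α - 1)) * (weightSeries α * (bdfSeries * Gh))) =
      C (τ ^ (α - 1)) * (solutionSeries α (lam * τ ^ α) * Gh) := by
    rw [solutionSeries]; ring
  rw [h2, h4, coeff_C_mul] at h3
  rw [cnApprox_eq_coeff hU, h3, coeff_mul, Finset.Nat.sum_antidiagonal_eq_sum_range_succ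
    (f := fun i j => coeff i (solutionSeries α (lam * τ ^ α)) * coeff j Gh), ← mul_assoc]
  congr 1
  · rw [← Real.rpow_neg_one, ← Real.rpow_add hτ]; ring_nf
  · refine Finset.sum_congr rfl fun j hj => ?_
    have : j ≤ n := by have := Finset.mem_range.1 hj; omega
    rw [hGh, coeff_mk]
    push_cast [this]
    rfl

/-- An interval integral of a locally integrable function differentiates back to it. -/
theorem ae_deriv_integral_eq {f : ℝ → ℝ} {t : ℝ} (hf : IntervalIntegrable f volume 0 t) :
    ∀ᵐ x : ℝ, x ∈ uIcc 0 t → deriv (fun x => ∫ s in (0 : ℝ)..x, f s) x = f x := by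
  filter_upwards [hf.ae_hasDerivAt_integral] with x hx hxt
  exact (hx hxt 0 left_mem_uIcc).deriv

theorem integral_integral_eq {f : ℝ → ℝ} {t : ℝ} (hf : IntervalIntegrable f volume 0 t) :
    ∫ x in (0 : ℝ)..t, ∫ s in (0 : ℝ)..x, f s = ∫ s in (0 : ℝ)..t, (t - s) * f s := by
  have hF := hf.absolutelyContinuousOnInterval_intervalIntegral (c := 0) left_mem_uIcc
  have hl : AbsolutelyContinuousOnInterval (fun x => t - x) 0 t :=
    ContDiffOn.absolutelyContinuousOnInterval (by fun_prop)
  have key := hl.integral_mul_deriv_eq_deriv_mul hF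
  have hd : ∀ x : ℝ, deriv (fun x => t - x) x = -1 := fun x =>
    ((hasDerivAt_id x).const_sub t).deriv
  simp_rw [hd] at key
  simp only [sub_self, zero_mul, intervalIntegral.integral_same, mul_zero, neg_one_mul,
    intervalIntegral.integral_neg, zero_sub, neg_neg] at key
  rw [← key]
  refine intervalIntegral.integral_congr_ae ?_
  filter_upwards [ae_deriv_integral_eq hf] with x hx hxt
  rw [hx (uIoc_subset_uIcc hxt)]

/-- The discrete solution is a convolution of the source with the discrete kernel. -/
theorem sum_coeff_mul_primitive {α lam τ : ℝ} (hτ : 0 < τ) {n : ℕ} {f : ℝ → ℝ}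
    (hf : IntervalIntegrable f volume 0 (n * τ)) :
    τ ^ (α - 2) * ∑ j ∈ Finset.range (n + 1), PowerSeries.coeff j (solutionSeries α lam) *
      (∫ x in (0 : ℝ)..((n : ℝ) - j) * τ, ∫ s in (0 : ℝ)..x, f s) =
    ∫ s in (0 : ℝ)..n * τ, τ ^ (α - 1) * discreteKernel α lam ((n * τ - s) / τ) * f s := by
  have hnτ : 0 ≤ (n : ℝ) * τ := by positivity
  have hr : ∀ j, IntervalIntegrable (fun s => ramp j ((n * τ - s) / τ) * f s) volume 0 (n * τ) := by
    intro j
    refine hf.continuousOn_mul (Continuous.continuousOn ?_)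
    unfold ramp
    fun_prop
  have hj : ∀ j ∈ Finset.range (n + 1),
      (∫ x in (0 : ℝ)..((n : ℝ) - j) * τ, ∫ s in (0 : ℝ)..x, f s) =
        τ * ∫ s in (0 : ℝ)..n * τ, ramp j ((n * τ - s) / τ) * f s := by
    intro j hj
    have hjn : (j : ℝ) ≤ n := by
      exact_mod_cast (by have := Finset.mem_range.1 hj; omega : j ≤ n)
    set t := ((n : ℝ) - j) * τ with ht
    have ht0 : 0 ≤ t := mul_nonneg (by linarith) hτ.le
    have htn : t ≤ n * τ := by rw [ht]; nlinarith [(Nat.cast_nonneg j : (0 : ℝ) ≤ j)]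
    have hsub : uIcc 0 t ⊆ uIcc 0 (n * τ) := by
      rw [uIcc_of_le ht0, uIcc_of_le hnτ]; exact Icc_subset_Icc le_rfl htn
    have hsub' : uIcc t (n * τ) ⊆ uIcc 0 (n * τ) := by
      rw [uIcc_of_le htn, uIcc_of_le hnτ]; exact Icc_subset_Icc ht0 le_rfl
    rw [integral_integral_eq (hf.mono_set hsub), ← intervalIntegral.integral_const_mul,
      ← intervalIntegral.integral_add_adjacent_intervals
        (((hr j).const_mul τ).mono_set hsub) (((hr j).const_mul τ).mono_set hsub')]
    have e : ∀ s, (n * τ - s) / τ - j = (t - s) / τ := by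
      intro s; rw [ht]; field_simp; ring
    have z : ∫ s in t..n * τ, τ * (ramp j ((n * τ - s) / τ) * f s) = 0 := by
      rw [intervalIntegral.integral_congr (g := fun _ => 0), intervalIntegral.integral_zero]
      intro s hs
      rw [uIcc_of_le htn] at hs
      simp only [ramp, e]
      rw [max_eq_right (div_nonpos_of_nonpos_of_nonneg (by linarith [hs.1]) hτ.le)]
      ring
    rw [z, add_zero]
    refine intervalIntegral.integral_congr fun s hs => ?_
    rw [uIcc_of_le ht0] at hs
    simp only [ramp, e]
    rw [max_eq_left (div_nonneg (by linarith [hs.2]) hτ.le)]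
    field_simp
  rw [Finset.sum_congr rfl fun j h => by rw [hj j h]]
  have e2 : ∀ s ∈ uIcc 0 (n * τ), τ ^ (α - 1) * discreteKernel α lam ((n * τ - s) / τ) * f s =
      ∑ j ∈ Finset.range (n + 1), τ ^ (α - 1) * (PowerSeries.coeff j (solutionSeries α lam) *
        (ramp j ((n * τ - s) / τ) * f s)) := by
    intro s hs
    rw [uIcc_of_le hnτ] at hs
    rw [discreteKernel_eq_sum α lam (n := n + 1), Finset.mul_sum, Finset.sum_mul]
    · refine Finset.sum_congr rfl fun j _ => by ring
    · rw [div_le_iff₀ hτ]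
      push_cast
      nlinarith [hs.1]
  rw [intervalIntegral.integral_congr e2, intervalIntegral.integral_finsetSum
    fun j _ => ((hr j).const_mul _).const_mul _, Finset.mul_sum]
  refine Finset.sum_congr rfl fun j _ => ?_
  rw [intervalIntegral.integral_const_mul, intervalIntegral.integral_const_mul]
  rw [show α - 1 = α - 2 + 1 by ring, Real.rpow_add_one hτ.ne']
  ring

/-! ### The error for one eigenvalue -/

theorem continuousOn_rpow_Ioi (p : ℝ) : ContinuousOn (fun s : ℝ => s ^ p) (Ioi 0) := fun _ hs =>
  (Real.continuousAt_rpow_const _ _ (Or.inl (ne_of_gt hs))).continuousWithinAt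

/-- For a single eigenvalue the error of the scheme is the convolution of the source with the
rescaled error kernel. -/
theorem error_eq_integral_errorKernel {α lam τ T : ℝ} (h0 : 0 < α) (h1 : α < 1) (hl : 0 ≤ lam)
    (hτ : 0 < τ) {N : ℕ} (hT : T = N * τ) {μ D : ℝ} (hμ : -1 < μ) {u f : ℝ → ℝ}
    (hu : IntervalIntegrable u volume 0 T) (huc : ContinuousOn u (Ioc 0 T))
    (hfc : ContinuousOn f (Ioc 0 T)) (hf : ∀ s ∈ Ioc 0 T, |f s| ≤ D * s ^ μ)
    (hf0 : ∀ s ≤ 0, f s = 0)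
    (heq : ∀ t ∈ Ioc 0 T, (∫ s in (0 : ℝ)..t, fracKernel (1 - α) (t - s) * u s) +
      lam * (∫ s in (0 : ℝ)..t, u s) = ∫ s in (0 : ℝ)..t, f s)
    {U : ℤ → ℝ} (hU : ∀ k ≤ 0, U k = 0)
    (hUeq : ∀ n : ℕ, 1 ≤ n → n ≤ N →
      τ ^ (-α) * ∑ j ∈ Finset.range (n + 1), glCoeff α j * U ((n : ℤ) - j) +
        lam * ((1 - α / 2) * U n + α / 2 * U ((n : ℤ) - 1)) =
      (1 - α / 2) * bdf2 τ (primitive (primitive f)) (n * τ) +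
        α / 2 * bdf2 τ (primitive (primitive f)) (((n : ℝ) - 1) * τ))
    {n : ℕ} (hn0 : 1 ≤ n) (hn : n ≤ N) :
    u (n * τ) - cnApprox τ U n = ∫ s in (0 : ℝ)..n * τ,
      τ ^ (α - 1) * errorKernel α (lam * τ ^ α) ((n * τ - s) / τ) * f s := by
  have hn0' : (0 : ℝ) < n := by exact_mod_cast hn0
  have hNn : (n : ℝ) ≤ N := by exact_mod_cast hn
  set t := (n : ℝ) * τ with ht
  have ht0 : 0 < t := by positivity
  have htT : t ≤ T := by rw [hT, ht]; gcongr
  have hT0 : 0 < T := ht0.trans_le htT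
  have hfi : IntervalIntegrable f volume 0 T := by
    rw [intervalIntegrable_iff_integrableOn_Ioc_of_le hT0.le]
    have := (intervalIntegral.intervalIntegrable_rpow' (a := 0) (b := T) hμ).const_mul D
    rw [intervalIntegrable_iff_integrableOn_Ioc_of_le hT0.le] at this
    refine this.mono' (hfc.aestronglyMeasurable measurableSet_Ioc) ?_
    filter_upwards [ae_restrict_mem measurableSet_Ioc] with s hs using hf s hs
  have hfi' : IntervalIntegrable f volume 0 t := hfi.mono_set (by
    rw [uIcc_of_le ht0.le, uIcc_of_le hT0.le]; exact Icc_subset_Icc le_rfl htT)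
  have hfc' : ContinuousOn f (Ioc 0 t) := hfc.mono (Ioc_subset_Ioc_right htT)
  -- the source vanishes for negative times, and with it its primitives
  have hz1 : ∀ x ≤ 0, primitive f x = 0 := fun x hx => by
    rw [primitive, intervalIntegral.integral_congr (g := fun _ => 0),
      intervalIntegral.integral_zero]
    intro s hs
    rw [uIcc_of_ge hx] at hs
    exact hf0 s hs.2
  have hz2 : ∀ x ≤ 0, primitive (primitive f) x = 0 := fun x hx => by
    rw [primitive, intervalIntegral.integral_congr (g := fun _ => 0),
      intervalIntegral.integral_zero]
    intro s hs
    rw [uIcc_of_ge hx] at hs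
    exact hz1 s hs.2
  rw [eq_integral_exactKernel_mul h0 h1 hl hT0 hu huc hfc hμ hf heq t ⟨ht0, htT⟩,
    cnApprox_eq_sum h1 hl hτ hU hz2 hUeq hn]
  have e : ∀ x, primitive (primitive f) x = ∫ x in (0 : ℝ)..x, ∫ s in (0 : ℝ)..x, f s :=
    fun x => rfl
  simp_rw [e]
  have iE : IntervalIntegrable (exactKernel α lam) volume 0 t :=
    (intervalIntegrable_iff_integrableOn_Ioc_of_le ht0.le).2 (integrableOn_exactKernel h0 hl t)
  have i1 := intervalIntegrable_comp_sub_mul ht0 iE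
    ((continuousOn_exactKernel h0 hl).mono Ioc_subset_Ioi_self) hfi' hfc'
  have i2 : IntervalIntegrable (fun s => τ ^ (α - 1) *
      discreteKernel α (lam * τ ^ α) ((t - s) / τ) * f s) volume 0 t := by
    refine hfi'.continuousOn_mul (Continuous.continuousOn ?_)
    have := continuous_discreteKernel α (lam * τ ^ α)
    fun_prop
  rw [sum_coeff_mul_primitive hτ hfi', ← intervalIntegral.integral_sub i1 i2]
  refine intervalIntegral.integral_congr_ae ?_
  have hne : ∀ᵐ s : ℝ, s ≠ t := by simp [ae_iff]
  filter_upwards [hne] with s hst hs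
  rw [uIoc_of_le ht0.le] at hs
  have hpos : 0 < t - s := by
    have := lt_of_le_of_ne hs.2 hst; linarith
  rw [← exactKernel_scale h0 lam hτ hpos, errorKernel]
  ring

namespace IsCancellingKernel

variable {α M : ℝ} {k : ℝ → ℝ}

theorem intervalIntegrable_mul_rpow (h : IsCancellingKernel α M k) {p t : ℝ} (hp : -1 < p)
    (ht : 0 < t) : IntervalIntegrable (fun s => k (t - s) * s ^ p) volume 0 t :=
  intervalIntegrable_comp_sub_mul ht (h.intervalIntegrable ht.le)
    (h.continuousOn.mono Ioc_subset_Ioi_self) (intervalIntegral.intervalIntegrable_rpow' hp)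
    ((continuousOn_rpow_Ioi p).mono Ioc_subset_Ioi_self)

/-- The Peano kernel of the convolution with `k`: its effect on the source with
second derivative concentrated at `ζ`. -/
noncomputable def peano (k : ℝ → ℝ) (μ t ζ : ℝ) : ℝ :=
  ∫ s in ζ..t, k (t - s) * (s ^ μ * (s - ζ))

/-- Insertion of the Taylor expansion of the smooth factor of the source. -/
theorem integral_mul_taylor (h : IsCancellingKernel α M k) {μ t : ℝ} (hμ : -1 < μ) (ht : 0 < t)
    {γ γ₂ : ℝ → ℝ} {γ₀ γ₁ : ℝ} (hγ₂ : IntervalIntegrable γ₂ volume 0 t)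
    (hγ : ∀ s ∈ Ioc 0 t, γ s = γ₀ + s * γ₁ + ∫ ζ in (0 : ℝ)..s, (s - ζ) * γ₂ ζ) :
    IntervalIntegrable (fun ζ => peano k μ t ζ * γ₂ ζ) volume 0 t ∧
    ∫ s in (0 : ℝ)..t, k (t - s) * (s ^ μ * γ s) =
      (∫ s in (0 : ℝ)..t, k (t - s) * s ^ μ) * γ₀ +
      (∫ s in (0 : ℝ)..t, k (t - s) * s ^ (μ + 1)) * γ₁ +
      ∫ ζ in (0 : ℝ)..t, peano k μ t ζ * γ₂ ζ := by
  set ν : Measure ℝ := volume.restrict (Ioc 0 t) with hν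
  set F : ℝ → ℝ → ℝ := fun s ζ => k (t - s) * s ^ μ * (max (s - ζ) 0 * γ₂ ζ) with hF
  have i0 := h.intervalIntegrable_mul_rpow hμ ht
  have i1 := h.intervalIntegrable_mul_rpow (by linarith : -1 < μ + 1) ht
  have i0' : Integrable (fun s => k (t - s) * s ^ μ) ν :=
    (intervalIntegrable_iff_integrableOn_Ioc_of_le ht.le).1 i0
  have i2' : Integrable γ₂ ν := (intervalIntegrable_iff_integrableOn_Ioc_of_le ht.le).1 hγ₂
  have hprod : Integrable (Function.uncurry F) (ν.prod ν) := by
    have hb := (i0'.mul_prod i2')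
    have := hb.bdd_mul (c := t) (f := fun x : ℝ × ℝ => max (x.1 - x.2) 0)
      (by fun_prop) (by
        rw [hν, Measure.prod_restrict]
        filter_upwards [ae_restrict_mem (measurableSet_Ioc.prod measurableSet_Ioc)] with x hx
        rw [Real.norm_of_nonneg (le_max_right _ _)]
        exact max_le (by linarith [hx.1.2, hx.2.1]) ht.le)
    refine this.congr (ae_of_all _ fun x => ?_)
    simp only [hF, Function.uncurry]
    ring
  have hinner : ∀ s ∈ Ioc 0 t, ∫ ζ, F s ζ ∂ν =
      k (t - s) * s ^ μ * ∫ ζ in (0 : ℝ)..s, (s - ζ) * γ₂ ζ := by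
    intro s hs
    rw [hF, integral_const_mul, intervalIntegral.integral_of_le hs.1.le, hν]
    congr 1
    refine (setIntegral_eq_of_subset_of_forall_sdiff_eq_zero measurableSet_Ioc
      (Ioc_subset_Ioc_right hs.2) ?_).trans
      (setIntegral_congr_fun measurableSet_Ioc fun ζ hζ => ?_)
    rotate_left
    · rw [max_eq_left (by linarith [hζ.2])]
    · intro ζ hζ
      have : s ≤ ζ := by
        by_contra hc
        exact hζ.2 ⟨hζ.1.1, (not_le.1 hc).le⟩
      rw [max_eq_right (by linarith), zero_mul]
  have houter : ∀ ζ ∈ Ioc 0 t, ∫ s, F s ζ ∂ν = peano k μ t ζ * γ₂ ζ := by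
    intro ζ hζ
    rw [peano, intervalIntegral.integral_of_le hζ.2, ← integral_mul_const, hν]
    refine (setIntegral_eq_of_subset_of_forall_sdiff_eq_zero measurableSet_Ioc
      (Ioc_subset_Ioc_left hζ.1.le) ?_).trans
      (setIntegral_congr_fun measurableSet_Ioc fun s hs => ?_)
    rotate_left
    · simp only [hF]
      rw [max_eq_left (by linarith [hs.1])]
      ring
    · intro s hs
      have : s ≤ ζ := by
        by_contra hc
        exact hs.2 ⟨not_le.1 hc, hs.1.2⟩
      simp only [hF]
      rw [max_eq_right (by linarith), zero_mul, mul_zero]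
  have j1 : IntervalIntegrable (fun ζ => peano k μ t ζ * γ₂ ζ) volume 0 t := by
    rw [intervalIntegrable_iff_integrableOn_Ioc_of_le ht.le]
    refine hprod.integral_prod_right.congr ?_
    filter_upwards [ae_restrict_mem measurableSet_Ioc] with ζ hζ using houter ζ hζ
  have j2 : IntervalIntegrable (fun s => k (t - s) * s ^ μ * ∫ ζ in (0 : ℝ)..s, (s - ζ) * γ₂ ζ)
      volume 0 t := by
    rw [intervalIntegrable_iff_integrableOn_Ioc_of_le ht.le]
    refine hprod.integral_prod_left.congr ?_
    filter_upwards [ae_restrict_mem measurableSet_Ioc] with s hs using hinner s hs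
  refine ⟨j1, ?_⟩
  have e : ∫ s in (0 : ℝ)..t, k (t - s) * (s ^ μ * γ s) =
      ∫ s in (0 : ℝ)..t, ((k (t - s) * s ^ μ * γ₀ + k (t - s) * s ^ (μ + 1) * γ₁) +
        k (t - s) * s ^ μ * ∫ ζ in (0 : ℝ)..s, (s - ζ) * γ₂ ζ) := by
    refine intervalIntegral.integral_congr_ae (ae_of_all _ fun s hs => ?_)
    rw [uIoc_of_le ht.le] at hs
    rw [hγ s hs, Real.rpow_add_one hs.1.ne']
    ring
  rw [e, intervalIntegral.integral_add ((i0.mul_const _).add (i1.mul_const _)) j2,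
    intervalIntegral.integral_add (i0.mul_const _) (i1.mul_const _),
    intervalIntegral.integral_mul_const, intervalIntegral.integral_mul_const]
  congr 1
  rw [intervalIntegral.integral_of_le ht.le, intervalIntegral.integral_of_le ht.le,
    ← setIntegral_congr_fun measurableSet_Ioc hinner,
    ← setIntegral_congr_fun measurableSet_Ioc houter]
  exact integral_integral_swap hprod

end IsCancellingKernel

/-! ### Weak derivatives and the Taylor formula -/

/-- A compactly supported smooth function of mean zero has a compactly supported primitive. -/
theorem exists_primitive_of_integral_eq_zero {η : ℝ → ℝ} {T : ℝ} (hη : ContDiff ℝ ∞ η)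
    (hc : HasCompactSupport η) (hs : tsupport η ⊆ Ioo 0 T) (h0 : ∫ t, η t = 0) :
    ∃ φ : ℝ → ℝ, ContDiff ℝ ∞ φ ∧ HasCompactSupport φ ∧ tsupport φ ⊆ Ioo 0 T ∧
      ∀ t, deriv φ t = η t := by
  have hd : ∀ t, HasDerivAt (fun t => ∫ s in (0 : ℝ)..t, η s) (η t) t := fun t =>
    (hη.continuous.integral_hasStrictDerivAt 0 t).hasDerivAt
  have hderiv : deriv (fun t => ∫ s in (0 : ℝ)..t, η s) = η := funext fun t => (hd t).deriv
  obtain ⟨a, b, ha, hb, hab⟩ : ∃ a b : ℝ, 0 < a ∧ b < T ∧ tsupport η ⊆ Icc a b := by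
    rcases (tsupport η).eq_empty_or_nonempty with he | hne
    · exact ⟨1, T - 1, one_pos, by linarith, by rw [he]; exact empty_subset _⟩
    · obtain ⟨a, ha, ha'⟩ := hc.exists_isMinOn hne continuousOn_id
      obtain ⟨b, hb, hb'⟩ := hc.exists_isMaxOn hne continuousOn_id
      exact ⟨a, b, (hs ha).1, (hs hb).2, fun x hx => ⟨ha' hx, hb' hx⟩⟩
  have hz : ∀ t, t ∉ Icc a b → η t = 0 := fun t ht =>
    image_eq_zero_of_notMem_tsupport fun h => ht (hab h)
  have hsub : tsupport (fun t => ∫ s in (0 : ℝ)..t, η s) ⊆ Icc a b := by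
    refine closure_minimal (fun t ht => ?_) isClosed_Icc
    by_contra hcon
    refine ht ?_
    rcases lt_or_ge t a with h1 | h1
    · simp only
      rw [intervalIntegral.integral_congr (g := fun _ => 0), intervalIntegral.integral_zero]
      intro s hs'
      refine hz s fun h => ?_
      rcases le_total 0 t with h2 | h2
      · rw [uIcc_of_le h2] at hs'; linarith [hs'.2, h.1]
      · rw [uIcc_of_ge h2] at hs'; linarith [hs'.2, h.1]
    · have h2 : b < t := by
        by_contra h; exact hcon ⟨h1, not_lt.1 h⟩
      simp only
      rw [intervalIntegral.integral_of_le (by linarith), setIntegral_eq_integral_of_forall_compl_eq_zero,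
        h0]
      intro s hs'
      refine hz s fun h => hs' ⟨by linarith [h.1], by linarith [h.2]⟩
  refine ⟨_, ?_, HasCompactSupport.of_support_subset_isCompact (isCompact_Icc (a := a) (b := b))
    ((subset_tsupport _).trans hsub), hsub.trans fun t ht => ⟨ha.trans_le ht.1, ht.2.trans_lt hb⟩,
    fun t => (hd t).deriv⟩
  rw [contDiff_infty_iff_deriv]
  exact ⟨fun t => (hd t).differentiableAt, by rwa [hderiv]⟩

/-- The lemma of du Bois-Reymond. -/
theorem eq_of_integral_deriv_mul_eq_zero {w : ℝ → ℝ} {T : ℝ} (hT : 0 < T)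
    (hw : ContinuousOn w (Icc 0 T))
    (h : ∀ φ : ℝ → ℝ, ContDiff ℝ ∞ φ → HasCompactSupport φ → tsupport φ ⊆ Ioo 0 T →
      ∫ t in Ioo 0 T, deriv φ t * w t = 0) {s : ℝ} (hs : s ∈ Icc 0 T) : w s = w 0 := by
  have hi : IntegrableOn w (Ioo 0 T) := hw.integrableOn_Icc.mono_set Ioo_subset_Icc_self
  set b : ContDiffBump (T / 2) := ⟨T / 8, T / 4, by positivity, by linarith⟩ with hb
  set ρ : ℝ → ℝ := b.normed volume with hρ
  have hρd : ContDiff ℝ ∞ ρ := b.contDiff_normed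
  have hρc : HasCompactSupport ρ := b.hasCompactSupport_normed
  have hρs : tsupport ρ ⊆ Ioo 0 T := by
    rw [hρ, b.tsupport_normed_eq, Real.closedBall_eq_Icc]
    intro t ht
    have h1 : T / 2 - T / 4 ≤ t := ht.1
    have h2 : t ≤ T / 2 + T / 4 := ht.2
    constructor <;> linarith
  have hρ1 : ∫ t, ρ t = 1 := b.integral_normed
  have hmul : ∀ {ψ : ℝ → ℝ}, Continuous ψ → HasCompactSupport ψ →
      IntegrableOn (fun t => ψ t * w t) (Ioo 0 T) := by
    intro ψ hψ hψc
    obtain ⟨C, hC⟩ := hψc.exists_bound_of_continuous hψ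
    exact hi.bdd_mul hψ.aestronglyMeasurable (ae_of_all _ hC)
  set c := ∫ t in Ioo 0 T, ρ t * w t with hc
  have hae : ∀ᵐ t : ℝ, t ∈ Ioo 0 T → w t - c = 0 := by
    refine isOpen_Ioo.ae_eq_zero_of_integral_contDiff_smul_eq_zero
      (f := fun t => w t - c)
      ((hi.sub (integrableOn_const (by simp))).locallyIntegrableOn) fun ψ hψ hψc hψs => ?_
    set m := ∫ t, ψ t with hm
    obtain ⟨φ, hφ, hφc, hφs, hφd⟩ := exists_primitive_of_integral_eq_zero (T := T)
      (η := fun t => ψ t - m * ρ t) (hψ.sub (contDiff_const.mul hρd))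
      (hψc.sub (hρc.mul_left (f := fun _ => m)))
      ((tsupport_sub ψ fun t => m * ρ t).trans (union_subset hψs
        ((tsupport_mul_subset_right (f := fun _ => m) (g := ρ)).trans hρs)))
      (by
        rw [integral_sub (hψ.continuous.integrable_of_hasCompactSupport hψc)
          ((hρd.continuous.integrable_of_hasCompactSupport hρc).const_mul m), integral_const_mul,
          hρ1, mul_one, sub_self])
    have key := h φ hφ hφc hφs
    have iψ := hmul hψ.continuous hψc
    have iρ := hmul hρd.continuous hρc
    simp_rw [hφd, sub_mul, mul_assoc] at key
    rw [integral_sub iψ (iρ.const_mul m), integral_const_mul] at key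
    have hψT : ∫ t in Ioo 0 T, ψ t = m :=
      setIntegral_eq_integral_of_forall_compl_eq_zero fun t ht =>
        image_eq_zero_of_notMem_tsupport fun h => ht (hψs h)
    have e : ∫ t, ψ t • (w t - c) = ∫ t in Ioo 0 T, ψ t * (w t - c) := by
      refine (setIntegral_eq_integral_of_forall_compl_eq_zero fun t ht => ?_).symm
      rw [image_eq_zero_of_notMem_tsupport fun h => ht (hψs h), zero_smul]
    simp_rw [e, mul_sub]
    rw [integral_sub iψ ((hψ.continuous.integrable_of_hasCompactSupport hψc).integrableOn.mul_const
      c), integral_mul_const, hψT]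
    linarith
  have heq : EqOn w (fun _ => c) (Ioo 0 T) := by
    refine Measure.eqOn_open_of_ae_eq (μ := volume) ((ae_restrict_iff' measurableSet_Ioo).2 ?_)
      isOpen_Ioo (hw.mono Ioo_subset_Icc_self) continuousOn_const
    filter_upwards [hae] with t ht h using sub_eq_zero.1 (ht h)
  have heq' : EqOn w (fun _ => c) (Icc 0 T) :=
    heq.of_subset_closure hw continuousOn_const Ioo_subset_Icc_self (by rw [closure_Ioo hT.ne])
  rw [heq' hs, heq' (left_mem_Icc.2 hT.le)]

/-- The fundamental theorem of calculus for weak derivatives. -/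
theorem eq_add_integral_of_hasWeakDeriv {h h' : ℝ → ℝ} {T : ℝ} (hT : 0 < T)
    (hh : ContinuousOn h (Icc 0 T)) (hh' : IntervalIntegrable h' volume 0 T)
    (hw : HasWeakDeriv T h h') {s : ℝ} (hs : s ∈ Icc 0 T) :
    h s = h 0 + ∫ t in (0 : ℝ)..s, h' t := by
  set H : ℝ → ℝ := fun x => ∫ t in (0 : ℝ)..x, h' t with hH
  have hHc : ContinuousOn H (Icc 0 T) := by
    have := intervalIntegral.continuousOn_primitive_interval' hh' left_mem_uIcc
    rwa [uIcc_of_le hT.le] at this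
  have hHac := hh'.absolutelyContinuousOnInterval_intervalIntegral (c := 0) left_mem_uIcc
  have key := eq_of_integral_deriv_mul_eq_zero hT (hh.sub hHc) (fun φ hφ hφc hφs => by
    have hφ0 : ∀ t, t ∉ Ioo 0 T → φ t = 0 := fun t ht =>
      image_eq_zero_of_notMem_tsupport fun h => ht (hφs h)
    have hφac : AbsolutelyContinuousOnInterval φ 0 T :=
      ContDiffOn.absolutelyContinuousOnInterval (hφ.contDiffOn.of_le (by simp))
    have ibp := hφac.integral_mul_deriv_eq_deriv_mul hHac
    rw [hφ0 T (by simp), hφ0 0 (by simp), zero_mul, zero_mul, sub_zero, zero_sub] at ibp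
    have e1 : ∫ x in (0 : ℝ)..T, φ x * deriv H x = ∫ x in (0 : ℝ)..T, φ x * h' x := by
      refine intervalIntegral.integral_congr_ae ?_
      filter_upwards [ae_deriv_integral_eq hh'] with x hx hxt
      rw [hx (uIoc_subset_uIcc hxt)]
    rw [e1, intervalIntegral.integral_of_le hT.le, intervalIntegral.integral_of_le hT.le,
      integral_Ioc_eq_integral_Ioo, integral_Ioc_eq_integral_Ioo] at ibp
    have hw' := hw.2.2 φ hφ hφc hφs
    simp only [smul_eq_mul] at hw'
    have hdc : Continuous (deriv φ) := hφ.continuous_deriv (by simp)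
    have hi : ∀ {v : ℝ → ℝ}, ContinuousOn v (Icc 0 T) →
        IntegrableOn (fun t => deriv φ t * v t) (Ioo 0 T) := fun hv =>
      (hdc.continuousOn.mul hv).integrableOn_Icc.mono_set Ioo_subset_Icc_self
    simp_rw [Pi.sub_apply, mul_sub]
    rw [integral_sub (hi hh) (hi hHc), hw', ibp]
    ring) hs
  simp only [Pi.sub_apply, hH, intervalIntegral.integral_same, sub_zero] at key
  linarith

theorem eq_taylor_of_hasWeakDeriv {h h' h'' : ℝ → ℝ} {T : ℝ} (hT : 0 < T)
    (hh : ContinuousOn h (Icc 0 T)) (hh' : ContinuousOn h' (Icc 0 T))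
    (hh'' : IntervalIntegrable h'' volume 0 T) (hw : HasWeakDeriv T h h')
    (hw' : HasWeakDeriv T h' h'') {s : ℝ} (hs : s ∈ Icc 0 T) :
    h s = h 0 + s * h' 0 + ∫ ζ in (0 : ℝ)..s, (s - ζ) * h'' ζ := by
  have hi' : IntervalIntegrable h' volume 0 T :=
    ContinuousOn.intervalIntegrable (by rwa [uIcc_of_le hT.le])
  have hi : IntervalIntegrable h'' volume 0 s := hh''.mono_set (by
    rw [uIcc_of_le hs.1, uIcc_of_le hT.le]; exact Icc_subset_Icc le_rfl hs.2)
  rw [eq_add_integral_of_hasWeakDeriv hT hh hi' hw hs, ← integral_integral_eq hi]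
  have e : ∫ t in (0 : ℝ)..s, h' t = ∫ t in (0 : ℝ)..s, (h' 0 + ∫ x in (0 : ℝ)..t, h'' x) := by
    refine intervalIntegral.integral_congr fun t ht => ?_
    rw [uIcc_of_le hs.1] at ht
    exact eq_add_integral_of_hasWeakDeriv hT hh' hh'' hw' ⟨ht.1, ht.2.trans hs.2⟩
  have hc := intervalIntegral.continuousOn_primitive_interval' hi left_mem_uIcc
  rw [e, intervalIntegral.integral_add intervalIntegrable_const hc.intervalIntegrable,
    intervalIntegral.integral_const, smul_eq_mul, sub_zero, ← add_assoc]

/-- Weak derivatives pass to the components of a vector valued function. -/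
theorem HasWeakDeriv.inner_right {H : Type*} [NormedAddCommGroup H] [InnerProductSpace ℝ H]
    [CompleteSpace H] {g g' : ℝ → H} {T : ℝ} (hw : HasWeakDeriv T g g')
    (hg : IntegrableOn g (Ioo 0 T)) (hg' : IntegrableOn g' (Ioo 0 T)) (x : H) :
    HasWeakDeriv T (fun t => inner ℝ x (g t)) (fun t => inner ℝ x (g' t)) := by
  refine ⟨IntegrableOn.locallyIntegrableOn (Integrable.const_inner x hg),
    IntegrableOn.locallyIntegrableOn (Integrable.const_inner x hg'),
    fun φ hφ hφc hφs => ?_⟩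
  have hdc : Continuous (deriv φ) := hφ.continuous_deriv (by simp)
  obtain ⟨C, hC⟩ := hφc.exists_bound_of_continuous hφ.continuous
  obtain ⟨D, hD⟩ := hφc.deriv.exists_bound_of_continuous hdc
  have i1 : IntegrableOn (fun t => deriv φ t • g t) (Ioo 0 T) :=
    hg.bdd_smul D hdc.aestronglyMeasurable (ae_of_all _ hD)
  have i2 : IntegrableOn (fun t => φ t • g' t) (Ioo 0 T) :=
    hg'.bdd_smul C hφ.continuous.aestronglyMeasurable (ae_of_all _ hC)
  have key := congrArg (inner ℝ x) (hw.2.2 φ hφ hφc hφs)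
  rw [inner_neg_right, ← integral_inner i1, ← integral_inner i2] at key
  simpa [inner_smul_right] using key

/-! ### The weak gradient on `H¹₀(Ω)` -/

section Sobolev

variable {d : ℕ} {Ω : Set (E d)}

theorem isFiniteMeasure_restrict_of_isBounded (hΩ : Bornology.IsBounded Ω) :
    IsFiniteMeasure ((volume : Measure (E d)).restrict Ω) :=
  isFiniteMeasure_restrict.2 hΩ.measure_lt_top.ne

theorem inner_gradient (φ : E d → ℝ) (x v : E d) : inner ℝ v (gradient φ x) = fderiv ℝ φ x v := by
  rw [real_inner_comm, gradient, InnerProductSpace.toDual_symm_apply]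

theorem memLp_of_hasCompactSupport {F : Type*} [NormedAddCommGroup F] {f : E d → F}
    (hf : Continuous f) (hc : HasCompactSupport f) :
    MemLp f 2 ((volume : Measure (E d)).restrict Ω) :=
  (hf.memLp_of_hasCompactSupport hc).restrict Ω

/-- Integration by parts against a test function, for pairs `(u, ∇u)` with `u ∈ H¹₀(Ω)`. -/
theorem integral_fderiv_mul_add_eq_zero {p : L2 Ω × L2Vec Ω} (hp : p ∈ sobolevGraph Ω)
    {ψ : E d → ℝ} (hψ : ContDiff ℝ ∞ ψ) (hψc : HasCompactSupport ψ) (v : E d) :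
    (∫ x in Ω, fderiv ℝ ψ x v * p.1 x) + ∫ x in Ω, inner ℝ (ψ x • v) (p.2 x) = 0 := by
  have hψ'cont : Continuous fun x => fderiv ℝ ψ x v :=
    (hψ.continuous_fderiv (by simp)).clm_apply continuous_const
  have hψ'c : HasCompactSupport fun x => fderiv ℝ ψ x v :=
    (hψc.fderiv (𝕜 := ℝ)).comp_left (g := fun L : E d →L[ℝ] ℝ => L v) rfl
  have m1 : MemLp (fun x => fderiv ℝ ψ x v) 2 ((volume : Measure (E d)).restrict Ω) :=
    memLp_of_hasCompactSupport hψ'cont hψ'c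
  have m2 : MemLp (fun x => ψ x • v) 2 ((volume : Measure (E d)).restrict Ω) :=
    memLp_of_hasCompactSupport (hψ.continuous.smul continuous_const) hψc.smul_right
  have e : ∀ p : L2 Ω × L2Vec Ω, (∫ x in Ω, fderiv ℝ ψ x v * p.1 x) +
      (∫ x in Ω, inner ℝ (ψ x • v) (p.2 x)) =
      inner ℝ (m1.toLp _) p.1 + inner ℝ (m2.toLp _) p.2 := by
    intro p
    rw [L2.inner_def, L2.inner_def]
    congr 1
    · refine integral_congr_ae ?_
      filter_upwards [m1.coeFn_toLp] with x hx
      rw [hx, real_inner_eq_re_inner, RCLike.inner_apply]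
      simp [mul_comm]
    · refine integral_congr_ae ?_
      filter_upwards [m2.coeFn_toLp] with x hx
      rw [hx]
  rw [e]
  have hcl : IsClosed {p : L2 Ω × L2Vec Ω |
      inner ℝ (m1.toLp _) p.1 + inner ℝ (m2.toLp _) p.2 = 0} :=
    isClosed_eq (by fun_prop) continuous_const
  refine closure_minimal (fun q hq => ?_) hcl hp
  obtain ⟨φ, hφ, hφc, hφs, hq1, hq2⟩ := hq
  rw [Set.mem_ofPred_eq, ← e]
  have hφ'cont : Continuous fun x => fderiv ℝ φ x v :=
    (hφ.continuous_fderiv (by simp)).clm_apply continuous_const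
  have hφz : ∀ x, x ∉ Ω → φ x = 0 := fun x hx =>
    image_eq_zero_of_notMem_tsupport fun h => hx (hφs h)
  have hφz' : ∀ x, x ∉ Ω → fderiv ℝ φ x v = 0 := fun x hx => by
    rw [image_eq_zero_of_notMem_tsupport fun h => hx (hφs (tsupport_fderiv_subset ℝ h))]
    rfl
  have e1 : ∫ x in Ω, fderiv ℝ ψ x v * q.1 x = ∫ x, fderiv ℝ ψ x v * φ x := by
    refine Eq.trans (integral_congr_ae ?_)
      (setIntegral_eq_integral_of_forall_compl_eq_zero (s := Ω) fun x hx => by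
        rw [hφz x hx, mul_zero])
    filter_upwards [hq1] with x hx
    rw [hx]
  have e2 : ∫ x in Ω, inner ℝ (ψ x • v) (q.2 x) = ∫ x, ψ x * fderiv ℝ φ x v := by
    refine Eq.trans (integral_congr_ae ?_)
      (setIntegral_eq_integral_of_forall_compl_eq_zero (s := Ω) fun x hx => by
        rw [hφz' x hx, mul_zero])
    filter_upwards [hq2] with x hx
    rw [hx, real_inner_smul_left, inner_gradient]
  rw [e1, e2, integral_mul_fderiv_eq_neg_fderiv_mul_of_integrable]
  · ring
  · exact (hψ'cont.mul hφ.continuous).integrable_of_hasCompactSupport hψ'c.mul_right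
  · exact (hψ.continuous.mul hφ'cont).integrable_of_hasCompactSupport hψc.mul_right
  · exact (hψ.continuous.mul hφ.continuous).integrable_of_hasCompactSupport hψc.mul_right
  · exact fun x _ => (hψ.differentiable (by simp)) x
  · exact fun x _ => (hφ.differentiable (by simp)) x

/-- The weak gradient is unique. -/
theorem eq_zero_of_mem_sobolevGraph (hΩ : IsBoundedDomain Ω) {G : L2Vec Ω}
    (hG : ((0 : L2 Ω), G) ∈ sobolevGraph Ω) : G = 0 := by
  have := isFiniteMeasure_restrict_of_isBounded hΩ.isBounded
  have hGi : IntegrableOn G Ω := (Lp.memLp G).integrable (by norm_num)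
  have hae : ∀ᵐ x : E d, x ∈ Ω → G x = 0 := by
    refine hΩ.isOpen.ae_eq_zero_of_integral_contDiff_smul_eq_zero hGi.locallyIntegrableOn
      fun ψ hψ hψc hψs => ?_
    have e : ∫ x, ψ x • G x = ∫ x in Ω, ψ x • G x :=
      (setIntegral_eq_integral_of_forall_compl_eq_zero fun x hx => by
        rw [image_eq_zero_of_notMem_tsupport fun h => hx (hψs h), zero_smul]).symm
    obtain ⟨C, hC⟩ := hψc.exists_bound_of_continuous hψ.continuous
    have hi : Integrable (fun x => ψ x • G x) (volume.restrict Ω) :=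
      hGi.bdd_smul C hψ.continuous.aestronglyMeasurable (ae_of_all _ hC)
    refine ext_inner_left ℝ fun v => ?_
    rw [e, inner_zero_right, ← integral_inner hi]
    have key := integral_fderiv_mul_add_eq_zero hG hψ hψc v
    have z : ∫ x in Ω, fderiv ℝ ψ x v * (0 : L2 Ω) x = 0 := by
      refine integral_eq_zero_of_ae ?_
      filter_upwards [Lp.coeFn_zero ℝ 2 ((volume : Measure (E d)).restrict Ω)] with x hx
      rw [hx]; simp
    rw [z, zero_add] at key
    rw [← key]
    congr 1
    ext x
    rw [real_inner_smul_left, real_inner_smul_right]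
  refine Lp.ext ?_
  filter_upwards [(ae_restrict_iff' hΩ.isOpen.measurableSet).2 hae,
    Lp.coeFn_zero (E d) 2 ((volume : Measure (E d)).restrict Ω)] with x h1 h2
  rw [h1, h2]
  rfl

theorem weakGrad_eq (hΩ : IsBoundedDomain Ω) {v : L2 Ω} {G : L2Vec Ω}
    (h : (v, G) ∈ sobolevGraph Ω) : weakGrad Ω v = G := by
  have hex : ∃ G : L2Vec Ω, (v, G) ∈ sobolevGraph Ω := ⟨G, h⟩
  rw [weakGrad, dif_pos hex]
  have := (sobolevGraph Ω).sub_mem hex.choose_spec h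
  rw [Prod.mk_sub_mk, sub_self] at this
  exact sub_eq_zero.1 (eq_zero_of_mem_sobolevGraph hΩ this)

theorem mem_sobolevGraph (hΩ : IsBoundedDomain Ω) {v : L2 Ω} (hv : v ∈ H10 Ω) :
    (v, weakGrad Ω v) ∈ sobolevGraph Ω := by
  obtain ⟨p, hp, rfl⟩ := hv
  have : (p.1, p.2) ∈ sobolevGraph Ω := hp
  simpa [weakGrad_eq hΩ this] using this

theorem weakGrad_add (hΩ : IsBoundedDomain Ω) {v w : L2 Ω} (hv : v ∈ H10 Ω) (hw : w ∈ H10 Ω) :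
    weakGrad Ω (v + w) = weakGrad Ω v + weakGrad Ω w :=
  weakGrad_eq hΩ ((sobolevGraph Ω).add_mem (mem_sobolevGraph hΩ hv) (mem_sobolevGraph hΩ hw))

theorem weakGrad_smul (hΩ : IsBoundedDomain Ω) (r : ℝ) {v : L2 Ω} (hv : v ∈ H10 Ω) :
    weakGrad Ω (r • v) = r • weakGrad Ω v :=
  weakGrad_eq hΩ ((sobolevGraph Ω).smul_mem r (mem_sobolevGraph hΩ hv))

/-! ### The bilinear form -/

variable {a : E d → (E d →L[ℝ] E d)} {b : E d → ℝ}

theorem integrable_ellipticForm (hΩ : IsBoundedDomain Ω) (hA : IsPosDefElliptic Ω a b)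
    (G H : L2Vec Ω) (v w : L2 Ω) :
    Integrable (fun x => inner ℝ (a x (G x)) (H x) + b x * v x * w x)
      ((volume : Measure (E d)).restrict Ω) := by
  obtain ⟨Ma, hMa⟩ := hA.a_bdd
  obtain ⟨Mb, hMb⟩ := hA.b_bdd
  have hmem := ae_restrict_mem (μ := (volume : Measure (E d))) hΩ.isOpen.measurableSet
  have i1 : Integrable (fun x => ‖G x‖ * ‖H x‖) ((volume : Measure (E d)).restrict Ω) :=
    (Lp.memLp G).norm.integrable_mul (Lp.memLp H).norm
  have i2 : Integrable (fun x => v x * w x) ((volume : Measure (E d)).restrict Ω) :=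
    (Lp.memLp v).integrable_mul (Lp.memLp w)
  refine Integrable.add ?_ ?_
  · refine (i1.const_mul Ma).mono' ?_ ?_
    · exact ((ContinuousLinearMap.id ℝ (E d →L[ℝ] E d)).aestronglyMeasurable_comp₂ hA.a_meas
        (Lp.aestronglyMeasurable G)).inner (Lp.aestronglyMeasurable H)
    · filter_upwards [hmem] with x hx
      calc ‖inner ℝ (a x (G x)) (H x)‖ ≤ ‖a x (G x)‖ * ‖H x‖ := norm_inner_le_norm _ _
        _ ≤ (Ma * ‖G x‖) * ‖H x‖ := by
            gcongr
            exact (a x).le_of_opNorm_le (hMa x hx) _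
        _ = _ := by ring
  · have := i2.bdd_mul (c := Mb) hA.b_meas (by filter_upwards [hmem] with x hx using hMb x hx)
    refine this.congr (ae_of_all _ fun x => ?_)
    simp only
    ring

theorem ellipticForm_add_left (hΩ : IsBoundedDomain Ω) (hA : IsPosDefElliptic Ω a b)
    {v v' : L2 Ω} (hv : v ∈ H10 Ω) (hv' : v' ∈ H10 Ω) (w : L2 Ω) :
    ellipticForm Ω a b (v + v') w = ellipticForm Ω a b v w + ellipticForm Ω a b v' w := by
  rw [ellipticForm, ellipticForm, ellipticForm, ← integral_add
    (integrable_ellipticForm hΩ hA _ _ _ _) (integrable_ellipticForm hΩ hA _ _ _ _),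
    weakGrad_add hΩ hv hv']
  refine integral_congr_ae ?_
  filter_upwards [Lp.coeFn_add v v', Lp.coeFn_add (weakGrad Ω v) (weakGrad Ω v')] with x h1 h2
  simp only [h1, h2, Pi.add_apply, map_add, inner_add_left]
  ring

theorem ellipticForm_smul_left (hΩ : IsBoundedDomain Ω) (r : ℝ)
    {v : L2 Ω} (hv : v ∈ H10 Ω) (w : L2 Ω) :
    ellipticForm Ω a b (r • v) w = r * ellipticForm Ω a b v w := by
  rw [ellipticForm, ellipticForm, ← integral_const_mul, weakGrad_smul hΩ r hv]
  refine integral_congr_ae ?_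
  filter_upwards [Lp.coeFn_smul r v, Lp.coeFn_smul r (weakGrad Ω v)] with x h1 h2
  simp only [h1, h2, Pi.smul_apply, map_smul, real_inner_smul_left, smul_eq_mul]
  ring

theorem ellipticForm_comm (hΩ : IsBoundedDomain Ω) (hA : IsPosDefElliptic Ω a b) (v w : L2 Ω) :
    ellipticForm Ω a b v w = ellipticForm Ω a b w v := by
  refine integral_congr_ae ?_
  filter_upwards [ae_restrict_mem (μ := (volume : Measure (E d))) hΩ.isOpen.measurableSet]
    with x hx
  rw [hA.a_symm x hx, real_inner_comm]
  ring

end Sobolev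

/-! ### The finite element space is finite dimensional -/

/-- On the triangulated set, a piecewise linear function is the mean, over the simplices
containing a point, of its linear pieces. -/
theorem finiteDimensional_feSpace {d : ℕ} {Ω : Set (E d)} (hΩ : IsBoundedDomain Ω)
    {K : Geometry.SimplicialComplex ℝ (E d)} (hK : IsTriangulation Ω K) :
    FiniteDimensional ℝ (feSpace Ω K) := by
  classical
  set ν := (volume : Measure (E d)).restrict Ω with hν
  have := isFiniteMeasure_restrict_of_isBounded hΩ.isBounded
  set S := hK.finite.toFinset with hS
  set χ : Finset (E d) → E d → ℝ := fun s => (convexHull ℝ (s : Set (E d))).indicator 1 with hχ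
  set m : E d → ℝ := fun x => ∑ s ∈ S, χ s x with hm
  set f : Finset (E d) → E d → ℝ := fun s x => χ s x / m x with hf
  have hχ0 : ∀ s x, 0 ≤ χ s x := fun s x => indicator_nonneg (fun _ _ => zero_le_one) _
  have hχm : ∀ s, Measurable (χ s) := fun s =>
    measurable_one.indicator (s.finite_toSet.isCompact_convexHull (𝕜 := ℝ)).isClosed.measurableSet
  have hfm : ∀ s, Measurable (f s) := fun s =>
    (hχm s).div (Finset.measurable_sum S fun s _ => hχm s)
  have hfb : ∀ s ∈ S, ∀ x, ‖f s x‖ ≤ 1 := by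
    intro s hs x
    have hle : χ s x ≤ m x := Finset.single_le_sum (fun s _ => hχ0 s x) hs
    rw [Real.norm_of_nonneg (div_nonneg (hχ0 s x) ((hχ0 s x).trans hle))]
    exact div_le_one_of_le₀ hle ((hχ0 s x).trans hle)
  -- the generators: the weights of the simplices, and their products with the coordinates
  set g : Finset (E d) × Option (Fin d) → E d → ℝ := fun p x =>
    f p.1 x * p.2.elim 1 (fun i => x i) with hg
  obtain ⟨R, hR⟩ := hΩ.isBounded.exists_norm_le
  have hgm : ∀ p : Finset (E d) × Option (Fin d), p.1 ∈ S → MemLp (g p) 2 ν := by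
    rintro ⟨s, o⟩ hs
    have hom : Measurable fun x : E d => (o.elim 1 fun i => x i : ℝ) := by
      cases o with
      | none => exact measurable_const
      | some i => exact (EuclideanSpace.proj (𝕜 := ℝ) i).continuous.measurable
    refine MemLp.of_bound (C := max 1 R) ((hfm s).mul hom).aestronglyMeasurable ?_
    filter_upwards [ae_restrict_mem hΩ.isOpen.measurableSet] with x hx
    have ho : ‖(o.elim 1 fun i => x i : ℝ)‖ ≤ max 1 R := by
      cases o with
      | none => simp
      | some i => exact ((PiLp.norm_apply_le x i).trans (hR x hx)).trans (le_max_right _ _)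
    rw [norm_mul]
    calc _ ≤ 1 * max 1 R := mul_le_mul (hfb s hs x) ho (norm_nonneg _) zero_le_one
      _ = _ := one_mul _
  set W : Submodule ℝ (L2 Ω) := Submodule.span ℝ
    (range fun p : S × Option (Fin d) => (hgm (p.1.1, p.2) p.1.2).toLp _) with hW
  have hWf : FiniteDimensional ℝ W := FiniteDimensional.span_of_finite ℝ (finite_range _)
  -- the functions represented by elements of the span
  set V : Submodule ℝ (E d → ℝ) :=
    { carrier := {h | ∃ v ∈ W, v =ᵐ[ν] h}
      zero_mem' := ⟨0, W.zero_mem, Lp.coeFn_zero _ _ _⟩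
      add_mem' := by
        rintro h h' ⟨v, hv, hvh⟩ ⟨v', hv', hvh'⟩
        exact ⟨v + v', W.add_mem hv hv', (Lp.coeFn_add _ _).trans (hvh.add hvh')⟩
      smul_mem' := by
        rintro r h ⟨v, hv, hvh⟩
        exact ⟨r • v, W.smul_mem r hv, (Lp.coeFn_smul _ _).trans (hvh.const_smul r)⟩ } with hV
  have hgV : ∀ s ∈ S, ∀ o, g (s, o) ∈ V := fun s hs o =>
    ⟨_, Submodule.subset_span ⟨(⟨s, hs⟩, o), rfl⟩, (hgm (s, o) hs).coeFn_toLp⟩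
  refine Submodule.finiteDimensional_of_le (S₂ := W) ?_
  rintro v ⟨-, w, ⟨-, hwl⟩, hvw⟩
  choose! l hl using hwl
  have hsum : (∑ s ∈ S, ((l s 0) • g (s, none) +
      ∑ i : Fin d, ((l s).linear (EuclideanSpace.single i 1)) • g (s, some i))) ∈ V := by
    refine V.sum_mem fun s hs => V.add_mem (V.smul_mem _ (hgV s hs _)) ?_
    exact V.sum_mem fun i _ => V.smul_mem _ (hgV s hs _)
  obtain ⟨v', hv', hve⟩ := hsum
  have : v = v' := by
    refine Lp.ext (hvw.trans (EventuallyEq.trans ?_ hve.symm))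
    filter_upwards [ae_restrict_mem hΩ.isOpen.measurableSet] with x hx
    have hlx : ∀ s, l s x = l s 0 + ∑ i : Fin d, (l s).linear (EuclideanSpace.single i 1) * x i := by
      intro s
      have h1 := (l s).map_vadd 0 x
      rw [vadd_eq_add, add_zero, vadd_eq_add] at h1
      rw [h1, add_comm]
      congr 1
      conv_lhs => rw [← (EuclideanSpace.basisFun (Fin d) ℝ).sum_repr x]
      rw [map_sum]
      refine Finset.sum_congr rfl fun i _ => ?_
      rw [map_smul, smul_eq_mul, mul_comm]
      simp
    have hpt : ∀ s ∈ S, f s x * l s x = f s x * w x := by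
      intro s hs
      by_cases hxs : x ∈ convexHull ℝ (s : Set (E d))
      · rw [hl s (hK.finite.mem_toFinset.1 hs) hxs]
      · have : f s x = 0 := by
          simp only [hf, hχ, indicator_of_notMem hxs, zero_div]
        rw [this, zero_mul, zero_mul]
    have hm0 : m x ≠ 0 := by
      have hxK : x ∈ K.space := by rw [hK.space_eq]; exact subset_closure hx
      obtain ⟨s, hs, hxs⟩ := Geometry.SimplicialComplex.mem_space_iff.1 hxK
      have h1 : χ s x = 1 := by simp only [hχ, indicator_of_mem hxs, Pi.one_apply]
      have hle : χ s x ≤ m x :=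
        Finset.single_le_sum (fun s _ => hχ0 s x) (hK.finite.mem_toFinset.2 hs)
      rw [h1] at hle
      linarith
    have hone : ∑ s ∈ S, f s x = 1 := by
      rw [← Finset.sum_div]
      exact div_self hm0
    rw [Finset.sum_apply]
    calc w x = ∑ s ∈ S, f s x * l s x := by
          rw [Finset.sum_congr rfl hpt, ← Finset.sum_mul, hone, one_mul]
      _ = _ := by
          refine Finset.sum_congr rfl fun s _ => ?_
          rw [hlx, Pi.add_apply, Finset.sum_apply, mul_add, Finset.mul_sum]
          simp only [Pi.smul_apply, smul_eq_mul, hg, Option.elim]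
          congr 1
          · ring
          · exact Finset.sum_congr rfl fun i _ => by ring
  rw [this]
  exact hv'

/-! ### Diagonalisation -/

/-- A symmetric, positive definite form on a finite dimensional subspace is diagonal in a suitable
orthonormal basis. -/
theorem exists_orthonormalBasis_of_symmetric {H : Type*} [NormedAddCommGroup H]
    [InnerProductSpace ℝ H] (X : Submodule ℝ H) [FiniteDimensional ℝ X] {A : H → H → ℝ}
    (hadd : ∀ v ∈ X, ∀ v' ∈ X, ∀ w, A (v + v') w = A v w + A v' w)
    (hsmul : ∀ r : ℝ, ∀ v ∈ X, ∀ w, A (r • v) w = r * A v w) (hcomm : ∀ v w, A v w = A w v)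
    (hpos : ∀ v ∈ X, v ≠ 0 → 0 < A v v) :
    ∃ (m : ℕ) (b : OrthonormalBasis (Fin m) ℝ X) (lam : Fin m → ℝ), (∀ i, 0 < lam i) ∧
      ∀ i, ∀ v ∈ X, A v (b i) = lam i * inner ℝ (b i : H) v := by
  set B : X → X →ₗ[ℝ] ℝ := fun v =>
    { toFun := fun w => A v w
      map_add' := fun w w' => by
        rw [hcomm, Submodule.coe_add, hadd _ w.2 _ w'.2, hcomm w, hcomm w']
      map_smul' := fun r w => by
        rw [hcomm, Submodule.coe_smul, hsmul _ _ w.2, hcomm w]; rfl } with hB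
  set S : X →ₗ[ℝ] X :=
    { toFun := fun v => (InnerProductSpace.toDual ℝ X).symm (LinearMap.toContinuousLinearMap (B v))
      map_add' := fun v v' => by
        rw [← map_add]; congr 1; ext w; exact hadd v v.2 v' v'.2 w
      map_smul' := fun r v => by
        refine ext_inner_right ℝ fun w => ?_
        rw [RingHom.id_apply, real_inner_smul_left, InnerProductSpace.toDual_symm_apply,
          InnerProductSpace.toDual_symm_apply]
        exact hsmul r v v.2 w } with hS
  have hSA : ∀ v w : X, inner ℝ (S v) w = A v w := fun v w =>
    InnerProductSpace.toDual_symm_apply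
  have hsymm : S.IsSymmetric := fun v w => by
    rw [hSA, hcomm, ← hSA, real_inner_comm]
  set b := hsymm.eigenvectorBasis rfl with hb
  have heig : ∀ i, ∀ v : X, A v (b i) = hsymm.eigenvalues rfl i * inner ℝ (b i) v := by
    intro i v
    rw [hcomm, ← hSA, hsymm.apply_eigenvectorBasis rfl i, real_inner_smul_left]
    rfl
  refine ⟨_, b, hsymm.eigenvalues rfl, fun i => ?_, fun i v hv => heig i ⟨v, hv⟩⟩
  have h1 := heig i (b i)
  rw [real_inner_self_eq_norm_sq, b.norm_eq_one, one_pow, mul_one] at h1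
  rw [← h1]
  refine hpos _ (b i).2 fun h => ?_
  have := b.norm_eq_one i
  rw [Submodule.coe_eq_zero.1 h, norm_zero] at this
  exact zero_ne_one this

section Bessel

variable {H : Type*} [NormedAddCommGroup H] [InnerProductSpace ℝ H] {ι : Type*} [Fintype ι]
  {v : ι → H}

theorem sum_mul_inner_mul_inner_le (hv : Orthonormal ℝ v) {w : ι → ℝ} {W : ℝ}
    (hw : ∀ k, |w k| ≤ W) (hW : 0 ≤ W) (x e : H) :
    ∑ k, w k * inner ℝ (v k) x * inner ℝ (v k) e ≤ W * ‖x‖ * ‖e‖ := by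
  have bessel : ∀ y : H, √(∑ k, |inner ℝ (v k) y| ^ 2) ≤ ‖y‖ := fun y => by
    rw [Real.sqrt_le_left (norm_nonneg _)]
    exact hv.sum_inner_products_le y (s := Finset.univ)
  calc ∑ k, w k * inner ℝ (v k) x * inner ℝ (v k) e ≤
      ∑ k, W * (|inner ℝ (v k) x| * |inner ℝ (v k) e|) := by
        refine Finset.sum_le_sum fun k _ => (le_abs_self _).trans ?_
        rw [abs_mul, abs_mul, mul_assoc]
        have := hw k
        gcongr
    _ = W * ∑ k, |inner ℝ (v k) x| * |inner ℝ (v k) e| := by rw [Finset.mul_sum]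
    _ ≤ W * (‖x‖ * ‖e‖) := by
        gcongr
        refine (Real.sum_mul_le_sqrt_mul_sqrt _ _ _).trans ?_
        exact mul_le_mul (bessel x) (bessel e) (Real.sqrt_nonneg _) (norm_nonneg _)
    _ = _ := by ring

/-- A bound for the norm from a representation of the components which is uniform in the
component. -/
theorem norm_le_of_inner_eq (hv : Orthonormal ℝ v) {e x₀ x₁ : H} {x₂ : ℝ → H} {t : ℝ}
    (ht : 0 ≤ t) (he : ∑ k, inner ℝ (v k) e ^ 2 = ‖e‖ ^ 2) {a b : ι → ℝ} {c : ι → ℝ → ℝ}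
    {A B : ℝ} {C : ℝ → ℝ} (ha : ∀ k, |a k| ≤ A) (hb : ∀ k, |b k| ≤ B) (hA : 0 ≤ A) (hB : 0 ≤ B)
    (hc : ∀ ζ ∈ Ioo 0 t, ∀ k, |c k ζ| ≤ C ζ) (hC : ∀ ζ ∈ Ioo 0 t, 0 ≤ C ζ)
    (hci : ∀ k, IntervalIntegrable (fun ζ => c k ζ * inner ℝ (v k) (x₂ ζ)) volume 0 t)
    (hCi : IntervalIntegrable (fun ζ => C ζ * ‖x₂ ζ‖) volume 0 t)
    (hrep : ∀ k, inner ℝ (v k) e = a k * inner ℝ (v k) x₀ + b k * inner ℝ (v k) x₁ +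
      ∫ ζ in (0 : ℝ)..t, c k ζ * inner ℝ (v k) (x₂ ζ)) :
    ‖e‖ ≤ A * ‖x₀‖ + B * ‖x₁‖ + ∫ ζ in (0 : ℝ)..t, C ζ * ‖x₂ ζ‖ := by
  have key : ‖e‖ ^ 2 ≤ (A * ‖x₀‖ + B * ‖x₁‖ + ∫ ζ in (0 : ℝ)..t, C ζ * ‖x₂ ζ‖) * ‖e‖ := by
    have e1 : ‖e‖ ^ 2 = ∑ k, a k * inner ℝ (v k) x₀ * inner ℝ (v k) e +
        ∑ k, b k * inner ℝ (v k) x₁ * inner ℝ (v k) e +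
        ∫ ζ in (0 : ℝ)..t, ∑ k, c k ζ * inner ℝ (v k) (x₂ ζ) * inner ℝ (v k) e := by
      rw [intervalIntegral.integral_finsetSum fun k _ => (hci k).mul_const _, ← he,
        ← Finset.sum_add_distrib, ← Finset.sum_add_distrib]
      refine Finset.sum_congr rfl fun k _ => ?_
      rw [intervalIntegral.integral_mul_const, ← add_mul, ← add_mul, ← hrep k, sq]
    have i1 : ∫ ζ in (0 : ℝ)..t, ∑ k, c k ζ * inner ℝ (v k) (x₂ ζ) * inner ℝ (v k) e ≤
        ∫ ζ in (0 : ℝ)..t, C ζ * ‖x₂ ζ‖ * ‖e‖ := by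
      refine intervalIntegral.integral_mono_on_of_le_Ioo ht ?_ (hCi.mul_const _) fun ζ hζ =>
        sum_mul_inner_mul_inner_le hv (hc ζ hζ) (hC ζ hζ) _ _
      have := IntervalIntegrable.sum (μ := volume) (a := 0) (b := t) Finset.univ fun k _ =>
        (hci k).mul_const (inner ℝ (v k) e)
      simpa only [Finset.sum_fn] using this
    rw [intervalIntegral.integral_mul_const] at i1
    rw [e1, add_mul, add_mul]
    exact add_le_add (add_le_add (sum_mul_inner_mul_inner_le hv ha hA _ _)
      (sum_mul_inner_mul_inner_le hv hb hB _ _)) i1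
  rcases (norm_nonneg e).eq_or_lt with h0 | h0
  · rw [← h0]
    have : 0 ≤ ∫ ζ in (0 : ℝ)..t, C ζ * ‖x₂ ζ‖ := by
      rw [intervalIntegral.integral_of_le ht, integral_Ioc_eq_integral_Ioo]
      exact setIntegral_nonneg measurableSet_Ioo fun ζ hζ =>
        mul_nonneg (hC ζ hζ) (norm_nonneg _)
    positivity
  · rw [sq] at key
    exact le_of_mul_le_mul_right key h0

end Bessel

/-! ### The components of the solutions -/

section Components

variable {d : ℕ} {Ω : Set (E d)} {X : Submodule ℝ (L2 Ω)} {A : L2 Ω → L2 Ω → ℝ} {α T lam : ℝ}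
  {φ : L2 Ω}

theorem inner_primitive {H : Type*} [NormedAddCommGroup H] [InnerProductSpace ℝ H]
    [CompleteSpace H] (x : H) {f : ℝ → H} {t : ℝ} (hf : IntervalIntegrable f volume 0 t) :
    inner ℝ x (primitive f t) = primitive (fun s => inner ℝ x (f s)) t :=
  ((innerSL ℝ x).intervalIntegral_comp_comm hf).symm

theorem primitive_mem {H : Type*} [NormedAddCommGroup H] [InnerProductSpace ℝ H]
    [CompleteSpace H] (X : Submodule ℝ H) [FiniteDimensional ℝ X] {f : ℝ → H} {t : ℝ} (ht : 0 ≤ t)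
    (hf : IntervalIntegrable f volume 0 t) (h : ∀ s ∈ Ioc 0 t, f s ∈ X) : primitive f t ∈ X := by
  rw [← Submodule.starProjection_eq_self_iff, primitive,
    ← X.starProjection.intervalIntegral_comp_comm hf]
  refine intervalIntegral.integral_congr_ae (ae_of_all _ fun s hs => ?_)
  rw [uIoc_of_le ht] at hs
  exact Submodule.starProjection_eq_self_iff.2 (h s hs)

/-- The component of the semidiscrete solution along an eigenvector solves a scalar fractional
equation. -/
theorem IsSemidiscreteSolution.inner_equation [FiniteDimensional ℝ X] {f u : ℝ → L2 Ω}
    (h : IsSemidiscreteSolution X A α T 0 f u) (h1 : α < 1)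
    (hf : IntervalIntegrable f volume 0 T) (hφ : φ ∈ X)
    (hA : ∀ w ∈ X, A w φ = lam * inner ℝ φ w) : ∀ t ∈ Ioc 0 T,
    (∫ s in (0 : ℝ)..t, fracKernel (1 - α) (t - s) * inner ℝ φ (u s)) +
      lam * (∫ s in (0 : ℝ)..t, inner ℝ φ (u s)) = ∫ s in (0 : ℝ)..t, inner ℝ φ (f s) := by
  intro t ht
  have hT : 0 < T := ht.1.trans_le ht.2
  have hsub : uIcc 0 t ⊆ uIcc 0 T := by
    rw [uIcc_of_le ht.1.le, uIcc_of_le hT.le]; exact Icc_subset_Icc le_rfl ht.2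
  have huT : IntervalIntegrable u volume 0 T :=
    (intervalIntegrable_iff_integrableOn_Ioc_of_le hT.le).2 h.integrableOn
  have hu : IntervalIntegrable u volume 0 t := huT.mono_set hsub
  have huc : ContinuousOn u (Ioc 0 t) := h.continuousOn.mono (Ioc_subset_Ioc_right ht.2)
  have key := h.equation t ht φ hφ
  rw [inner_zero_left, mul_zero, add_zero,
    hA _ (primitive_mem X ht.1.le hu fun s hs => h.mem s ⟨hs.1, hs.2.trans ht.2⟩),
    inner_primitive φ hu, real_inner_comm, real_inner_comm φ (primitive f t),
    inner_primitive φ (hf.mono_set hsub)] at key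
  refine Eq.trans (congrArg₂ (· + ·) ?_ rfl) key
  -- away from the initial time the primitive of `u` is differentiable with derivative `u`
  have hderiv : ∀ ζ ∈ Ioo 0 t, deriv (primitive u) ζ = u ζ := by
    intro ζ hζ
    have hc : ContinuousOn u (Ioo 0 t) := huc.mono Ioo_subset_Ioc_self
    have hd : HasDerivAt (primitive u) (u ζ) ζ := by
      refine intervalIntegral.integral_hasDerivAt_right (hu.mono_set ?_)
        ⟨Ioo 0 t, Ioo_mem_nhds hζ.1 hζ.2, hc.aestronglyMeasurable measurableSet_Ioo⟩
        (hc.continuousAt (Ioo_mem_nhds hζ.1 hζ.2))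
      rw [uIcc_of_le hζ.1.le, uIcc_of_le ht.1.le]
      exact Icc_subset_Icc le_rfl hζ.2.le
    exact hd.deriv
  have hne : ∀ᵐ s : ℝ, s ≠ t := by simp [ae_iff]
  have e1 : ∫ ζ in (0 : ℝ)..t, (t - ζ) ^ (-α) • deriv (primitive u) ζ =
      ∫ ζ in (0 : ℝ)..t, (t - ζ) ^ (-α) • u ζ := by
    refine intervalIntegral.integral_congr_ae ?_
    filter_upwards [hne] with s hst hs
    rw [uIoc_of_le ht.1.le] at hs
    rw [hderiv s ⟨hs.1, lt_of_le_of_ne hs.2 hst⟩]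
  have hint : IntervalIntegrable (fun ζ => (t - ζ) ^ (-α) • u ζ) volume 0 t := by
    have hn := intervalIntegrable_comp_sub_mul ht.1
      (intervalIntegral.intervalIntegrable_rpow' (by linarith : -1 < -α))
      ((continuousOn_rpow_Ioi (-α)).mono Ioc_subset_Ioi_self) hu.norm huc.norm
    refine hn.mono_fun ?_ ?_
    · have hm : Measurable fun s : ℝ => (t - s) ^ (-α) := Measurable.pow_const (by fun_prop) _
      rw [uIoc_of_le ht.1.le]
      exact hm.aestronglyMeasurable.smul (huc.aestronglyMeasurable measurableSet_Ioc)
    · refine ae_of_all _ fun s => ?_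
      simp only [norm_smul, norm_mul, norm_norm, le_refl]
  rw [caputoDeriv, e1, inner_smul_right]
  have e2 := (innerSL ℝ φ).intervalIntegral_comp_comm hint
  simp only [innerSL_apply_apply, inner_smul_right] at e2
  rw [← e2, ← intervalIntegral.integral_const_mul]
  refine intervalIntegral.integral_congr fun s _ => ?_
  simp only [fracKernel]
  rw [show 1 - α - 1 = -α by ring]
  ring

theorem inner_bdf2 {H : Type*} [NormedAddCommGroup H] [InnerProductSpace ℝ H] (x : H) (τ : ℝ)
    (f : ℝ → H) (t : ℝ) : inner ℝ x (bdf2 τ f t) = bdf2 τ (fun s => inner ℝ x (f s)) t := by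
  simp only [bdf2, inner_smul_right, inner_add_right, inner_sub_right, smul_eq_mul]

theorem inner_cnApprox {H : Type*} [NormedAddCommGroup H] [InnerProductSpace ℝ H] (x : H) (τ : ℝ)
    (U : ℤ → H) (n : ℤ) : inner ℝ x (cnApprox τ U n) = cnApprox τ (fun k => inner ℝ x (U k)) n := by
  simp only [cnApprox, inner_smul_right, inner_add_right, inner_sub_right, smul_eq_mul]

theorem inner_primitive_primitive {H : Type*} [NormedAddCommGroup H] [InnerProductSpace ℝ H]
    [CompleteSpace H] (x : H) {f : ℝ → H} {t : ℝ} (hf : IntervalIntegrable f volume 0 t) :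
    inner ℝ x (primitive (primitive f) t) = primitive (primitive fun s => inner ℝ x (f s)) t := by
  have hc : ContinuousOn (primitive f) (uIcc 0 t) :=
    intervalIntegral.continuousOn_primitive_interval' hf left_mem_uIcc
  rw [inner_primitive x hc.intervalIntegrable]
  refine intervalIntegral.integral_congr fun s hs => ?_
  exact inner_primitive x (hf.mono_set (uIcc_subset_uIcc_left hs))

/-- The component of the discrete solution along an eigenvector solves the scalar scheme. -/
theorem IsCNSolution.inner_equation {τ : ℝ} (hτ : 0 < τ) {N : ℕ} {f : ℝ → L2 Ω} {U : ℤ → L2 Ω}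
    (h : IsCNSolution X A α τ N 0 f U) (hf : ∀ t ≤ N * τ, IntervalIntegrable f volume 0 t)
    (hφ : φ ∈ X) (hA : ∀ w ∈ X, A w φ = lam * inner ℝ φ w) (n : ℕ) (hn1 : 1 ≤ n) (hn : n ≤ N) :
    τ ^ (-α) * ∑ j ∈ Finset.range (n + 1), glCoeff α j * inner ℝ φ (U ((n : ℤ) - j)) +
        lam * ((1 - α / 2) * inner ℝ φ (U n) + α / 2 * inner ℝ φ (U ((n : ℤ) - 1))) =
      (1 - α / 2) * bdf2 τ (primitive (primitive fun s => inner ℝ φ (f s))) (n * τ) +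
        α / 2 * bdf2 τ (primitive (primitive fun s => inner ℝ φ (f s))) (((n : ℝ) - 1) * τ) := by
  have key := h.equation n hn1 hn φ hφ
  have hN : (n : ℝ) ≤ N := by exact_mod_cast hn
  have hb : ∀ t ≤ N * τ, inner ℝ (bdf2 τ (primitive (primitive f)) t) φ =
      bdf2 τ (primitive (primitive fun s => inner ℝ φ (f s))) t := by
    intro t ht
    rw [real_inner_comm, inner_bdf2]
    simp only [bdf2]
    rw [inner_primitive_primitive φ (hf t ht), inner_primitive_primitive φ (hf (t - τ) (by linarith)),
      inner_primitive_primitive φ (hf (t - 2 * τ) (by linarith))]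
  rw [hA _ (h.mem _), hA _ (h.mem _), hb _ (by gcongr), hb _ (by nlinarith), inner_zero_left,
    mul_zero, mul_zero, add_zero, add_zero, real_inner_smul_left, sum_inner] at key
  rw [← key, mul_add, ← add_assoc]
  congr 1
  · congr 1
    · congr 1
      refine Finset.sum_congr rfl fun j _ => ?_
      rw [real_inner_smul_left, real_inner_comm]
    · ring
  · ring

end Components

/-! ### The error bound -/

section Source

variable {H : Type*} [NormedAddCommGroup H] [NormedSpace ℝ H] {g : ℝ → H} {T μ : ℝ}

theorem singularSource_of_pos {s : ℝ} (hs : 0 < s) : singularSource μ g s = s ^ μ • g s :=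
  if_pos hs

theorem singularSource_of_nonpos {s : ℝ} (hs : s ≤ 0) : singularSource μ g s = 0 :=
  if_neg (not_lt.2 hs)

theorem continuousOn_singularSource (hg : ContinuousOn g (Icc 0 T)) :
    ContinuousOn (singularSource μ g) (Ioc 0 T) :=
  (((continuousOn_rpow_Ioi μ).mono Ioc_subset_Ioi_self).smul (hg.mono Ioc_subset_Icc_self)).congr
    fun _ hs => singularSource_of_pos hs.1

theorem norm_singularSource_le {D : ℝ} (hD : ∀ s ∈ Icc 0 T, ‖g s‖ ≤ D) {s : ℝ} (hs : s ∈ Ioc 0 T) :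
    ‖singularSource μ g s‖ ≤ D * s ^ μ := by
  have : 0 < s ^ μ := Real.rpow_pos_of_pos hs.1 μ
  rw [singularSource_of_pos hs.1, norm_smul, Real.norm_of_nonneg this.le, mul_comm]
  gcongr
  exact hD s (Ioc_subset_Icc_self hs)

theorem intervalIntegrable_singularSource (hμ : -1 < μ) (hg : ContinuousOn g (Icc 0 T)) {t : ℝ}
    (ht : t ≤ T) : IntervalIntegrable (singularSource μ g) volume 0 t := by
  rcases le_or_gt t 0 with h | h
  · refine (intervalIntegrable_const (c := (0 : H))).congr fun s hs => ?_
    rw [uIoc_of_ge h] at hs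
    exact (singularSource_of_nonpos hs.2).symm
  · have hg' := hg.mono (Icc_subset_Icc_right ht)
    obtain ⟨D, hD⟩ := isCompact_Icc.exists_bound_of_continuousOn hg'
    have := (intervalIntegral.intervalIntegrable_rpow' (a := 0) (b := t) hμ).const_mul D
    rw [intervalIntegrable_iff_integrableOn_Ioc_of_le h.le] at this ⊢
    refine this.mono' ((continuousOn_singularSource hg').aestronglyMeasurable measurableSet_Ioc) ?_
    filter_upwards [ae_restrict_mem measurableSet_Ioc] with s hs
    exact norm_singularSource_le hD hs

end Source

/-- The weighted integrability of the second derivative includes its integrability. -/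
theorem integrableOn_of_integrableOn_rpow_mul_norm {H : Type*} [NormedAddCommGroup H] {T : ℝ}
    {g₂ : ℝ → H} {p : ℝ} (hp : p ≤ 0) (hT : 0 < T)
    (hg₂ : LocallyIntegrableOn g₂ (Ioo 0 T))
    (h : IntegrableOn (fun ζ => ζ ^ p * ‖g₂ ζ‖) (Ioo 0 T)) : IntegrableOn g₂ (Ioo 0 T) := by
  refine (h.const_mul (T ^ (-p))).mono' hg₂.aestronglyMeasurable ?_
  filter_upwards [ae_restrict_mem measurableSet_Ioo] with ζ hζ
  have h1 : T ^ p ≤ ζ ^ p := Real.rpow_le_rpow_of_nonpos hζ.1 hζ.2.le hp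
  have h2 : 0 < T ^ p := Real.rpow_pos_of_pos hT p
  rw [Real.rpow_neg hT.le, ← mul_assoc]
  refine le_mul_of_one_le_left (norm_nonneg _) ?_
  rw [inv_mul_eq_div, one_le_div h2]
  exact h1

set_option maxHeartbeats 1000000 in
/-- The error bound for a symmetric, positive definite form on a finite dimensional subspace, with
a constant that depends neither on the form nor on the subspace. -/
theorem exists_norm_sub_cnApprox_le {α μ : ℝ} (h0 : 0 < α) (h1 : α < 1) (hμ0 : -1 < μ)
    (hμ1 : μ < 0) : ∃ c : ℝ, 0 < c ∧
      ∀ (d : ℕ) (Ω : Set (E d)) (X : Submodule ℝ (L2 Ω)) (_ : FiniteDimensional ℝ X)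
        (A : L2 Ω → L2 Ω → ℝ)
        (_ : ∀ v ∈ X, ∀ v' ∈ X, ∀ w, A (v + v') w = A v w + A v' w)
        (_ : ∀ r : ℝ, ∀ v ∈ X, ∀ w, A (r • v) w = r * A v w) (_ : ∀ v w, A v w = A w v)
        (_ : ∀ v ∈ X, v ≠ 0 → 0 < A v v) (T : ℝ) (g g' g'' : ℝ → L2 Ω)
        (_ : HasWeakDeriv T g g') (_ : HasWeakDeriv T g' g'')
        (_ : ContinuousOn g (Icc 0 T)) (_ : ContinuousOn g' (Icc 0 T))
        (_ : ∀ t ∈ Ioc 0 T, IntegrableOn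
          (fun ζ : ℝ => (t - ζ) ^ (α - 1) * ζ ^ μ * ‖g'' ζ‖) (Ioo 0 t))
        (_ : IntegrableOn (fun ζ : ℝ => ζ ^ ((μ - 1) / 2) * ‖g'' ζ‖) (Ioo 0 T))
        (uh : ℝ → L2 Ω) (_ : IsSemidiscreteSolution X A α T 0 (singularSource μ g) uh)
        (N : ℕ) (τ : ℝ) (_ : 0 < τ) (_ : T = N * τ) (U : ℤ → L2 Ω)
        (_ : IsCNSolution X A α τ N 0 (singularSource μ g) U)
        (n : ℕ) (_ : 1 ≤ n) (_ : n ≤ N) (t : ℝ) (_ : t = n * τ),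
        ‖uh t - cnApprox τ U n‖ ≤ c * τ ^ 2 *
          (t ^ (α + μ - 2) * ‖g 0‖ + t ^ (α + μ - 1) * ‖g' 0‖
            + (∫ ζ in (0 : ℝ)..t, (t - ζ) ^ (α - 1) * ζ ^ μ * ‖g'' ζ‖)
            + t ^ (α + (μ - 1) / 2) * ∫ ζ in (0 : ℝ)..t, ζ ^ ((μ - 1) / 2) * ‖g'' ζ‖) := by
  obtain ⟨C, hC, hker⟩ := isCancellingKernel_errorKernel h0 h1
  have h1α : 0 < 1 - α := by linarith
  -- the constants for the values `g(0)`, `g'(0)` and for the second derivative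
  set c₀ : ℝ := (1 / (μ + 1) + 1 + 1 / (1 - α) + 2 / ((1 - α) * α)) * (1 / 2) ^ (α + μ - 2)
    with hc₀
  set c₁ : ℝ := (1 / (μ + 1 + 1) + 1 + 1 / (1 - α) + 2 / ((1 - α) * α)) *
    (1 / 2) ^ (α + (μ + 1) - 2) with hc₁
  set c₂ : ℝ := 1 / (1 - α) + 4 / (1 - α) * (Real.Gamma α * Real.Gamma ((μ - 1) / 2 + 1) /
    Real.Gamma (α + (μ - 1) / 2 + 1)) with hc₂
  have hc₀p : 0 < c₀ := by
    have : 0 < μ + 1 := by linarith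
    positivity
  have hc₁p : 0 < c₁ := by
    have : 0 < μ + 1 + 1 := by linarith
    positivity
  have hc₂p : 0 < c₂ := by
    have := Real.Gamma_pos_of_pos h0
    have := Real.Gamma_pos_of_pos (by linarith : 0 < (μ - 1) / 2 + 1)
    have := Real.Gamma_pos_of_pos (by linarith : 0 < α + (μ - 1) / 2 + 1)
    positivity
  refine ⟨(c₀ + c₁ + c₂) * C, by positivity, ?_⟩
  intro d Ω X hX A hadd hsmul hcomm hpos T g g' g'' hg hg' hgc hgc' hI1 hI2 uh hu N τ hτ hT U hU
    n hn1 hn t ht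
  obtain ⟨m, b, lam, hlam, hA⟩ := exists_orthonormalBasis_of_symmetric X hadd hsmul hcomm hpos
  have hn0 : (0 : ℝ) < n := by exact_mod_cast hn1
  have hnN : (n : ℝ) ≤ N := by exact_mod_cast hn
  have ht0 : 0 < t := by rw [ht]; positivity
  have htT : t ≤ T := by rw [hT, ht]; gcongr
  have hT0 : 0 < T := ht0.trans_le htT
  set v : Fin m → L2 Ω := fun k => (b k : L2 Ω) with hv
  have hvo : Orthonormal ℝ v := b.orthonormal.comp_linearIsometry X.subtypeₗᵢ
  set k : Fin m → ℝ → ℝ := fun i r => τ ^ (α - 1) * errorKernel α (lam i * τ ^ α) (r / τ) with hk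
  have hkc : ∀ i, IsCancellingKernel α (C * τ ^ 2) (k i) := fun i =>
    (hker (lam i * τ ^ α) (by have := hlam i; positivity)).scale hτ
  -- the regularity of the data
  have hg2i : IntegrableOn g'' (Ioo 0 T) :=
    integrableOn_of_integrableOn_rpow_mul_norm (by linarith) hT0 hg'.2.1 hI2
  have hgi : IntegrableOn g (Ioo 0 T) := hgc.integrableOn_Icc.mono_set Ioo_subset_Icc_self
  have hgi' : IntegrableOn g' (Ioo 0 T) := hgc'.integrableOn_Icc.mono_set Ioo_subset_Icc_self
  obtain ⟨D, hD⟩ := isCompact_Icc.exists_bound_of_continuousOn hgc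
  have hg2T : ∀ i, IntervalIntegrable (fun ζ => inner ℝ (v i) (g'' ζ)) volume 0 T := fun i => by
    rw [intervalIntegrable_iff_integrableOn_Ioo_of_le hT0.le]
    exact Integrable.const_inner (v i) hg2i
  -- the error is a convolution with the error kernel in each component
  set e := uh t - cnApprox τ U n with he
  have hcomp : ∀ i, inner ℝ (v i) e =
      ∫ s in (0 : ℝ)..t, k i (t - s) * inner ℝ (v i) (singularSource μ g s) := by
    intro i
    have hmem : v i ∈ X := (b i).2
    rw [he, inner_sub_right, inner_cnApprox, ht]
    refine error_eq_integral_errorKernel (D := ‖v i‖ * D) h0 h1 (hlam i).le hτ hT hμ0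
      (u := fun s => inner ℝ (v i) (uh s)) (f := fun s => inner ℝ (v i) (singularSource μ g s))
      (U := fun k => inner ℝ (v i) (U k)) ?_ ?_ ?_ ?_ ?_ ?_ ?_ ?_ hn1 hn
    · rw [intervalIntegrable_iff_integrableOn_Ioc_of_le hT0.le]
      exact Integrable.const_inner (v i) hu.integrableOn
    · exact continuousOn_const.inner hu.continuousOn
    · exact continuousOn_const.inner (continuousOn_singularSource hgc)
    · intro s hs
      refine (abs_real_inner_le_norm _ _).trans ?_
      rw [mul_assoc]
      gcongr
      exact norm_singularSource_le hD hs
    · intro s hs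
      simp only [singularSource_of_nonpos hs, inner_zero_right]
    · exact hu.inner_equation h1 (intervalIntegrable_singularSource hμ0 hgc le_rfl) hmem (hA i)
    · intro j hj
      simp only [hU.zero j hj, inner_zero_right]
    · exact hU.inner_equation hτ
        (fun t ht => intervalIntegrable_singularSource hμ0 hgc (ht.trans hT.ge)) hmem (hA i)
  have hTay : ∀ i, IntervalIntegrable
      (fun ζ => IsCancellingKernel.peano (k i) μ t ζ * inner ℝ (v i) (g'' ζ)) volume 0 t ∧
      inner ℝ (v i) e = (∫ s in (0 : ℝ)..t, k i (t - s) * s ^ μ) * inner ℝ (v i) (g 0) +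
        (∫ s in (0 : ℝ)..t, k i (t - s) * s ^ (μ + 1)) * inner ℝ (v i) (g' 0) +
        ∫ ζ in (0 : ℝ)..t, IsCancellingKernel.peano (k i) μ t ζ * inner ℝ (v i) (g'' ζ) := by
    intro i
    obtain ⟨t1, t2⟩ := (hkc i).integral_mul_taylor hμ0 ht0
      (γ := fun s => inner ℝ (v i) (g s)) (γ₂ := fun s => inner ℝ (v i) (g'' s))
      (γ₀ := inner ℝ (v i) (g 0)) (γ₁ := inner ℝ (v i) (g' 0))
      ((hg2T i).mono_set (by
        rw [uIcc_of_le ht0.le, uIcc_of_le hT0.le]; exact Icc_subset_Icc le_rfl htT))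
      (fun s hs => eq_taylor_of_hasWeakDeriv hT0 (continuousOn_const.inner hgc)
        (continuousOn_const.inner hgc') (hg2T i) (hg.inner_right hgi hgi' (v i))
        (hg'.inner_right hgi' hg2i (v i)) ⟨hs.1.le, hs.2.trans htT⟩)
    refine ⟨t1, ?_⟩
    rw [← t2, hcomp]
    refine intervalIntegral.integral_congr_ae (ae_of_all _ fun s hs => ?_)
    rw [uIoc_of_le ht0.le] at hs
    rw [singularSource_of_pos hs.1, inner_smul_right]
  have heX : e ∈ X := by
    refine X.sub_mem (hu.mem t ⟨ht0, htT⟩) (X.smul_mem _ ?_)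
    exact X.add_mem (X.sub_mem (X.smul_mem _ (hU.mem _)) (X.smul_mem _ (hU.mem _)))
      (X.smul_mem _ (hU.mem _))
  have hpars : ∑ i, inner ℝ (v i) e ^ 2 = ‖e‖ ^ 2 := by
    have := b.sum_sq_norm_inner_right ⟨e, heX⟩
    simpa [hv] using this
  have hJ1 : IntervalIntegrable (fun ζ => (t - ζ) ^ (α - 1) * ζ ^ μ * ‖g'' ζ‖) volume 0 t :=
    (intervalIntegrable_iff_integrableOn_Ioo_of_le ht0.le).2 (hI1 t ⟨ht0, htT⟩)
  have hJ2 : IntervalIntegrable (fun ζ => ζ ^ ((μ - 1) / 2) * ‖g'' ζ‖) volume 0 t :=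
    (intervalIntegrable_iff_integrableOn_Ioo_of_le ht0.le).2
      (hI2.mono_set (Ioo_subset_Ioo_right htT))
  set w : ℝ → ℝ := fun ζ => c₂ * (C * τ ^ 2) * ((t - ζ) ^ (α - 1) * ζ ^ μ +
    t ^ (α + (μ - 1) / 2) * ζ ^ ((μ - 1) / 2)) with hw
  have hwe : ∀ ζ, w ζ * ‖g'' ζ‖ = c₂ * (C * τ ^ 2) * ((t - ζ) ^ (α - 1) * ζ ^ μ * ‖g'' ζ‖ +
      t ^ (α + (μ - 1) / 2) * (ζ ^ ((μ - 1) / 2) * ‖g'' ζ‖)) := fun ζ => by rw [hw]; ring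
  have hmain := norm_le_of_inner_eq hvo ht0.le hpars
    (A := c₀ * (C * τ ^ 2) * t ^ (α + μ - 2)) (B := c₁ * (C * τ ^ 2) * t ^ (α + μ - 1)) (C := w)
    (fun i => (hkc i).abs_integral_mul_rpow_le h0 h1 hμ0 (by linarith) ht0)
    (fun i => by
      have := (hkc i).abs_integral_mul_rpow_le h0 h1 (by linarith : -1 < μ + 1) (by linarith) ht0
      rwa [← hc₁, show α + (μ + 1) - 2 = α + μ - 1 by ring] at this)
    (by positivity) (by positivity)
    (fun ζ hζ i => (hkc i).abs_integral_mul_rpow_mul_sub_le h0 h1 hμ0 hμ1 hζ.1 hζ.2)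
    (fun ζ hζ => by
      have h2 : 0 < t - ζ := by linarith [hζ.2]
      have h3 := hζ.1
      positivity)
    (fun i => (hTay i).1)
    (by simp_rw [hwe]; exact (hJ1.add (hJ2.const_mul _)).const_mul _)
    (fun i => (hTay i).2)
  simp_rw [hwe] at hmain
  rw [intervalIntegral.integral_const_mul, intervalIntegral.integral_add hJ1 (hJ2.const_mul _),
    intervalIntegral.integral_const_mul] at hmain
  refine hmain.trans ?_
  set I₁ := ∫ ζ in (0 : ℝ)..t, (t - ζ) ^ (α - 1) * ζ ^ μ * ‖g'' ζ‖ with hI₁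
  set I₂ := ∫ ζ in (0 : ℝ)..t, ζ ^ ((μ - 1) / 2) * ‖g'' ζ‖ with hI₂
  have hI₁0 : 0 ≤ I₁ := intervalIntegral.integral_nonneg ht0.le fun ζ hζ => by
    have : 0 ≤ t - ζ := by linarith [hζ.2]
    have := hζ.1
    positivity
  have hI₂0 : 0 ≤ I₂ := intervalIntegral.integral_nonneg ht0.le fun ζ hζ => by
    have := hζ.1
    positivity
  clear_value c₀ c₁ c₂ I₁ I₂
  have k1 : 0 ≤ C * τ ^ 2 * (t ^ (α + μ - 2) * ‖g 0‖) := by positivity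
  have k2 : 0 ≤ C * τ ^ 2 * (t ^ (α + μ - 1) * ‖g' 0‖) := by positivity
  have k3 : 0 ≤ C * τ ^ 2 * (I₁ + t ^ (α + (μ - 1) / 2) * I₂) := by positivity
  have l1 := mul_le_mul_of_nonneg_right (by linarith : c₀ ≤ c₀ + c₁ + c₂) k1
  have l2 := mul_le_mul_of_nonneg_right (by linarith : c₁ ≤ c₀ + c₁ + c₂) k2
  have l3 := mul_le_mul_of_nonneg_right (by linarith : c₂ ≤ c₀ + c₁ + c₂) k3
  linarith

end SubDiffusion

theorem mainTheorem4 (α μ : ℝ) (hα0 : 0 < α) (hα1 : α < 1) (hμ0 : -1 < μ) (hμ1 : μ < 0) :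
    ∃ c : ℝ, 0 < c ∧
      ∀ (d : ℕ) (_ : d = 1 ∨ d = 2)
        (Ω : Set (SubDiffusion.E d)) (_ : SubDiffusion.IsBoundedDomain Ω)
        (a : SubDiffusion.E d → (SubDiffusion.E d →L[ℝ] SubDiffusion.E d))
        (b : SubDiffusion.E d → ℝ) (_ : SubDiffusion.IsPosDefElliptic Ω a b)
        (K : Geometry.SimplicialComplex ℝ (SubDiffusion.E d))
        (_ : SubDiffusion.IsTriangulation Ω K)
        (T : ℝ) (_ : 0 < T)
        -- the source term, with the continuous representatives of g and its weak derivative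
        (g g' g'' : ℝ → SubDiffusion.L2 Ω)
        (_ : SubDiffusion.MemW1Infty T g g') (_ : SubDiffusion.HasWeakDeriv T g' g'')
        (_ : ContinuousOn g (Set.Icc 0 T)) (_ : ContinuousOn g' (Set.Icc 0 T))
        (_ : ∀ t ∈ Set.Ioc 0 T, MeasureTheory.IntegrableOn
          (fun ζ : ℝ => (t - ζ) ^ (α - 1) * ζ ^ μ * ‖g'' ζ‖) (Set.Ioo 0 t))
        (_ : MeasureTheory.IntegrableOn
          (fun ζ : ℝ => ζ ^ ((μ - 1) / 2) * ‖g'' ζ‖) (Set.Ioo 0 T))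
        -- the semidiscrete solution
        (uh : ℝ → SubDiffusion.L2 Ω)
        (_ : SubDiffusion.IsSemidiscreteSolution (SubDiffusion.feSpace Ω K)
          (SubDiffusion.ellipticForm Ω a b) α T 0 (SubDiffusion.singularSource μ g) uh)
        -- the fully discrete solution
        (N : ℕ) (τ : ℝ) (_ : 1 ≤ N) (_ : τ = T / N)
        (U : ℤ → SubDiffusion.L2 Ω)
        (_ : SubDiffusion.IsCNSolution (SubDiffusion.feSpace Ω K)
          (SubDiffusion.ellipticForm Ω a b) α τ N 0 (SubDiffusion.singularSource μ g) U)
        (n : ℕ) (_ : 1 ≤ n) (_ : n ≤ N) (tn : ℝ) (_ : tn = n * τ),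
        ‖uh tn - SubDiffusion.cnApprox τ U n‖ ≤
          c * τ ^ 2 *
            (tn ^ (α + μ - 2) * ‖g 0‖ + tn ^ (α + μ - 1) * ‖g' 0‖
              + (∫ ζ in (0 : ℝ)..tn, (tn - ζ) ^ (α - 1) * ζ ^ μ * ‖g'' ζ‖)
              + tn ^ (α + (μ - 1) / 2) *
                ∫ ζ in (0 : ℝ)..tn, ζ ^ ((μ - 1) / 2) * ‖g'' ζ‖) := by
  obtain ⟨c, hc, H⟩ := SubDiffusion.exists_norm_sub_cnApprox_le hα0 hα1 hμ0 hμ1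
  refine ⟨c, hc, ?_⟩
  intro d _ Ω hΩ a b hA K hK T hT g g' g'' hg hg' hgc hgc' hI1 hI2 uh hu N τ hN hτ U hU n hn1 hn
    tn htn
  have hN0 : (0 : ℝ) < N := by exact_mod_cast hN
  refine H d Ω (SubDiffusion.feSpace Ω K) (SubDiffusion.finiteDimensional_feSpace hΩ hK)
    (SubDiffusion.ellipticForm Ω a b)
    (fun v hv v' hv' w => SubDiffusion.ellipticForm_add_left hΩ hA hv.1 hv'.1 w)
    (fun r v hv w => SubDiffusion.ellipticForm_smul_left hΩ r hv.1 w)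
    (SubDiffusion.ellipticForm_comm hΩ hA) (fun v hv hv0 => hA.pos_def v hv.1 hv0) T g g' g''
    hg.2.2 hg' hgc hgc' hI1 hI2 uh hu N τ ?_ ?_ U hU n hn1 hn tn htn
  · rw [hτ]; positivity
  · rw [hτ]; field_simp
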